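/- Let $\gamma:\mathbb R\to\mathbb R^2$ be a smooth injective curve with $|\gamma'|\equiv1$, $$|\gamma''(t)|^2+|\gamma'''(t)|\le C_0e^{-\beta|t|}\quad(t\in\mathbb R)$$ for some constants $C_0,\beta>0$, and $|\gamma(\pm t)|\to\infty$, $|\gamma(t)-\gamma(-t)|\to\infty$ as $t\to\infty$. Let $c>0$ satisfy $|\gamma(t)-\gamma(s)|\ge c|t-s|$ for all $s,t\in\mathbb R$. Let $K_0,K_1$ be the modified Bessel functions of the second kind. Fix $m_0>0$ and $E_0\in(-m_0,m_0)\setminus\{0\}$, and put $\omega_0=\sqrt{m_0^2-E_0^2}$. For $\lambda\ge1$ set $m=\lambda m_0$, $E=\lambda E_0$, $\omega=\sqrt{m^2-E^2}=\lambda\omega_0$, and $$\mathcal P\rho(t)=\rho(t)+\frac{m^2}{E}\int_{\mathbb R}e^{iE|t-t'|}\rho(t')\,dt',\qquad \mathcal L\mu(t)=\mu(t)-\frac m\pi\int_{\mathbb R}K_0(\omega|\gamma(t)-\gamma(t')|)\,\mu(t')\,dt'.$$ For an integrable, compactly supported source $f:\mathbb R^2\to\mathbb C$ let $$u_i(x)=\frac1{2\pi}\int_{\mathbb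 R^2}K_0(\omega|x-y|)f(y)\,dy .$$ For $\alpha>0$ let $L^2_\alpha=\{\rho\in L^2(\mathbb R;\mathbb C): e^{\alpha|\cdot|}\rho\in L^2(\mathbb R;\mathbb C)\}$. Let $\alpha_*>0$ be such that - $e^{\alpha_*|\cdot|}K_0(\omega_0|\cdot|)\in L^1(\mathbb R)$; - $\displaystyle\int_{\mathbb R^2}\Big(e^{\alpha_*t}e^{\alpha_*s}|t-s|^3e^{-\beta\chi(s,t)}K_1(c\,\omega_0|t-s|)\Big)^2dt\,ds<\infty$, where $\chi(s,t)=\min\{|s|,|t|\}$ if $st>0$ and $\chi(s,t)=0$ otherwise; - $\alpha_*<\sqrt{\tfrac12\big(\sqrt{4m_0^4+E_0^4}-E_0^2\big)}$; - $|t|^3K_1(c|t|)\le Ce^{-\alpha_*|t|}$ for all $t\neq0$, for some $C>0$; - $\alpha_*<\beta$. Then for every $\alpha\in(0,\alpha_*]$ there is a finite set $S\subset\mathbb R$ such that, for every $\lambda\in[1,\infty)\setminus S$ and every integrable, compactly supported $f$, the integral equation $$\mathcal L\mathcal P\rho(t)=2m\,u_i(\gamma(t))\qquad\text{for almost every }t\in\mathbb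 R$$ has a unique solution $\rho\in L^2_\alpha$. -/

import Mathlib

open MeasureTheory Set Filter Topology
open scoped ENNReal

noncomputable section

namespace KleinGordonInterface

/-- The Euclidean plane. -/
abbrev Plane : Type := EuclideanSpace ℝ (Fin 2)

/-- The modified Bessel function of the second kind `K_ν`, for `r > 0`, through the standard
integral representation `K_ν(r) = ∫₀^∞ exp (-r cosh u) cosh (ν u) du`. -/
def besselK (ν r : ℝ) : ℝ :=
  ∫ u in Ioi (0 : ℝ), Real.exp (-(r * Real.cosh u)) * Real.cosh (ν * u)

/-- The decaying Green's function `G_ω(x, y) = K₀(ω |x - y|) / (2π)` of `-Δ + ω²` in the plane. -/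
def green (ω : ℝ) (x y : Plane) : ℝ :=
  (2 * Real.pi)⁻¹ * besselK 0 (ω * ‖x - y‖)

/-- `ω = √(m² - E²)`. -/
def freq (m E : ℝ) : ℝ := Real.sqrt (m ^ 2 - E ^ 2)

/-- The standing assumptions on the interface: `γ` is a smooth injective arclength
parameterization, its curvature decays exponentially with constants `C₀` and `β`, and its two
ends go to infinity and separate from each other. -/
structure IsInterface (γ : ℝ → Plane) (C₀ β : ℝ) : Prop where
  smooth : ContDiff ℝ ((⊤ : ℕ∞) : WithTop ℕ∞) γ
  injective : Function.Injective γ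
  norm_deriv : ∀ t, ‖deriv γ t‖ = 1
  C₀_pos : 0 < C₀
  β_pos : 0 < β
  decay : ∀ t, ‖iteratedDeriv 2 γ t‖ ^ 2 + ‖iteratedDeriv 3 γ t‖
    ≤ C₀ * Real.exp (-(β * |t|))
  tendsto_right : Tendsto (fun t => ‖γ t‖) atTop atTop
  tendsto_left : Tendsto (fun t => ‖γ (-t)‖) atTop atTop
  tendsto_sep : Tendsto (fun t => ‖γ t - γ (-t)‖) atTop atTop

/-- The constant `c > 0` in `|γ(t) - γ(s)| / |t - s| ≥ c`. -/
def IsChordArcConst (γ : ℝ → Plane) (c : ℝ) : Prop :=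
  0 < c ∧ ∀ s t, c * |t - s| ≤ ‖γ t - γ s‖

/-- `χ(s, t) = min (|s|, |t|)` if `s t > 0`, and `0` otherwise. -/
def chi (s t : ℝ) : ℝ := if 0 < s * t then min |s| |t| else 0

/-- The conditions imposed on the largest admissible exponential weight `α_*`. -/
structure IsMaxWeight (m₀ E₀ β c a : ℝ) : Prop where
  pos : 0 < a
  integrable_K0 : Integrable
    (fun t : ℝ => Real.exp (a * |t|) * besselK 0 (freq m₀ E₀ * |t|))
  integrable_K1 : Integrable
    (fun p : ℝ × ℝ => (Real.exp (a * p.1) * Real.exp (a * p.2) * |p.1 - p.2| ^ 3 *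
      Real.exp (-(β * chi p.2 p.1)) * besselK 1 (c * freq m₀ E₀ * |p.1 - p.2|)) ^ 2)
  lt_rate : a < Real.sqrt ((Real.sqrt (4 * m₀ ^ 4 + E₀ ^ 4) - E₀ ^ 2) / 2)
  bound_K1 : ∃ C : ℝ, 0 < C ∧
    ∀ t : ℝ, |t| ^ 3 * besselK 1 (c * |t|) ≤ C * Real.exp (-(a * |t|))
  lt_β : a < β

/-- The weight `w_α(t) = exp (α |t|)`. -/
def weight (α t : ℝ) : ℝ := Real.exp (α * |t|)

/-- `L²_α`: the `ρ ∈ L²(ℝ)` with `w_α ρ ∈ L²(ℝ)`. -/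
def weightedL2 (α : ℝ) : Submodule ℂ (Lp ℂ 2 (volume : Measure ℝ)) where
  carrier := {ρ | MemLp (fun t => (weight α t : ℂ) * ρ t) 2 volume}
  zero_mem' := by
    refine (memLp_congr_ae ?_).2 (MemLp.zero (ε := ℂ))
    filter_upwards [Lp.coeFn_zero ℂ 2 (volume : Measure ℝ)] with t ht
    rw [ht]
    simp
  add_mem' := by
    intro ρ σ hρ hσ
    refine (memLp_congr_ae ?_).1 (MemLp.add hρ hσ)
    filter_upwards [Lp.coeFn_add ρ σ] with t ht
    rw [ht, Pi.add_apply, Pi.add_apply, mul_add]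
  smul_mem' := by
    intro z ρ hρ
    refine (memLp_congr_ae ?_).1 (MemLp.const_smul hρ z)
    filter_upwards [Lp.coeFn_smul z ρ] with t ht
    rw [ht]
    simp only [Pi.smul_apply, smul_eq_mul]
    ring

/-- The single-layer operator on the interface,
`𝒮_ω μ (t) = ∫ G_ω(γ(t), γ(t')) μ(t') dt'`. -/
def singleLayer (γ : ℝ → Plane) (ω : ℝ) (μ : ℝ → ℂ) (t : ℝ) : ℂ :=
  ∫ t', (green ω (γ t) (γ t') : ℂ) * μ t'

/-- `ℒ = 1 - 2 m 𝒮_ω`. -/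
def opL (γ : ℝ → Plane) (m E : ℝ) (μ : ℝ → ℂ) (t : ℝ) : ℂ :=
  μ t - 2 * (m : ℂ) * singleLayer γ (freq m E) μ t

/-- `Q ρ (t) = (m² / E) ∫ exp (i E |t - t'|) ρ(t') dt'`. -/
def opQ (m E : ℝ) (ρ : ℝ → ℂ) (t : ℝ) : ℂ :=
  ((m ^ 2 / E : ℝ) : ℂ) * ∫ t', Complex.exp (Complex.I * ((E * |t - t'| : ℝ) : ℂ)) * ρ t'

/-- `𝒫 = 1 + Q`. -/
def opP (m E : ℝ) (ρ : ℝ → ℂ) (t : ℝ) : ℂ := ρ t + opQ m E ρ t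

/-- The incident field `u_i(x) = ∫ G_ω(x, y) f(y) dy`. -/
def incident (ω : ℝ) (f : Plane → ℂ) (x : Plane) : ℂ :=
  ∫ y, (green ω x y : ℂ) * f y

/-- `ρ` solves the integral equation `ℒ 𝒫 ρ = 2 m u_i` on the interface, as an identity between
(classes of) functions on `ℝ`. -/
def SolvesBIE (γ : ℝ → Plane) (m E : ℝ) (f : Plane → ℂ)
    (ρ : Lp ℂ 2 (volume : Measure ℝ)) : Prop :=
  ∀ᵐ t : ℝ, opL γ m E (opP m E ρ) t = 2 * (m : ℂ) * incident (freq m E) f (γ t)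

end KleinGordonInterface

end

noncomputable section

namespace KleinGordonInterface

/-! ### Integral operators on `L²(ℝ)` with kernels satisfying Schur's condition -/

/-! The proof treats the curved interface as a compact perturbation of a straight line and applies
the analytic Fredholm theorem in `λ`.

Put `σ = w_α ρ`. The wave kernel does not decay, so `𝒫ρ` need not lie in `L²`; what the proof
controls in `L²` is `w_{-α} 𝒫ρ = (W + Q)σ`, where `W` multiplies by `w_α⁻²` and `Q` is the wave
kernel with weight `w_{-α}` on both sides. Let `K` be convolution with `m K₀(ω|·|)/π`, which is `2m`
times the single layer of a straight line, let `K₋ = w_{-α} K w_α` and `K₊ = w_α K w_{-α}`, and let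
`M` be the curved-minus-straight kernel with weight `w_α` on both sides. Multiplied by `w_{-α}`, the
equation reads `(1 - K₋)(W + Q)σ = W(b + M(W + Q)σ)` with `b = w_α · 2m u_i(γ)` (`solvesBIE_iff`).

The straight-line part is inverted by Fourier symbols. `K` has symbol `m/√(η² + ω²)`
(`besselAbs_convolution` is the resulting square-root identity), so `(1 + K)(1 - K)` has symbol `(η²
- E²)/(η² + ω²)`, whose zeros at `η = ±E` cancel the formal poles of `𝒫`. What remains is `1 - a/(η²
+ ω²)` with `a = m²(1 + 2i)`. Its inverse is `1 + a/(η² + b²)` with `b² = -(E² + 2im²)`, that is, 1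
plus convolution with `(a/2b) e^{-b|·|}`. In `flat_equation_iff` this becomes a set of kernel
identities, because `Q` exists only between weights. The equation is then `(1 - B)σ = Tb` with `T =
(1 + G)(1 + K₊)` and `B = T M (W + Q)`.

Chord and arclength differ by `O(e^{-βχ}|t - s|³)`, and increments of `K₀` are bounded by `K₁`.
Hence `M` has a square integrable kernel (`IsInterface.norm_pertKer_le`) and `B` is a limit of
finite rank operators. `B` extends holomorphically to a strip around the real half-line
(`differentiableAt_kerOp`), and `‖B‖ = O(1/λ)`: the factors of `T` are bounded, `M` is `O(λ⁻²)` and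
`W + Q` is `O(λ)`. A Neumann series handles large `λ`, `eventually_isUnit_one_sub` makes the
exceptional points isolated, and compactness of a bounded interval makes them finitely many.

The weight enters through `α < Re b` and two inequalities drawn from the `K₁` integral condition:
`2α_* < β` (`IsMaxWeight.two_mul_lt`) and `α_* < cω₀` (`IsMaxWeight.lt_mul_freq`). -/

/-- The complex Hilbert space `L²(ℝ)`. -/
abbrev L2 : Type := Lp ℂ 2 (volume : Measure ℝ)

/-- Schur's condition with constant `A` on an integral kernel. -/
structure IsSchur (k : ℝ → ℝ → ℂ) (A : ℝ) : Prop where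
  measurable : Measurable (Function.uncurry k)
  nonneg : 0 ≤ A
  row : ∀ t, ∫⁻ s, ‖k t s‖ₑ ≤ ENNReal.ofReal A
  col : ∀ s, ∫⁻ t, ‖k t s‖ₑ ≤ ENNReal.ofReal A

theorem IsSchur.measurable_row {k : ℝ → ℝ → ℂ} {A : ℝ} (h : IsSchur k A) (t : ℝ) :
    Measurable (k t) := h.measurable.of_uncurry_left

theorem IsSchur.measurable_col {k : ℝ → ℝ → ℂ} {A : ℝ} (h : IsSchur k A) (s : ℝ) :
    Measurable (fun t => k t s) := h.measurable.of_uncurry_right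

/-- A kernel dominated by a translation invariant integrable kernel satisfies Schur's condition. -/
theorem IsSchur.of_le_sub {k : ℝ → ℝ → ℂ} {Φ : ℝ → ℝ} (hk : Measurable (Function.uncurry k))
    (hΦ : Integrable Φ) (h : ∀ t s, ‖k t s‖ ≤ Φ (t - s)) : IsSchur k (∫ x, Φ x) := by
  have h0 : ∀ x, 0 ≤ Φ x := fun x => by simpa using (norm_nonneg _).trans (h x 0)
  have hint : ∫⁻ x, ENNReal.ofReal (Φ x) = ENNReal.ofReal (∫ x, Φ x) :=
    (ofReal_integral_eq_lintegral_ofReal hΦ (ae_of_all _ h0)).symm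
  have hle : ∀ t s, ‖k t s‖ₑ ≤ ENNReal.ofReal (Φ (t - s)) := fun t s => by
    rw [← ofReal_norm]
    exact ENNReal.ofReal_le_ofReal (h t s)
  refine ⟨hk, integral_nonneg h0, fun t => ?_, fun s => ?_⟩
  · refine (lintegral_mono (hle t)).trans ?_
    rw [lintegral_sub_left_eq_self (fun x => ENNReal.ofReal (Φ x)) t, hint]
  · refine (lintegral_mono fun t => hle t s).trans ?_
    rw [lintegral_sub_right_eq_self (fun x => ENNReal.ofReal (Φ x)) s, hint]

theorem IsSchur.add {k l : ℝ → ℝ → ℂ} {A B : ℝ} (hk : IsSchur k A) (hl : IsSchur l B) :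
    IsSchur (fun t s => k t s + l t s) (A + B) := by
  refine ⟨hk.measurable.add hl.measurable, add_nonneg hk.nonneg hl.nonneg, fun t => ?_, fun s => ?_⟩
  · rw [ENNReal.ofReal_add hk.nonneg hl.nonneg]
    refine (lintegral_mono fun s => enorm_add_le _ _).trans ?_
    rw [lintegral_add_left (hk.measurable_row t).enorm]
    exact add_le_add (hk.row t) (hl.row t)
  · rw [ENNReal.ofReal_add hk.nonneg hl.nonneg]
    refine (lintegral_mono fun t => enorm_add_le _ _).trans ?_
    rw [lintegral_add_left (hk.measurable_col s).enorm]
    exact add_le_add (hk.col s) (hl.col s)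

theorem IsSchur.const_mul {k : ℝ → ℝ → ℂ} {A : ℝ} (hk : IsSchur k A) (z : ℂ) :
    IsSchur (fun t s => z * k t s) (‖z‖ * A) := by
  have e : ENNReal.ofReal (‖z‖ * A) = ‖z‖ₑ * ENNReal.ofReal A := by
    rw [ENNReal.ofReal_mul (norm_nonneg _), ofReal_norm]
  refine ⟨hk.measurable.const_mul z, mul_nonneg (norm_nonneg _) hk.nonneg, fun t => ?_, fun s => ?_⟩
  · simp only [enorm_mul]
    rw [lintegral_const_mul _ (hk.measurable_row t).enorm, e]
    gcongr
    exact hk.row t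
  · simp only [enorm_mul]
    rw [lintegral_const_mul _ (hk.measurable_col s).enorm, e]
    gcongr
    exact hk.col s

/-- Cauchy-Schwarz with respect to the density `k`. -/
theorem sq_lintegral_mul_le {X : Type*} [MeasurableSpace X] {μ : Measure X} {k f : X → ℝ≥0∞}
    (hk : AEMeasurable k μ) (hf : AEMeasurable f μ) :
    (∫⁻ s, k s * f s ∂μ) ^ 2 ≤ (∫⁻ s, k s ∂μ) * ∫⁻ s, k s * f s ^ 2 ∂μ := by
  have hp : (2 : ℝ).HolderConjugate 2 := Real.HolderConjugate.two_two
  have hkm : AEMeasurable (fun s => k s ^ (1 / 2 : ℝ)) μ := hk.pow_const _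
  have h := ENNReal.lintegral_mul_le_Lp_mul_Lq μ hp hkm (hkm.mul hf)
  have hsq : ∀ x : ℝ≥0∞, (x ^ (1 / 2 : ℝ)) ^ (2 : ℕ) = x := fun x => by
    rw [← ENNReal.rpow_natCast, ← ENNReal.rpow_mul]; norm_num
  have e1 : ∀ s, ((fun s => k s ^ (1 / 2 : ℝ)) * ((fun s => k s ^ (1 / 2 : ℝ)) * f)) s
      = k s * f s := fun s => by
    simp only [Pi.mul_apply, ← mul_assoc, ← pow_two, hsq]
  simp only [e1] at h
  have e2 : ∀ s, (k s ^ (1 / 2 : ℝ)) ^ (2 : ℝ) = k s := fun s => by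
    rw [← ENNReal.rpow_mul]; norm_num
  have e3 : ∀ s, ((fun s => k s ^ (1 / 2 : ℝ)) * f) s ^ (2 : ℝ) = k s * f s ^ 2 := fun s => by
    rw [Pi.mul_apply, ENNReal.mul_rpow_of_nonneg _ _ zero_le_two, e2]
    congr 1
    exact ENNReal.rpow_natCast _ 2
  simp only [e2, e3] at h
  calc (∫⁻ s, k s * f s ∂μ) ^ 2
      ≤ ((∫⁻ s, k s ∂μ) ^ (1 / 2 : ℝ) * (∫⁻ s, k s * f s ^ 2 ∂μ) ^ (1 / 2 : ℝ)) ^ 2 := by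
        gcongr
    _ = _ := by rw [mul_pow, hsq, hsq]

/-- Schur's test: Cauchy-Schwarz with density `|k(t,·)|` uses the row bound, and the column bound
then applies after Tonelli. -/
theorem IsSchur.lintegral_sq_le {k : ℝ → ℝ → ℂ} {A : ℝ} (h : IsSchur k A) {f : ℝ → ℝ≥0∞}
    (hf : AEMeasurable f) :
    ∫⁻ t, (∫⁻ s, ‖k t s‖ₑ * f s) ^ 2 ≤ ENNReal.ofReal A ^ 2 * ∫⁻ s, f s ^ 2 := by
  calc ∫⁻ t, (∫⁻ s, ‖k t s‖ₑ * f s) ^ 2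
      ≤ ∫⁻ t, ENNReal.ofReal A * ∫⁻ s, ‖k t s‖ₑ * f s ^ 2 := by
        refine lintegral_mono fun t => ?_
        refine (sq_lintegral_mul_le (h.measurable_row t).enorm.aemeasurable hf).trans ?_
        gcongr
        exact h.row t
    _ = ENNReal.ofReal A * ∫⁻ t, ∫⁻ s, ‖k t s‖ₑ * f s ^ 2 := by
        rw [lintegral_const_mul' _ _ ENNReal.ofReal_ne_top]
    _ = ENNReal.ofReal A * ∫⁻ s, ∫⁻ t, ‖k t s‖ₑ * f s ^ 2 := by
        rw [lintegral_lintegral_swap]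
        exact h.measurable.enorm.aemeasurable.mul (hf.comp_snd.pow_const 2)
    _ ≤ ENNReal.ofReal A * ∫⁻ s, ENNReal.ofReal A * f s ^ 2 := by
        gcongr with s
        rw [lintegral_mul_const _ (h.measurable_col s).enorm]
        gcongr
        exact h.col s
    _ = _ := by
        rw [lintegral_const_mul' _ _ ENNReal.ofReal_ne_top, pow_two, mul_assoc]

theorem lintegral_enorm_sq_eq (f : ℝ → ℂ) : ∫⁻ t, ‖f t‖ₑ ^ 2 = eLpNorm f 2 volume ^ 2 := by
  rw [eLpNorm_eq_lintegral_rpow_enorm_toReal two_ne_zero ENNReal.ofNat_ne_top,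
    ← ENNReal.rpow_natCast, ← ENNReal.rpow_mul]
  norm_num

/-- The integral operator with kernel `k`, on functions. -/
def kerFun (k : ℝ → ℝ → ℂ) (f : ℝ → ℂ) (t : ℝ) : ℂ := ∫ s, k t s * f s

theorem IsSchur.ae_lintegral_lt_top {k : ℝ → ℝ → ℂ} {A : ℝ} (h : IsSchur k A) {f : ℝ → ℂ}
    (hf : MemLp f 2 volume) : ∀ᵐ t, ∫⁻ s, ‖k t s‖ₑ * ‖f s‖ₑ < ∞ := by
  have hfm : AEMeasurable (fun s => ‖f s‖ₑ) := hf.1.enorm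
  have hle := h.lintegral_sq_le hfm
  rw [lintegral_enorm_sq_eq] at hle
  have hlt : ∫⁻ t, (∫⁻ s, ‖k t s‖ₑ * ‖f s‖ₑ) ^ 2 ≠ ∞ := by
    refine (hle.trans_lt (ENNReal.mul_lt_top (by simp) ?_)).ne
    exact ENNReal.pow_lt_top hf.2
  have hm : AEMeasurable (fun t => (∫⁻ s, ‖k t s‖ₑ * ‖f s‖ₑ) ^ 2) :=
    (AEMeasurable.lintegral_prod_right'
      (f := fun p : ℝ × ℝ => ‖k p.1 p.2‖ₑ * ‖f p.2‖ₑ)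
      (h.measurable.enorm.aemeasurable.mul hfm.comp_snd)).pow_const 2
  filter_upwards [ae_lt_top' hm hlt] with t ht
  by_contra! h'
  rw [top_le_iff] at h'
  simp [h'] at ht

theorem IsSchur.ae_integrable {k : ℝ → ℝ → ℂ} {A : ℝ} (h : IsSchur k A) {f : ℝ → ℂ}
    (hf : MemLp f 2 volume) : ∀ᵐ t, Integrable (fun s => k t s * f s) := by
  filter_upwards [h.ae_lintegral_lt_top hf] with t ht
  refine ⟨(h.measurable_row t).aestronglyMeasurable.mul hf.1, ?_⟩
  simpa only [HasFiniteIntegral, enorm_mul] using ht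

theorem aestronglyMeasurable_kerFun {k : ℝ → ℝ → ℂ} (hk : Measurable (Function.uncurry k))
    {f : ℝ → ℂ} (hf : AEStronglyMeasurable f volume) :
    AEStronglyMeasurable (kerFun k f) volume :=
  AEStronglyMeasurable.integral_prod_right' (f := fun p : ℝ × ℝ => k p.1 p.2 * f p.2)
    (hk.aestronglyMeasurable.mul hf.comp_snd)

theorem IsSchur.eLpNorm_kerFun_le {k : ℝ → ℝ → ℂ} {A : ℝ} (h : IsSchur k A) {f : ℝ → ℂ}
    (hf : AEStronglyMeasurable f volume) :
    eLpNorm (kerFun k f) 2 volume ≤ ENNReal.ofReal A * eLpNorm f 2 volume := by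
  have h1 : eLpNorm (kerFun k f) 2 volume ^ 2 ≤ (ENNReal.ofReal A * eLpNorm f 2 volume) ^ 2 := by
    rw [← lintegral_enorm_sq_eq, mul_pow, ← lintegral_enorm_sq_eq]
    refine le_trans (lintegral_mono fun t => ?_) (h.lintegral_sq_le hf.enorm)
    gcongr
    refine (enorm_integral_le_lintegral_enorm _).trans ?_
    simp only [enorm_mul, le_refl]
  exact (ENNReal.pow_le_pow_left_iff two_ne_zero).1 h1

theorem IsSchur.memLp_kerFun {k : ℝ → ℝ → ℂ} {A : ℝ} (h : IsSchur k A) {f : ℝ → ℂ}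
    (hf : MemLp f 2 volume) : MemLp (kerFun k f) 2 volume :=
  ⟨aestronglyMeasurable_kerFun h.measurable hf.1,
    (h.eLpNorm_kerFun_le hf.1).trans_lt (ENNReal.mul_lt_top ENNReal.ofReal_lt_top hf.2)⟩

theorem kerFun_congr (k : ℝ → ℝ → ℂ) {f g : ℝ → ℂ} (h : f =ᵐ[volume] g) :
    kerFun k f = kerFun k g := by
  ext t
  refine integral_congr_ae ?_
  filter_upwards [h] with s hs
  rw [hs]

open Classical in
/-- The bounded operator on `L²(ℝ)` with kernel `k` (zero if `k` does not satisfy Schur's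
condition). -/
def kerOp (k : ℝ → ℝ → ℂ) : L2 →L[ℂ] L2 :=
  if h : ∃ A, IsSchur k A then
    LinearMap.mkContinuous
      { toFun := fun f => (h.choose_spec.memLp_kerFun (Lp.memLp f)).toLp _
        map_add' := by
          intro f g
          rw [← MemLp.toLp_add, MemLp.toLp_eq_toLp_iff, kerFun_congr k (Lp.coeFn_add f g)]
          filter_upwards [h.choose_spec.ae_integrable (Lp.memLp f),
            h.choose_spec.ae_integrable (Lp.memLp g)] with t hf hg
          simp only [kerFun, Pi.add_apply, mul_add]
          exact integral_add hf hg
        map_smul' := by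
          intro z f
          rw [RingHom.id_apply, ← MemLp.toLp_const_smul, MemLp.toLp_eq_toLp_iff,
            kerFun_congr k (Lp.coeFn_smul z f)]
          refine ae_of_all _ fun t => ?_
          simp only [kerFun, Pi.smul_apply, smul_eq_mul]
          rw [← integral_const_mul]
          refine integral_congr_ae (ae_of_all _ fun s => ?_)
          ring }
      h.choose (by
        intro f
        rw [LinearMap.coe_mk, AddHom.coe_mk, Lp.norm_toLp, Lp.norm_def]
        have h1 := h.choose_spec.eLpNorm_kerFun_le (Lp.memLp f).1
        refine (ENNReal.toReal_mono (ENNReal.mul_ne_top ENNReal.ofReal_ne_top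
          (Lp.memLp f).2.ne) h1).trans ?_
        rw [ENNReal.toReal_mul, ENNReal.toReal_ofReal h.choose_spec.nonneg])
  else 0

/-- The constant picked by choice in `kerOp` enters only the continuity bound, so any Schur constant
may be supplied here. -/
theorem IsSchur.coeFn_kerOp {k : ℝ → ℝ → ℂ} {A : ℝ} (h : IsSchur k A) (f : L2) :
    kerOp k f =ᵐ[volume] kerFun k f := by
  have h' : ∃ A, IsSchur k A := ⟨A, h⟩
  rw [kerOp, dif_pos h']
  exact MemLp.coeFn_toLp (h.memLp_kerFun (Lp.memLp f))

theorem IsSchur.norm_kerOp_le {k : ℝ → ℝ → ℂ} {A : ℝ} (h : IsSchur k A) : ‖kerOp k‖ ≤ A := by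
  refine ContinuousLinearMap.opNorm_le_bound _ h.nonneg fun f => ?_
  rw [Lp.norm_def, Lp.norm_def, eLpNorm_congr_ae (h.coeFn_kerOp f)]
  refine (ENNReal.toReal_mono (ENNReal.mul_ne_top ENNReal.ofReal_ne_top
    (Lp.memLp f).2.ne) (h.eLpNorm_kerFun_le (Lp.memLp f).1)).trans ?_
  rw [ENNReal.toReal_mul, ENNReal.toReal_ofReal h.nonneg]

theorem kerOp_add {k l : ℝ → ℝ → ℂ} {A B : ℝ} (hk : IsSchur k A) (hl : IsSchur l B) :
    kerOp (fun t s => k t s + l t s) = kerOp k + kerOp l := by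
  ext1 f
  refine Lp.ext ?_
  rw [add_apply]
  filter_upwards [(hk.add hl).coeFn_kerOp f, Lp.coeFn_add (kerOp k f) (kerOp l f),
    hk.coeFn_kerOp f, hl.coeFn_kerOp f, hk.ae_integrable (Lp.memLp f),
    hl.ae_integrable (Lp.memLp f)] with t h1 h2 h3 h4 h5 h6
  rw [h1, h2, Pi.add_apply, h3, h4]
  simp only [kerFun, add_mul]
  exact integral_add h5 h6

theorem kerOp_const_mul {k : ℝ → ℝ → ℂ} {A : ℝ} (hk : IsSchur k A) (z : ℂ) :
    kerOp (fun t s => z * k t s) = z • kerOp k := by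
  ext1 f
  refine Lp.ext ?_
  rw [smul_apply]
  filter_upwards [(hk.const_mul z).coeFn_kerOp f, Lp.coeFn_smul z (kerOp k f),
    hk.coeFn_kerOp f] with t h1 h2 h3
  rw [h1, h2, Pi.smul_apply, h3]
  simp only [kerFun, mul_assoc, smul_eq_mul]
  exact integral_const_mul _ _

theorem kerOp_sub {k l : ℝ → ℝ → ℂ} {A B : ℝ} (hk : IsSchur k A) (hl : IsSchur l B) :
    kerOp (fun t s => k t s - l t s) = kerOp k - kerOp l := by
  have h := kerOp_add hk (hl.const_mul (-1))
  rw [kerOp_const_mul hl] at h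
  simpa [sub_eq_add_neg] using h

/-- Composition of integral operators. -/
theorem kerOp_comp {k l p : ℝ → ℝ → ℂ} {A B C : ℝ} (hk : IsSchur k A) (hl : IsSchur l B)
    (hp : IsSchur p C) (h : ∀ t, ∀ᵐ s, ∫ r, k t r * l r s = p t s) :
    kerOp k * kerOp l = kerOp p := by
  ext1 f
  refine Lp.ext ?_
  rw [mul_apply_eq_comp]
  have hfm : AEMeasurable (fun s => ‖f s‖ₑ) := (Lp.memLp f).1.enorm
  -- Justifies Fubini below: the Schur estimate, applied twice to absolute values, makes the triple
  -- product absolutely integrable for almost every `t`.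
  have hfin : ∀ᵐ t, ∫⁻ r, ‖k t r‖ₑ * ∫⁻ s, ‖l r s‖ₑ * ‖f s‖ₑ < ∞ := by
    have hm : AEMeasurable (fun r => ∫⁻ s, ‖l r s‖ₑ * ‖f s‖ₑ) :=
      AEMeasurable.lintegral_prod_right'
        (f := fun p : ℝ × ℝ => ‖l p.1 p.2‖ₑ * ‖f p.2‖ₑ)
        (hl.measurable.enorm.aemeasurable.mul hfm.comp_snd)
    have h1 := hk.lintegral_sq_le hm
    have h2 := hl.lintegral_sq_le hfm
    rw [lintegral_enorm_sq_eq] at h2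
    have h3 : ∫⁻ t, (∫⁻ r, ‖k t r‖ₑ * ∫⁻ s, ‖l r s‖ₑ * ‖f s‖ₑ) ^ 2 ≠ ∞ := by
      refine (h1.trans_lt (ENNReal.mul_lt_top (by simp) (h2.trans_lt ?_))).ne
      exact ENNReal.mul_lt_top (by simp) (ENNReal.pow_lt_top (Lp.memLp f).2)
    have hm' : AEMeasurable (fun t => (∫⁻ r, ‖k t r‖ₑ * ∫⁻ s, ‖l r s‖ₑ * ‖f s‖ₑ) ^ 2) :=
      (AEMeasurable.lintegral_prod_right'
        (f := fun p : ℝ × ℝ => ‖k p.1 p.2‖ₑ * ∫⁻ s, ‖l p.2 s‖ₑ * ‖f s‖ₑ)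
        (hk.measurable.enorm.aemeasurable.mul hm.comp_snd)).pow_const 2
    filter_upwards [ae_lt_top' hm' h3] with t ht
    by_contra! h'
    rw [top_le_iff] at h'
    simp [h'] at ht
  filter_upwards [hk.coeFn_kerOp (kerOp l f), hp.coeFn_kerOp f, hfin] with t h1 h2 h3
  rw [h1, h2, kerFun_congr k (hl.coeFn_kerOp f)]
  simp only [kerFun]
  have hmeas : AEStronglyMeasurable (Function.uncurry fun r s => k t r * (l r s * f s))
      ((volume : Measure ℝ).prod volume) := by
    refine AEStronglyMeasurable.mul ?_ (AEStronglyMeasurable.mul ?_ ?_)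
    · exact ((hk.measurable_row t).comp measurable_fst).aestronglyMeasurable
    · exact hl.measurable.aestronglyMeasurable
    · exact (Lp.memLp f).1.comp_snd
  have hint : Integrable (Function.uncurry fun r s => k t r * (l r s * f s))
      ((volume : Measure ℝ).prod volume) := by
    refine ⟨hmeas, ?_⟩
    rw [HasFiniteIntegral, lintegral_prod _ hmeas.enorm]
    simp only [Function.uncurry_apply_pair, enorm_mul]
    refine lt_of_le_of_lt (lintegral_mono fun r => ?_) h3
    exact (lintegral_const_mul'' (‖k t r‖ₑ)
      ((hl.measurable_row r).enorm.aemeasurable.mul hfm)).le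
  calc ∫ r, k t r * ∫ s, l r s * f s = ∫ r, ∫ s, k t r * (l r s * f s) := by
        simp only [integral_const_mul]
    _ = ∫ s, ∫ r, k t r * (l r s * f s) := integral_integral_swap hint
    _ = ∫ s, p t s * f s := by
        refine integral_congr_ae ?_
        filter_upwards [h t] with s hs
        simp only [← mul_assoc]
        rw [integral_mul_const, hs]

/-! ### Multiplication operators -/

/-- Multiplication by a bounded measurable function preserves `L²`. -/
theorem memLp_mul_of_bound {u : ℝ → ℂ} {A : ℝ} (hu : Measurable u) (hA : ∀ t, ‖u t‖ ≤ A)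
    {f : ℝ → ℂ} (hf : MemLp f 2 volume) : MemLp (fun t => u t * f t) 2 volume := by
  refine MemLp.of_le_mul (c := A) hf (hu.aestronglyMeasurable.mul hf.1) (ae_of_all _ fun t => ?_)
  rw [norm_mul]
  gcongr
  exact hA t

open Classical in
/-- The operator of multiplication by `u` on `L²(ℝ)` (zero if `u` is not bounded measurable). -/
def mulOp (u : ℝ → ℂ) : L2 →L[ℂ] L2 :=
  if h : Measurable u ∧ ∃ A : ℝ, ∀ t, ‖u t‖ ≤ A then
    LinearMap.mkContinuous
      { toFun := fun f => (memLp_mul_of_bound h.1 h.2.choose_spec (Lp.memLp f)).toLp _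
        map_add' := by
          intro f g
          rw [← MemLp.toLp_add, MemLp.toLp_eq_toLp_iff]
          filter_upwards [Lp.coeFn_add f g] with t ht
          simp only [Pi.add_apply, ht, mul_add]
        map_smul' := by
          intro z f
          rw [RingHom.id_apply, ← MemLp.toLp_const_smul, MemLp.toLp_eq_toLp_iff]
          filter_upwards [Lp.coeFn_smul z f] with t ht
          simp only [Pi.smul_apply, ht, smul_eq_mul]
          ring }
      h.2.choose (by
        intro f
        rw [LinearMap.coe_mk, AddHom.coe_mk]
        refine Lp.norm_le_mul_norm_of_ae_le_mul ?_
        filter_upwards [MemLp.coeFn_toLp (memLp_mul_of_bound h.1 h.2.choose_spec (Lp.memLp f))]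
          with t ht
        rw [ht, norm_mul]
        gcongr
        exact h.2.choose_spec t)
  else 0

theorem coeFn_mulOp {u : ℝ → ℂ} {A : ℝ} (hu : Measurable u) (hA : ∀ t, ‖u t‖ ≤ A) (f : L2) :
    mulOp u f =ᵐ[volume] fun t => u t * f t := by
  rw [mulOp, dif_pos ⟨hu, A, hA⟩]
  exact MemLp.coeFn_toLp (memLp_mul_of_bound hu hA (Lp.memLp f))

theorem norm_mulOp_le {u : ℝ → ℂ} {A : ℝ} (hu : Measurable u) (hA : ∀ t, ‖u t‖ ≤ A) :
    ‖mulOp u‖ ≤ A := by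
  refine ContinuousLinearMap.opNorm_le_bound _ ((norm_nonneg _).trans (hA 0)) fun f => ?_
  refine Lp.norm_le_mul_norm_of_ae_le_mul ?_
  filter_upwards [coeFn_mulOp hu hA f] with t ht
  rw [ht, norm_mul]
  gcongr
  exact hA t

theorem mulOp_mul_kerOp {u : ℝ → ℂ} {A B C : ℝ} {k p : ℝ → ℝ → ℂ} (hu : Measurable u)
    (hA : ∀ t, ‖u t‖ ≤ A) (hk : IsSchur k B) (hp : IsSchur p C)
    (h : ∀ t s, u t * k t s = p t s) : mulOp u * kerOp k = kerOp p := by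
  ext1 f
  refine Lp.ext ?_
  rw [mul_apply_eq_comp]
  filter_upwards [coeFn_mulOp hu hA (kerOp k f), hk.coeFn_kerOp f, hp.coeFn_kerOp f]
    with t h1 h2 h3
  rw [h1, h2, h3]
  simp only [kerFun, ← integral_const_mul, ← mul_assoc, h]

theorem kerOp_mul_mulOp {u : ℝ → ℂ} {A B C : ℝ} {k p : ℝ → ℝ → ℂ} (hu : Measurable u)
    (hA : ∀ t, ‖u t‖ ≤ A) (hk : IsSchur k B) (hp : IsSchur p C)
    (h : ∀ t s, k t s * u s = p t s) : kerOp k * mulOp u = kerOp p := by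
  ext1 f
  refine Lp.ext ?_
  rw [mul_apply_eq_comp]
  filter_upwards [hk.coeFn_kerOp (mulOp u f), hp.coeFn_kerOp f] with t h2 h3
  rw [h2, h3, kerFun_congr k (coeFn_mulOp hu hA f)]
  simp only [kerFun, ← mul_assoc, h]

theorem mulOp_injective {u : ℝ → ℂ} {A : ℝ} (hu : Measurable u) (hA : ∀ t, ‖u t‖ ≤ A)
    (h0 : ∀ t, u t ≠ 0) : Function.Injective (mulOp u) := by
  intro f g hfg
  refine Lp.ext ?_
  have h1 := coeFn_mulOp hu hA f
  rw [hfg] at h1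
  filter_upwards [h1, coeFn_mulOp hu hA g] with t ht1 ht2
  exact mul_left_cancel₀ (h0 t) (ht1.symm.trans ht2)

/-! ### Holomorphic families of integral operators -/

/-- Second order Cauchy estimate for the remainder of the first order Taylor expansion. -/
theorem norm_deriv_le_and_norm_taylor_remainder_le {f : ℂ → ℂ} {z₀ : ℂ} {R G : ℝ} (hR : 0 < R)
    (hf : DifferentiableOn ℂ f (Metric.ball z₀ R)) (hG : ∀ z ∈ Metric.ball z₀ R, ‖f z‖ ≤ G) :
    ‖deriv f z₀‖ ≤ 2 * G / R ∧ ∀ z ∈ Metric.ball z₀ R,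
      ‖f z - f z₀ - (z - z₀) * deriv f z₀‖ ≤ 4 / R ^ 2 * G * ‖z - z₀‖ ^ 2 := by
  have hz₀ : z₀ ∈ Metric.ball z₀ R := Metric.mem_ball_self hR
  have hmaps : MapsTo f (Metric.ball z₀ R) (Metric.closedBall (f z₀) (2 * G)) := fun z hz => by
    rw [mem_closedBall_iff_norm]
    linarith [norm_sub_le (f z) (f z₀), hG z hz, hG z₀ hz₀]
  have hg : DifferentiableOn ℂ (dslope f z₀) (Metric.ball z₀ R) :=
    (Complex.differentiableOn_dslope (Metric.ball_mem_nhds z₀ hR)).2 hf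
  -- Schwarz's lemma is used twice: `f - f z₀` is at most `2G`, so the divided difference is at most
  -- `2G/R`; its own increment is at most `4G/R`, so the second divided difference is at most
  -- `4G/R²`.
  have hgb : ∀ z ∈ Metric.ball z₀ R, ‖dslope f z₀ z‖ ≤ 2 * G / R := fun z hz =>
    Complex.norm_dslope_le_div_of_mapsTo_ball hf hmaps hz
  have hmaps' : MapsTo (dslope f z₀) (Metric.ball z₀ R)
      (Metric.closedBall (dslope f z₀ z₀) (4 * G / R)) := fun z hz => by
    rw [mem_closedBall_iff_norm]
    have := norm_sub_le (dslope f z₀ z) (dslope f z₀ z₀)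
    have e : 4 * G / R = 2 * G / R + 2 * G / R := by ring
    linarith [hgb z hz, hgb z₀ hz₀]
  refine ⟨by simpa using hgb z₀ hz₀, fun z hz => ?_⟩
  have h2 := Complex.norm_dslope_le_div_of_mapsTo_ball hg hmaps' hz
  have e1 : f z - f z₀ = (z - z₀) * dslope f z₀ z := by
    simpa using (sub_smul_dslope f z₀ z).symm
  have e2 : dslope f z₀ z - dslope f z₀ z₀ = (z - z₀) * dslope (dslope f z₀) z₀ z := by
    simpa using (sub_smul_dslope (dslope f z₀) z₀ z).symm
  rw [dslope_same] at e2
  have e3 : f z - f z₀ - (z - z₀) * deriv f z₀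
      = (z - z₀) ^ 2 * dslope (dslope f z₀) z₀ z := by
    rw [e1, ← mul_sub, e2]; ring
  rw [e3, norm_mul, norm_pow, mul_comm]
  have e4 : 4 / R ^ 2 * G = 4 * G / R / R := by field_simp
  rw [e4]
  gcongr

/-- Pointwise holomorphy is upgraded to operator norm. The Cauchy estimate turns the majorant `Φ` of
the kernels into a majorant `C|z - z₀|²Φ` of the Taylor remainder, and Schur's test bounds the
remainder operator by its integral. -/
theorem differentiableAt_kerOp {k : ℂ → ℝ → ℝ → ℂ} {z₀ : ℂ} {R : ℝ} (hR : 0 < R) {Φ : ℝ → ℝ}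
    (hΦ : Integrable Φ)
    (hmeas : ∀ z ∈ Metric.ball z₀ R, Measurable (Function.uncurry (k z)))
    (hbound : ∀ z ∈ Metric.ball z₀ R, ∀ t s, ‖k z t s‖ ≤ Φ (t - s))
    (hhol : ∀ t s, DifferentiableOn ℂ (fun z => k z t s) (Metric.ball z₀ R)) :
    DifferentiableAt ℂ (fun z => kerOp (k z)) z₀ := by
  have hz₀ : z₀ ∈ Metric.ball z₀ R := Metric.mem_ball_self hR
  set d : ℝ → ℝ → ℂ := fun t s => deriv (fun z => k z t s) z₀ with hd
  have key := fun t s => norm_deriv_le_and_norm_taylor_remainder_le hR (hhol t s)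
    (fun z hz => hbound z hz t s)
  have hk : ∀ z ∈ Metric.ball z₀ R, IsSchur (k z) (∫ x, Φ x) := fun z hz =>
    IsSchur.of_le_sub (hmeas z hz) hΦ (hbound z hz)
  -- The derivative kernel is a pointwise limit of measurable difference quotients. The steps
  -- `R/(n+2)` stay strictly inside the open ball already for `n = 0`.
  have hdm : Measurable (Function.uncurry d) := by
    have hu : Tendsto (fun n : ℕ => (R / (n + 2 : ℝ) : ℝ)) atTop (𝓝 0) :=
      tendsto_const_nhds.div_atTop
        (tendsto_atTop_add_const_right _ _ tendsto_natCast_atTop_atTop)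
    have hpos : ∀ n : ℕ, 0 < R / (n + 2 : ℝ) := fun n => by positivity
    have hlt : ∀ n : ℕ, R / (n + 2 : ℝ) < R := fun n => by
      rw [div_lt_iff₀ (by positivity)]
      nlinarith [Nat.cast_nonneg (α := ℝ) n]
    have hmem : ∀ n : ℕ, z₀ + (R / (n + 2 : ℝ) : ℝ) ∈ Metric.ball z₀ R := fun n => by
      rw [mem_ball_iff_norm, add_sub_cancel_left, Complex.norm_real, Real.norm_eq_abs,
        abs_of_pos (hpos n)]
      exact hlt n
    refine measurable_of_tendsto_metrizable (f := fun n : ℕ => fun p : ℝ × ℝ =>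
      ((R / (n + 2 : ℝ) : ℝ) : ℂ)⁻¹ * (k (z₀ + (R / (n + 2 : ℝ) : ℝ)) p.1 p.2 - k z₀ p.1 p.2))
      (fun n => ((hmeas _ (hmem n)).sub (hmeas _ hz₀)).const_mul _) ?_
    rw [tendsto_pi_nhds]
    rintro ⟨t, s⟩
    have hder : HasDerivAt (fun z => k z t s) (d t s) z₀ :=
      ((hhol t s).differentiableAt (Metric.ball_mem_nhds z₀ hR)).hasDerivAt
    have := hder.tendsto_slope_zero
    have hc : Tendsto (fun n : ℕ => ((R / (n + 2 : ℝ) : ℝ) : ℂ)) atTop (𝓝[≠] 0) := by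
      refine tendsto_nhdsWithin_iff.2 ⟨?_, Eventually.of_forall fun n => ?_⟩
      · have h0 := (Complex.continuous_ofReal.tendsto 0).comp hu
        rwa [Complex.ofReal_zero] at h0
      · exact Complex.ofReal_ne_zero.2 (hpos n).ne'
    exact this.comp hc
  have hdS : IsSchur d (∫ x, 2 / R * Φ x) :=
    IsSchur.of_le_sub hdm (hΦ.const_mul _) fun t s => by
      refine (key t s).1.trans (le_of_eq ?_)
      ring
  refine HasDerivAt.differentiableAt (f' := kerOp d) ?_
  rw [hasDerivAt_iff_isLittleO]
  have hO : (fun z => kerOp (k z) - kerOp (k z₀) - (z - z₀) • kerOp d)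
      =O[𝓝 z₀] fun z => ‖z - z₀‖ ^ 2 := by
    refine Asymptotics.IsBigO.of_bound (4 / R ^ 2 * ∫ x, Φ x) ?_
    filter_upwards [Metric.ball_mem_nhds z₀ hR] with z hz
    rw [← kerOp_const_mul hdS, ← kerOp_sub (hk z hz) (hk z₀ hz₀),
      ← kerOp_sub (((hmeas z hz).sub (hmeas z₀ hz₀) |> fun hm =>
        IsSchur.of_le_sub (k := fun t s => k z t s - k z₀ t s) (Φ := fun x => Φ x + Φ x) hm
          (hΦ.add hΦ) fun t s => (norm_sub_le _ _).trans
            (add_le_add (hbound z hz t s) (hbound z₀ hz₀ t s)))) (hdS.const_mul _)]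
    have hrm : Measurable (Function.uncurry fun t s =>
        k z t s - k z₀ t s - (z - z₀) * d t s) :=
      ((hmeas z hz).sub (hmeas z₀ hz₀)).sub (hdm.const_mul _)
    have hS := IsSchur.of_le_sub hrm (hΦ.const_mul (4 / R ^ 2 * ‖z - z₀‖ ^ 2)) fun t s =>
      ((key t s).2 z hz).trans (le_of_eq (by ring))
    refine hS.norm_kerOp_le.trans (le_of_eq ?_)
    rw [integral_const_mul, norm_pow, norm_norm]
    ring
  refine hO.trans_isLittleO ?_
  have := Asymptotics.isLittleO_norm_pow_id (E' := ℂ) one_lt_two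
  exact this.comp_tendsto (tendsto_sub_nhds_zero_iff.2 tendsto_id)

/-! ### Hilbert-Schmidt operators -/

/-- An operator is a limit of finite rank operators. -/
def IsFiniteRankLimit {H : Type*} [NormedAddCommGroup H] [NormedSpace ℂ H] (T : H →L[ℂ] H) :
    Prop :=
  ∀ ε : ℝ, 0 < ε → ∃ (n : ℕ) (φ : H →L[ℂ] (Fin n → ℂ)) (v : (Fin n → ℂ) →L[ℂ] H),
    ‖T - v ∘L φ‖ < ε

theorem IsFiniteRankLimit.mul_mul {H : Type*} [NormedAddCommGroup H] [NormedSpace ℂ H]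
    {T : H →L[ℂ] H} (hT : IsFiniteRankLimit T) (X Y : H →L[ℂ] H) :
    IsFiniteRankLimit (X * T * Y) := by
  intro ε hε
  obtain ⟨n, φ, v, h⟩ := hT (ε / ((‖X‖ + 1) * (‖Y‖ + 1))) (by positivity)
  refine ⟨n, φ ∘L Y, X ∘L v, ?_⟩
  have e : X * T * Y - (X ∘L v) ∘L (φ ∘L Y) = X * (T - v ∘L φ) * Y := by
    ext x
    simp [mul_apply_eq_comp]
  rw [e]
  calc ‖X * (T - v ∘L φ) * Y‖ ≤ ‖X‖ * ‖T - v ∘L φ‖ * ‖Y‖ :=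
        (norm_mul_le _ _).trans (mul_le_mul_of_nonneg_right (norm_mul_le _ _) (norm_nonneg _))
    _ ≤ (‖X‖ + 1) * ‖T - v ∘L φ‖ * (‖Y‖ + 1) := by gcongr <;> linarith
    _ < (‖X‖ + 1) * (ε / ((‖X‖ + 1) * (‖Y‖ + 1))) * (‖Y‖ + 1) := by gcongr
    _ = ε := by field_simp

/-- Truncating `T` to finitely many basis vectors leaves a tail which Cauchy-Schwarz and Bessel
bound by the tail of `∑ ‖T (b i)‖²`. -/
theorem isFiniteRankLimit_of_sum_norm_sq_le {H ι : Type*} [NormedAddCommGroup H]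
    [InnerProductSpace ℂ H] (b : HilbertBasis ι ℂ H) {T : H →L[ℂ] H} {D : ℝ}
    (hD : ∀ F : Finset ι, ∑ i ∈ F, ‖T (b i)‖ ^ 2 ≤ D) : IsFiniteRankLimit T := by
  classical
  intro ε hε
  have hsum : Summable fun i => ‖T (b i)‖ ^ 2 :=
    summable_of_sum_le (fun i => sq_nonneg _) hD
  obtain ⟨F, hF⟩ := summable_iff_vanishing_norm.1 hsum ((ε / 2) ^ 2) (by positivity)
  let e := F.equivFin
  let φ : H →L[ℂ] (Fin F.card → ℂ) :=
    ContinuousLinearMap.pi fun j => innerSL ℂ (b (e.symm j))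
  let v : (Fin F.card → ℂ) →L[ℂ] H :=
    ∑ j, (ContinuousLinearMap.proj (R := ℂ) (φ := fun _ : Fin F.card => ℂ) j).smulRight
      (T (b (e.symm j)))
  refine ⟨F.card, φ, v, lt_of_le_of_lt ?_ (half_lt_self hε)⟩
  refine ContinuousLinearMap.opNorm_le_bound _ (by positivity) fun x => ?_
  have hvφ : v (φ x) = ∑ i ∈ F, b.repr x i • T (b i) := by
    simp only [v, φ, sum_apply, ContinuousLinearMap.smulRight_apply,
      ContinuousLinearMap.proj_apply, ContinuousLinearMap.coe_pi', innerSL_apply_apply]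
    rw [← Finset.sum_coe_sort F, ← e.symm.sum_comp]
    simp only [b.repr_apply_apply]
  have hx : HasSum (fun i => b.repr x i • T (b i)) (T x) := by
    simpa using (b.hasSum_repr x).mapL T
  rw [sub_apply, ContinuousLinearMap.comp_apply, hvφ]
  have hlim : Tendsto (fun G : Finset ι => ‖∑ i ∈ G, b.repr x i • T (b i)
      - ∑ i ∈ F, b.repr x i • T (b i)‖) atTop
      (𝓝 ‖T x - ∑ i ∈ F, b.repr x i • T (b i)‖) := (hx.sub_const _).norm
  refine le_of_tendsto hlim ?_
  filter_upwards [eventually_ge_atTop F] with G hG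
  rw [← Finset.sum_sdiff hG, add_sub_cancel_right]
  have h1 : ∑ i ∈ G \ F, ‖T (b i)‖ ^ 2 ≤ (ε / 2) ^ 2 := by
    have := hF (G \ F) Finset.sdiff_disjoint
    rw [Real.norm_eq_abs] at this
    exact (le_abs_self _).trans this.le
  have h2 : ∑ i ∈ G \ F, ‖b.repr x i‖ ^ 2 ≤ ‖x‖ ^ 2 := by
    simp only [b.repr_apply_apply]
    exact b.orthonormal.sum_inner_products_le x
  calc ‖∑ i ∈ G \ F, b.repr x i • T (b i)‖ ≤ ∑ i ∈ G \ F, ‖b.repr x i‖ * ‖T (b i)‖ := by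
        refine (norm_sum_le _ _).trans (Finset.sum_le_sum fun i _ => ?_)
        rw [norm_smul]
    _ ≤ √(∑ i ∈ G \ F, ‖b.repr x i‖ ^ 2) * √(∑ i ∈ G \ F, ‖T (b i)‖ ^ 2) :=
        Real.sum_mul_le_sqrt_mul_sqrt _ _ _
    _ ≤ √(‖x‖ ^ 2) * √((ε / 2) ^ 2) := by gcongr
    _ = ε / 2 * ‖x‖ := by
        rw [Real.sqrt_sq (norm_nonneg _), Real.sqrt_sq (by positivity), mul_comm]

theorem norm_sq_eq_lintegral (f : L2) : ENNReal.ofReal (‖f‖ ^ 2) = ∫⁻ t, ‖f t‖ₑ ^ 2 := by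
  rw [lintegral_enorm_sq_eq, Lp.norm_def, ENNReal.ofReal_pow ENNReal.toReal_nonneg,
    ENNReal.ofReal_toReal (Lp.memLp f).2.ne]

/-- Bessel's inequality for the square integrable function `g`. -/
theorem sum_enorm_integral_sq_le {ι : Type*} {e : ι → L2} (he : Orthonormal ℂ e) (F : Finset ι)
    {g : ℝ → ℂ} (hg : MemLp g 2 volume) :
    ∑ i ∈ F, ‖∫ s, g s * e i s‖ₑ ^ 2 ≤ ∫⁻ s, ‖g s‖ₑ ^ 2 := by
  have hg' : MemLp (fun s => (starRingEnd ℂ) (g s)) 2 volume := hg.star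
  set r : L2 := hg'.toLp _
  have hr : r =ᵐ[volume] fun s => (starRingEnd ℂ) (g s) := MemLp.coeFn_toLp hg'
  have hin : ∀ i, ∫ s, g s * e i s = inner ℂ r (e i) := fun i => by
    rw [L2.inner_def]
    refine integral_congr_ae ?_
    filter_upwards [hr] with s hs
    rw [hs, RCLike.inner_apply, RCLike.conj_conj, mul_comm]
  have h1 : ∑ i ∈ F, ‖inner ℂ (e i) r‖ ^ 2 ≤ ‖r‖ ^ 2 := he.sum_inner_products_le r
  have h2 : ∫⁻ s, ‖g s‖ₑ ^ 2 = ENNReal.ofReal (‖r‖ ^ 2) := by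
    rw [norm_sq_eq_lintegral]
    refine lintegral_congr_ae ?_
    filter_upwards [hr] with s hs
    rw [hs, RCLike.enorm_conj]
  rw [h2]
  refine le_trans (le_of_eq ?_) (ENNReal.ofReal_le_ofReal h1)
  rw [ENNReal.ofReal_sum_of_nonneg fun i _ => sq_nonneg _]
  refine Finset.sum_congr rfl fun i _ => ?_
  rw [hin, ENNReal.ofReal_pow (norm_nonneg _), norm_inner_symm, ofReal_norm]

/-- An operator with square integrable kernel is a limit of finite rank operators. -/
theorem IsSchur.isFiniteRankLimit {k : ℝ → ℝ → ℂ} {A : ℝ} (hk : IsSchur k A)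
    (h2 : ∫⁻ t, ∫⁻ s, ‖k t s‖ₑ ^ 2 ≠ ∞) : IsFiniteRankLimit (kerOp k) := by
  obtain ⟨w, b, -⟩ := exists_hilbertBasis ℂ L2
  refine isFiniteRankLimit_of_sum_norm_sq_le b (D := (∫⁻ t, ∫⁻ s, ‖k t s‖ₑ ^ 2).toReal)
    fun F => ?_
  have hm : Measurable fun t => ∫⁻ s, ‖k t s‖ₑ ^ 2 :=
    Measurable.lintegral_prod_right' (f := fun p : ℝ × ℝ => ‖k p.1 p.2‖ₑ ^ 2)
      (hk.measurable.enorm.pow_const 2)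
  rw [← ENNReal.ofReal_le_iff_le_toReal h2, ENNReal.ofReal_sum_of_nonneg fun i _ => sq_nonneg _]
  have e1 : ∀ i, ENNReal.ofReal (‖kerOp k (b i)‖ ^ 2) = ∫⁻ t, ‖kerFun k (b i) t‖ₑ ^ 2 := fun i => by
    rw [norm_sq_eq_lintegral]
    refine lintegral_congr_ae ?_
    filter_upwards [hk.coeFn_kerOp (b i)] with t ht
    rw [ht]
  simp only [e1]
  rw [← lintegral_finsetSum' _ fun i _ =>
    ((aestronglyMeasurable_kerFun hk.measurable (Lp.memLp (b i)).1).enorm.pow_const 2)]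
  -- For fixed `t` the values of the image functions are the coefficients of the row `k(t,·)`, so
  -- Bessel's inequality applies row by row.
  refine lintegral_mono_ae ?_
  filter_upwards [ae_lt_top hm h2] with t ht
  refine sum_enorm_integral_sq_le b.orthonormal F ⟨(hk.measurable_row t).aestronglyMeasurable, ?_⟩
  rw [lintegral_enorm_sq_eq] at ht
  by_contra! h'
  rw [top_le_iff] at h'
  simp [h'] at ht

/-! ### The analytic Fredholm theorem -/

/-- Sylvester's identity: `1 - vφ` is invertible exactly when the finite matrix `1 - φv` is, each
inverse being explicit in terms of the other. -/
theorem isUnit_one_sub_iff_det_ne_zero {H : Type*} [NormedAddCommGroup H] [NormedSpace ℂ H] {n : ℕ}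
    (φ : H →L[ℂ] (Fin n → ℂ)) (v : (Fin n → ℂ) →L[ℂ] H) :
    IsUnit (1 - v ∘L φ) ↔
      (1 - Matrix.of fun i j => φ (v (Pi.single j 1)) i).det ≠ 0 := by
  set A : Matrix (Fin n) (Fin n) ℂ := Matrix.of fun i j => φ (v (Pi.single j 1)) i with hA
  have hφv : ∀ x, φ (v x) = A.mulVec x := by
    intro x
    have : (φ ∘L v : (Fin n → ℂ) →ₗ[ℂ] (Fin n → ℂ)) = A.toLin' := by
      refine LinearMap.pi_ext' fun j => LinearMap.ext_ring ?_
      ext i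
      simp [hA]
    simpa using congrArg (fun L : (Fin n → ℂ) →ₗ[ℂ] (Fin n → ℂ) => L x) this
  rw [← isUnit_iff_ne_zero, ← Matrix.isUnit_iff_isUnit_det]
  constructor
  · rintro ⟨u, hu⟩
    have h1 : ∀ y, (↑u⁻¹ : H →L[ℂ] H) y - v (φ ((↑u⁻¹ : H →L[ℂ] H) y)) = y := fun y => by
      have := congrArg (fun L : H →L[ℂ] H => L y) u.mul_inv
      rw [hu] at this
      simpa [mul_apply_eq_comp] using this
    have hsurj : Function.Surjective (1 - A).mulVec := by
      intro x
      -- The formula `(1 - φv)⁻¹ = 1 + φ(1 - vφ)⁻¹v`, applied to `x`.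
      refine ⟨x + φ ((↑u⁻¹ : H →L[ℂ] H) (v x)), ?_⟩
      have h2 := congrArg φ (h1 (v x))
      rw [map_sub, hφv, hφv x] at h2
      rw [Matrix.sub_mulVec, Matrix.one_mulVec, Matrix.mulVec_add, ← h2]
      abel
    exact Matrix.mulVec_surjective_iff_isUnit.1 hsurj
  · rintro ⟨u, hu⟩
    set Y : (Fin n → ℂ) →L[ℂ] (Fin n → ℂ) :=
      LinearMap.toContinuousLinearMap (Matrix.toLin' (↑u⁻¹ : Matrix (Fin n) (Fin n) ℂ)) with hY
    have hYx : ∀ x, Y x = (↑u⁻¹ : Matrix (Fin n) (Fin n) ℂ).mulVec x := fun x => by simp [hY]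
    have h1 : ∀ x, Y x - A.mulVec (Y x) = x := fun x => by
      have : (1 - A).mulVec (Y x) = x := by
        rw [hYx, Matrix.mulVec_mulVec, ← hu, u.mul_inv, Matrix.one_mulVec]
      simpa [Matrix.sub_mulVec] using this
    have h2 : ∀ x, Y (x - A.mulVec x) = x := fun x => by
      have : (↑u⁻¹ : Matrix (Fin n) (Fin n) ℂ).mulVec ((1 - A).mulVec x) = x := by
        rw [Matrix.mulVec_mulVec, ← hu, u.inv_mul, Matrix.one_mulVec]
      rw [hYx]
      simpa [Matrix.sub_mulVec] using this
    refine ⟨⟨1 - v ∘L φ, 1 + v ∘L Y ∘L φ, ?_, ?_⟩, rfl⟩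
    · ext y
      have := congrArg v (h1 (φ y))
      rw [map_sub] at this
      simp only [mul_apply_eq_comp, sub_apply, add_apply, one_apply_eq_self,
        ContinuousLinearMap.comp_apply, map_add, hφv]
      rw [← this]
      abel
    · ext y
      have := congrArg v (h2 (φ y))
      rw [map_sub, map_sub] at this
      simp only [mul_apply_eq_comp, sub_apply, add_apply, one_apply_eq_self,
        ContinuousLinearMap.comp_apply, map_sub, hφv]
      rw [← this]
      abel

/-- Near `z₀`, with `N = 1 - (B - vφ)` invertible, `1 - B = N(1 - N⁻¹vφ)` is invertible exactly when
a finite determinant, holomorphic in `z`, is nonzero. Such a function vanishes identically near `z₀`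
or has at most an isolated zero there. -/
theorem eventually_not_isUnit_or_eventually_isUnit {H : Type*} [NormedAddCommGroup H]
    [NormedSpace ℂ H] [CompleteSpace H] {B : ℂ → H →L[ℂ] H} {z₀ : ℂ}
    (hB : ∀ᶠ z in 𝓝 z₀, DifferentiableAt ℂ B z) (hfin : IsFiniteRankLimit (B z₀)) :
    (∀ᶠ z in 𝓝 z₀, ¬ IsUnit (1 - B z)) ∨ ∀ᶠ z in 𝓝[≠] z₀, IsUnit (1 - B z) := by
  obtain ⟨n, φ, v, h⟩ := hfin 1 one_pos
  have hcont : ContinuousAt B z₀ := hB.self_of_nhds.continuousAt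
  have hlt : ∀ᶠ z in 𝓝 z₀, ‖B z - v ∘L φ‖ < 1 :=
    (hcont.sub continuousAt_const).norm.eventually_lt continuousAt_const h
  set N : ℂ → H →L[ℂ] H := fun z => 1 - (B z - v ∘L φ) with hN
  have hNu : ∀ᶠ z in 𝓝 z₀, IsUnit (N z) := hlt.mono fun z hz => isUnit_one_sub_of_norm_lt_one hz
  set f : ℂ → ℂ := fun z =>
    (1 - Matrix.of fun i j => φ (Ring.inverse (N z) (v (Pi.single j 1))) i).det with hf
  have hiff : ∀ᶠ z in 𝓝 z₀, (IsUnit (1 - B z) ↔ f z ≠ 0) := by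
    filter_upwards [hNu] with z hz
    have e : 1 - B z = N z * (1 - (Ring.inverse (N z) ∘L v) ∘L φ) := by
      have h3 : N z * ((Ring.inverse (N z) ∘L v) ∘L φ) = v ∘L φ := by
        have := Ring.mul_inverse_cancel _ hz
        calc N z * ((Ring.inverse (N z) ∘L v) ∘L φ) = (N z * Ring.inverse (N z)) ∘L (v ∘L φ) := rfl
          _ = v ∘L φ := by rw [this]; rfl
      rw [mul_sub, mul_one, h3, hN, sub_sub, sub_add_cancel]
    obtain ⟨u, hu⟩ := hz
    rw [e, ← hu, Units.isUnit_units_mul, hu]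
    exact isUnit_one_sub_iff_det_ne_zero φ (Ring.inverse (N z) ∘L v)
  have hdiff : ∀ᶠ z in 𝓝 z₀, DifferentiableAt ℂ f z := by
    filter_upwards [hB, hNu] with z hz hzu
    have hinv : DifferentiableAt ℂ (fun w => Ring.inverse (N w)) z := by
      have hNd : DifferentiableAt ℂ N z := (differentiableAt_const _).sub (hz.sub_const _)
      exact (differentiableAt_inverse hzu).comp z hNd
    simp only [hf, Matrix.det_apply]
    refine DifferentiableAt.fun_sum fun σ _ => DifferentiableAt.const_smul ?_ _
    refine DifferentiableAt.fun_finsetProd fun i _ => ?_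
    simp only [Matrix.sub_apply, Matrix.of_apply]
    refine (differentiableAt_const _).sub ?_
    let Λ : (H →L[ℂ] H) →L[ℂ] ℂ :=
      (ContinuousLinearMap.proj (R := ℂ) (φ := fun _ : Fin n => ℂ) (σ i)) ∘L φ ∘L
        ContinuousLinearMap.apply ℂ H (v (Pi.single i 1))
    exact Λ.differentiableAt.comp z hinv
  have han : AnalyticAt ℂ f z₀ := by
    obtain ⟨s, hs, hs'⟩ := hdiff.exists_mem
    exact DifferentiableOn.analyticAt (s := s)
      (fun z hz => (hs' z hz).differentiableWithinAt) hs
  rcases han.eventually_eq_zero_or_eventually_ne_zero with h0 | h0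
  · left
    filter_upwards [h0, hiff] with z hz hz'
    simp [hz', hz]
  · right
    filter_upwards [h0, nhdsWithin_le_nhds hiff] with z hz hz'
    exact hz'.2 hz

/-- The analytic Fredholm theorem. -/
theorem eventually_isUnit_one_sub {H : Type*} [NormedAddCommGroup H]
    [NormedSpace ℂ H] [CompleteSpace H] {B : ℂ → H →L[ℂ] H} {U : Set ℂ} (hU : IsOpen U)
    (hU' : IsPreconnected U) (hB : DifferentiableOn ℂ B U)
    (hfin : ∀ z ∈ U, IsFiniteRankLimit (B z)) {z₁ : ℂ} (hz₁ : z₁ ∈ U) (h₁ : IsUnit (1 - B z₁)) :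
    ∀ z ∈ U, ∀ᶠ w in 𝓝[≠] z, IsUnit (1 - B w) := by
  set Z : Set ℂ := {z | ∀ᶠ w in 𝓝 z, ¬ IsUnit (1 - B w)} with hZ
  have hdich : ∀ z ∈ U, z ∈ Z ∨ ∀ᶠ w in 𝓝[≠] z, IsUnit (1 - B w) := fun z hz =>
    eventually_not_isUnit_or_eventually_isUnit
      ((hU.eventually_mem hz).mono fun w hw => hB.differentiableAt (hU.mem_nhds hw)) (hfin z hz)
  have hZo : IsOpen Z := isOpen_iff_eventually.2 fun z hz => hz.eventually_nhds
  set V : Set ℂ := {z | ∀ᶠ w in 𝓝[≠] z, IsUnit (1 - B w)} with hV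
  -- A point `w ≠ z` close to `z` has a full neighbourhood of invertibility, so it lies in `V`. Thus
  -- `Z` and `V` are disjoint open sets covering the connected set `U`.
  have hVo : IsOpen V := isOpen_iff_eventually.2 fun z hz => by
    have h1 : ∀ᶠ w in 𝓝[≠] z, ∀ᶠ x in 𝓝 w, IsUnit (1 - B x) := by
      have := eventually_eventually_nhdsWithin.2 hz
      filter_upwards [this, self_mem_nhdsWithin] with w hw hwz
      rwa [isOpen_compl_singleton.nhdsWithin_eq hwz] at hw
    have h2 : ∀ᶠ w in 𝓝[≠] z, w ∈ V := h1.mono fun w hw => nhdsWithin_le_nhds hw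
    rw [eventually_nhdsWithin_iff] at h2
    filter_upwards [h2] with w hw
    by_cases hwz : w = z
    · rw [hwz]; exact hz
    · exact hw hwz
  have hdisj : Disjoint Z V := by
    rw [Set.disjoint_left]
    intro z hzZ hzV
    have hzZ' : ∀ᶠ w in 𝓝[≠] z, ¬ IsUnit (1 - B w) := nhdsWithin_le_nhds hzZ
    obtain ⟨w, hw⟩ := (hzZ'.and hzV).exists
    exact hw.1 hw.2
  rcases hU'.subset_or_subset hZo hVo hdisj (fun z hz => hdich z hz) with h | h
  · exact absurd h₁ (h hz₁).self_of_nhds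
  · exact h

/-! ### Modified Bessel functions -/

theorem besselK_nonneg (ν r : ℝ) : 0 ≤ besselK ν r :=
  integral_nonneg fun _ => mul_nonneg (Real.exp_pos _).le (Real.cosh_pos _).le

theorem exp_le_two_mul_cosh (u : ℝ) : Real.exp u ≤ 2 * Real.cosh u := by
  rw [Real.cosh_eq]
  linarith [Real.exp_pos (-u)]

theorem inv_cosh_le (u : ℝ) : (Real.cosh u)⁻¹ ≤ 2 * Real.exp (-u) := by
  rw [Real.exp_neg, inv_le_comm₀ (Real.cosh_pos u) (by positivity), mul_inv, inv_inv]
  linarith [exp_le_two_mul_cosh u]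

theorem exp_neg_le_factorial_div_pow (n : ℕ) {y : ℝ} (hy : 0 < y) :
    Real.exp (-y) ≤ n.factorial / y ^ n := by
  rw [Real.exp_neg, inv_le_comm₀ (Real.exp_pos y) (by positivity), inv_div]
  exact Real.pow_div_factorial_le_exp y hy.le n

theorem integrableOn_exp_neg : IntegrableOn (fun u : ℝ => Real.exp (-u)) (Ioi 0) := by
  simpa using exp_neg_integrableOn_Ioi 0 one_pos

/-- The exponent is split: a fraction `κ` is kept as decay in `x`, and the rest is spent through
`e^{-y} ≤ 3!/y³`. This pays for `x⁻³` and leaves two factors `1/cosh u`, one of which gives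
integrability in `u`; hence `12 = 3!·2`. -/
theorem exp_neg_mul_cosh_mul_cosh_le {x κ : ℝ} (hx : 0 < x) (hκ : 0 ≤ κ) (hκ' : κ < 1) (u : ℝ) :
    Real.exp (-(x * Real.cosh u)) * Real.cosh u
      ≤ 12 / (1 - κ) ^ 3 * (x ^ 3)⁻¹ * Real.exp (-(κ * x)) * Real.exp (-u) := by
  have hc := Real.one_le_cosh u
  have h1κ : 0 < 1 - κ := by linarith
  have e : Real.exp (-(x * Real.cosh u)) = Real.exp (-(κ * x * Real.cosh u)) *
      Real.exp (-((1 - κ) * x * Real.cosh u)) := by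
    rw [← Real.exp_add]; ring_nf
  have h1 : Real.exp (-(κ * x * Real.cosh u)) ≤ Real.exp (-(κ * x)) := by
    rw [Real.exp_le_exp]
    nlinarith [mul_nonneg hκ hx.le]
  have h2 := exp_neg_le_factorial_div_pow 3 (y := (1 - κ) * x * Real.cosh u) (by positivity)
  calc _ ≤ Real.exp (-(κ * x)) * ((3 : ℕ).factorial / ((1 - κ) * x * Real.cosh u) ^ 3)
        * Real.cosh u := by
        rw [e]; gcongr
    _ = 6 / (1 - κ) ^ 3 * (x ^ 3)⁻¹ * Real.exp (-(κ * x)) * ((Real.cosh u)⁻¹ * (Real.cosh u)⁻¹) := by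
        have : (Real.cosh u) ≠ 0 := by positivity
        rw [show (((3 : ℕ).factorial : ℕ) : ℝ) = 6 by norm_num [Nat.factorial]]
        field_simp
    _ ≤ 6 / (1 - κ) ^ 3 * (x ^ 3)⁻¹ * Real.exp (-(κ * x)) * (1 * (2 * Real.exp (-u))) := by
        gcongr
        · exact inv_le_one_of_one_le₀ hc
        · exact inv_cosh_le u
    _ = _ := by ring

theorem integrableOn_exp_neg_mul_cosh_mul_cosh {x : ℝ} (hx : 0 < x) :
    IntegrableOn (fun u => Real.exp (-(x * Real.cosh u)) * Real.cosh u) (Ioi 0) := by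
  refine Integrable.mono' (integrableOn_exp_neg.const_mul
    (12 / (1 - 0) ^ 3 * (x ^ 3)⁻¹ * Real.exp (-(0 * x)))) ?_ (ae_of_all _ fun u => ?_)
  · exact (by fun_prop : Continuous fun u => Real.exp (-(x * Real.cosh u)) * Real.cosh u).aestronglyMeasurable
  · rw [Real.norm_of_nonneg (by positivity)]
    exact exp_neg_mul_cosh_mul_cosh_le hx le_rfl one_pos u

theorem integrableOn_exp_neg_mul_cosh {x : ℝ} (hx : 0 < x) :
    IntegrableOn (fun u => Real.exp (-(x * Real.cosh u))) (Ioi 0) := by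
  refine Integrable.mono' (integrableOn_exp_neg_mul_cosh_mul_cosh hx) ?_ (ae_of_all _ fun u => ?_)
  · exact (by fun_prop : Continuous fun u => Real.exp (-(x * Real.cosh u))).aestronglyMeasurable
  · rw [Real.norm_of_nonneg (by positivity)]
    exact le_mul_of_one_le_right (by positivity) (Real.one_le_cosh u)

theorem besselK_one_eq (x : ℝ) :
    besselK 1 x = ∫ u in Ioi (0 : ℝ), Real.exp (-(x * Real.cosh u)) * Real.cosh u := by
  simp [besselK]

theorem besselK_zero_eq (x : ℝ) :
    besselK 0 x = ∫ u in Ioi (0 : ℝ), Real.exp (-(x * Real.cosh u)) := by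
  simp [besselK]

/-- A default value: the integrand is the constant 1, which is not integrable on the half-line, so
the integral is 0. -/
theorem besselK_zero_zero : besselK 0 0 = 0 := by
  simp [besselK, measureReal_def]

/-- Decay of `K₁` together with its behaviour at the origin. -/
theorem pow_three_mul_besselK_one_le {x κ : ℝ} (hx : 0 < x) (hκ : 0 ≤ κ) (hκ' : κ < 1) :
    x ^ 3 * besselK 1 x ≤ 12 / (1 - κ) ^ 3 * Real.exp (-(κ * x)) := by
  have h := setIntegral_mono_on (integrableOn_exp_neg_mul_cosh_mul_cosh hx)
    (integrableOn_exp_neg.const_mul (12 / (1 - κ) ^ 3 * (x ^ 3)⁻¹ * Real.exp (-(κ * x))))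
    measurableSet_Ioi fun u _ => exp_neg_mul_cosh_mul_cosh_le hx hκ hκ' u
  rw [← besselK_one_eq, integral_const_mul, integral_exp_neg_Ioi_zero, mul_one] at h
  calc x ^ 3 * besselK 1 x ≤ x ^ 3 * (12 / (1 - κ) ^ 3 * (x ^ 3)⁻¹ * Real.exp (-(κ * x))) := by
        gcongr
    _ = _ := by field_simp

/-- The exponent `1/4` replaces the logarithmic singularity of `K₀`: its square is still integrable
at the origin, and substituting `y ∼ x e^u` leaves the integrable factor `e^{-u/4}`. -/
theorem exp_neg_le_rpow {y : ℝ} (hy : 0 < y) : Real.exp (-y) ≤ y ^ (-(1 / 4) : ℝ) := by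
  rw [Real.rpow_def_of_pos hy, Real.exp_le_exp]
  linarith [Real.log_le_sub_one_of_pos hy]

/-- Decay of `K₀` together with its behaviour at the origin. -/
theorem besselK_zero_le {κ : ℝ} (hκ : 0 ≤ κ) (hκ' : κ < 1) {x : ℝ} (hx : 0 ≤ x) :
    besselK 0 x ≤ 4 * ((1 - κ) / 2) ^ (-(1 / 4) : ℝ) * (x ^ (-(1 / 4) : ℝ) * Real.exp (-(κ * x))) := by
  have h1κ : 0 < 1 - κ := by linarith
  rcases hx.eq_or_lt with rfl | hx
  · rw [besselK_zero_zero]; positivity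
  have hb : ∀ u : ℝ, Real.exp (-(x * Real.cosh u)) ≤
      ((1 - κ) / 2) ^ (-(1 / 4) : ℝ) * (x ^ (-(1 / 4) : ℝ) * Real.exp (-(κ * x))) *
        Real.exp (-(1 / 4) * u) := fun u => by
    have hc := Real.one_le_cosh u
    have e : Real.exp (-(x * Real.cosh u)) = Real.exp (-(κ * x * Real.cosh u)) *
        Real.exp (-((1 - κ) * x * Real.cosh u)) := by
      rw [← Real.exp_add]; ring_nf
    have h1 : Real.exp (-(κ * x * Real.cosh u)) ≤ Real.exp (-(κ * x)) := by
      rw [Real.exp_le_exp]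
      nlinarith [mul_nonneg hκ hx.le]
    have h2 : Real.exp (-((1 - κ) * x * Real.cosh u)) ≤
        Real.exp (-((1 - κ) / 2 * x * Real.exp u)) := by
      rw [Real.exp_le_exp]
      nlinarith [exp_le_two_mul_cosh u, mul_pos h1κ hx]
    have h3 := exp_neg_le_rpow (y := (1 - κ) / 2 * x * Real.exp u) (by positivity)
    have h4 : ((1 - κ) / 2 * x * Real.exp u) ^ (-(1 / 4) : ℝ) =
        ((1 - κ) / 2) ^ (-(1 / 4) : ℝ) * x ^ (-(1 / 4) : ℝ) * Real.exp (-(1 / 4) * u) := by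
      rw [Real.mul_rpow (by positivity) (by positivity), Real.mul_rpow (by positivity) hx.le,
        ← Real.exp_mul]
      ring_nf
    rw [e]
    calc _ ≤ Real.exp (-(κ * x)) * ((1 - κ) / 2 * x * Real.exp u) ^ (-(1 / 4) : ℝ) := by
          gcongr
          exact h2.trans h3
      _ = _ := by rw [h4]; ring
  have hi : IntegrableOn (fun u : ℝ => Real.exp (-(1 / 4) * u)) (Ioi 0) :=
    exp_neg_integrableOn_Ioi 0 (by norm_num)
  have h := setIntegral_mono_on (integrableOn_exp_neg_mul_cosh hx)
    (hi.const_mul (((1 - κ) / 2) ^ (-(1 / 4) : ℝ) * (x ^ (-(1 / 4) : ℝ) * Real.exp (-(κ * x)))))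
    measurableSet_Ioi fun u _ => hb u
  rw [← besselK_zero_eq, integral_const_mul, integral_exp_mul_Ioi (by norm_num)] at h
  refine h.trans (le_of_eq ?_)
  norm_num
  ring

theorem besselK_one_anti {x y : ℝ} (hx : 0 < x) (hxy : x ≤ y) : besselK 1 y ≤ besselK 1 x := by
  rw [besselK_one_eq, besselK_one_eq]
  refine setIntegral_mono_on (integrableOn_exp_neg_mul_cosh_mul_cosh (hx.trans_le hxy))
    (integrableOn_exp_neg_mul_cosh_mul_cosh hx) measurableSet_Ioi fun u _ => ?_
  have := Real.cosh_pos u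
  gcongr

theorem besselK_zero_anti {x y : ℝ} (hx : 0 < x) (hxy : x ≤ y) : besselK 0 y ≤ besselK 0 x := by
  rw [besselK_zero_eq, besselK_zero_eq]
  refine setIntegral_mono_on (integrableOn_exp_neg_mul_cosh (hx.trans_le hxy))
    (integrableOn_exp_neg_mul_cosh hx) measurableSet_Ioi fun u _ => ?_
  have := Real.cosh_pos u
  gcongr

/-- A lower bound for `K₁` at infinity. -/
theorem exp_neg_div_le_besselK_one {x : ℝ} (hx : 1 ≤ x) :
    Real.exp (-(x + 1)) / x ≤ besselK 1 x := by
  have hx0 : 0 < x := by linarith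
  -- Only `u ≤ 1/x` is kept: there `cosh u ≤ 1 + u²`, hence `x cosh u ≤ x + 1`.
  have hsub : Ioc 0 x⁻¹ ⊆ Ioi (0 : ℝ) := Ioc_subset_Ioi_self
  have hI := integrableOn_exp_neg_mul_cosh_mul_cosh hx0
  have h1 : ∫ u in Ioc 0 x⁻¹, Real.exp (-(x + 1)) ≤
      ∫ u in Ioc 0 x⁻¹, Real.exp (-(x * Real.cosh u)) * Real.cosh u := by
    refine setIntegral_mono_on (by simp) (hI.mono_set hsub) measurableSet_Ioc fun u hu => ?_
    have hxu : x * u ≤ 1 := by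
      calc x * u ≤ x * x⁻¹ := by gcongr; exact hu.2
        _ = 1 := mul_inv_cancel₀ hx0.ne'
    have hu1 : u ≤ 1 := hu.2.trans (inv_le_one_of_one_le₀ hx)
    have hu2 : u ^ 2 / 2 ≤ 1 := by nlinarith [hu.1]
    have h2 := Real.abs_exp_sub_one_le (x := u ^ 2 / 2) (by rw [abs_of_nonneg (by positivity)]; exact hu2)
    rw [abs_of_nonneg (by positivity : 0 ≤ u ^ 2 / 2)] at h2
    have h3 := (Real.cosh_le_exp_half_sq u).trans (by linarith [le_abs_self (Real.exp (u ^ 2 / 2) - 1)] :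
      Real.exp (u ^ 2 / 2) ≤ 1 + u ^ 2)
    have h4 : x * Real.cosh u ≤ x + 1 := by
      calc x * Real.cosh u ≤ x * (1 + u ^ 2) := by gcongr
        _ = x + (x * u) * u := by ring
        _ ≤ x + 1 * 1 := by gcongr; exact hu.1.le
        _ = x + 1 := by ring
    calc Real.exp (-(x + 1)) ≤ Real.exp (-(x * Real.cosh u)) := by
          rw [Real.exp_le_exp]; linarith
      _ ≤ _ := le_mul_of_one_le_right (Real.exp_pos _).le (Real.one_le_cosh u)
  have h2 := setIntegral_mono_set hI (ae_of_all _ fun u => by positivity)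
    hsub.eventuallyLE
  rw [← besselK_one_eq] at h2
  refine le_trans (le_of_eq ?_) (h1.trans h2)
  rw [setIntegral_const, Real.volume_real_Ioc_of_le (by positivity), smul_eq_mul]
  ring

/-! ### Holomorphic extension of `K₀` to the right half-plane. -/

/-- The function `K₀` for a complex argument. -/
def besselKc (z : ℂ) : ℂ := ∫ u in Ioi (0 : ℝ), Complex.exp (-(z * Real.cosh u))

theorem besselKc_ofReal (x : ℝ) : besselKc x = besselK 0 x := by
  rw [besselKc, besselK_zero_eq, ← integral_complex_ofReal]
  push_cast
  rfl

theorem measurable_besselKc : Measurable besselKc := by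
  have : Continuous fun p : ℂ × ℝ => Complex.exp (-(p.1 * Real.cosh p.2)) := by fun_prop
  exact (StronglyMeasurable.integral_prod_right
    (f := fun (z : ℂ) (u : ℝ) => Complex.exp (-(z * Real.cosh u)))
    this.stronglyMeasurable).measurable

theorem norm_cexp_neg_mul_ofReal (z : ℂ) (x : ℝ) :
    ‖Complex.exp (-(z * x))‖ = Real.exp (-(z.re * x)) := by
  rw [Complex.norm_exp]
  simp

theorem integrableOn_cexp_neg_mul_cosh {z : ℂ} (hz : 0 < z.re) :
    IntegrableOn (fun u : ℝ => Complex.exp (-(z * Real.cosh u))) (Ioi 0) := by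
  refine Integrable.mono' (integrableOn_exp_neg_mul_cosh hz) ?_ (ae_of_all _ fun u => ?_)
  · exact (by fun_prop : Continuous fun u : ℝ => Complex.exp (-(z * Real.cosh u))).aestronglyMeasurable
  · rw [norm_cexp_neg_mul_ofReal]

theorem norm_besselKc_le (z : ℂ) : ‖besselKc z‖ ≤ besselK 0 z.re := by
  rw [besselKc, besselK_zero_eq]
  refine (norm_integral_le_integral_norm _).trans (le_of_eq ?_)
  simp only [norm_cexp_neg_mul_ofReal]

theorem differentiableAt_besselKc {z : ℂ} (hz : 0 < z.re) : DifferentiableAt ℂ besselKc z := by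
  have hre : ∀ w ∈ Metric.ball z (z.re / 2), z.re / 2 < w.re := fun w hw => by
    have h1 := (Complex.abs_re_le_norm (w - z)).trans_lt (mem_ball_iff_norm.1 hw)
    rw [Complex.sub_re, abs_lt] at h1
    linarith [h1.1]
  refine (hasDerivAt_integral_of_dominated_loc_of_deriv_le
    (s := Metric.ball z (z.re / 2))
    (F := fun w (u : ℝ) => Complex.exp (-(w * Real.cosh u)))
    (F' := fun w (u : ℝ) => Complex.exp (-(w * Real.cosh u)) * (-(Real.cosh u : ℂ)))
    (bound := fun u => Real.exp (-(z.re / 2 * Real.cosh u)) * Real.cosh u)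
    (Metric.ball_mem_nhds z (by linarith)) ?_ (integrableOn_cexp_neg_mul_cosh hz) ?_ ?_ ?_ ?_).2.differentiableAt
  · exact Eventually.of_forall fun w => (by fun_prop :
      Continuous fun u : ℝ => Complex.exp (-(w * Real.cosh u))).aestronglyMeasurable
  · exact (by fun_prop : Continuous fun u : ℝ =>
      Complex.exp (-(z * Real.cosh u)) * (-(Real.cosh u : ℂ))).aestronglyMeasurable
  · refine ae_of_all _ fun u w hw => ?_
    rw [norm_mul, norm_cexp_neg_mul_ofReal, norm_neg, Complex.norm_real,
      Real.norm_of_nonneg (Real.cosh_pos u).le]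
    have := Real.cosh_pos u
    gcongr
    exact (hre w hw).le
  · exact integrableOn_exp_neg_mul_cosh_mul_cosh (by linarith)
  · refine ae_of_all _ fun u w _ => ?_
    have h1 : HasDerivAt (fun w : ℂ => -(w * Real.cosh u)) (-(Real.cosh u : ℂ)) w := by
      simpa using ((hasDerivAt_id w).mul_const (Real.cosh u : ℂ)).fun_neg
    exact h1.cexp

theorem norm_cexp_sub_cexp_le (z : ℂ) (hz : 0 ≤ z.re) {a b c : ℝ} (hc : 0 ≤ c)
    (hab : a ≤ b) :
    ‖Complex.exp (-(z * ((b * c : ℝ) : ℂ))) - Complex.exp (-(z * ((a * c : ℝ) : ℂ)))‖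
      ≤ ‖z‖ * (b - a) * (Real.exp (-(z.re * a * c)) * c) := by
  have hd : ∀ x : ℝ, HasDerivAt (fun x : ℝ => Complex.exp (-(z * ((x * c : ℝ) : ℂ))))
      (Complex.exp (-(z * ((x * c : ℝ) : ℂ))) * (-(z * c))) x := fun x => by
    have h1 : HasDerivAt (fun x : ℝ => -(z * ((x * c : ℝ) : ℂ))) (-(z * c)) x := by
      have h0 : HasDerivAt (fun x : ℝ => (x : ℂ)) 1 x := (hasDerivAt_id x).ofReal_comp
      have h2 := ((h0.mul_const (c : ℂ)).const_mul z).fun_neg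
      simpa using h2
    exact h1.cexp
  have h := norm_image_sub_le_of_norm_deriv_le_segment' (a := a) (b := b)
    (C := ‖z‖ * (Real.exp (-(z.re * a * c)) * c))
    (fun x _ => (hd x).hasDerivWithinAt) (fun x hx => ?_) b (right_mem_Icc.2 hab)
  · refine h.trans (le_of_eq (by ring))
  · rw [norm_mul, norm_cexp_neg_mul_ofReal, norm_neg, norm_mul, Complex.norm_real,
      Real.norm_of_nonneg hc]
    have h1 : Real.exp (-(z.re * (x * c))) ≤ Real.exp (-(z.re * a * c)) := by
      rw [Real.exp_le_exp]
      nlinarith [mul_nonneg (mul_nonneg hz hc) (sub_nonneg.2 hx.1)]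
    calc _ ≤ Real.exp (-(z.re * a * c)) * (‖z‖ * c) := by gcongr
      _ = _ := by ring

/-- Increments of `K₀` along a ray are controlled by `K₁`. -/
theorem norm_besselKc_sub_le {z : ℂ} (hz : 0 < z.re) {a b : ℝ} (ha : 0 < a) (hab : a ≤ b) :
    ‖besselKc (z * a) - besselKc (z * b)‖ ≤ ‖z‖ * (b - a) * besselK 1 (z.re * a) := by
  have hre : ∀ x : ℝ, (z * x).re = z.re * x := fun x => by simp
  have hI : ∀ x : ℝ, 0 < x →
      IntegrableOn (fun u : ℝ => Complex.exp (-(z * x * Real.cosh u))) (Ioi 0) := fun x hx =>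
    integrableOn_cexp_neg_mul_cosh (by rw [hre]; positivity)
  rw [norm_sub_rev, besselKc, besselKc, besselK_one_eq,
    ← integral_sub (hI b (ha.trans_le hab)) (hI a ha), ← integral_const_mul]
  refine norm_integral_le_of_norm_le
    ((integrableOn_exp_neg_mul_cosh_mul_cosh (by positivity)).const_mul _)
    (ae_of_all _ fun u => ?_)
  have := norm_cexp_sub_cexp_le z hz.le (Real.cosh_pos u).le hab
  simpa only [Complex.ofReal_mul, mul_assoc] using this

/-! ### Convolutions of even exponentials and of `K₀` -/

theorem integrable_comp_abs {E : Type*} [NormedAddCommGroup E] {f : ℝ → E}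
    (hf : IntegrableOn f (Ioi 0)) : Integrable fun x => f |x| := by
  have h1 : IntegrableOn (fun x => f |x|) (Ioi 0) :=
    hf.congr_fun (fun x hx => by rw [abs_of_pos (mem_Ioi.1 hx)]) measurableSet_Ioi
  have h2 : IntegrableOn (fun x => f |x|) (Iic 0) := by
    rw [← Measure.map_neg_eq_self (volume : Measure ℝ)]
    let m : MeasurableEmbedding fun x : ℝ => -x := (Homeomorph.neg ℝ).measurableEmbedding
    rw [m.integrableOn_map_iff]
    simp_rw [Function.comp_def, abs_neg, neg_preimage, neg_Iic, neg_zero]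
    exact Iff.mpr integrableOn_Ici_iff_integrableOn_Ioi h1
  rw [← integrableOn_univ, ← Iic_union_Ioi (a := (0 : ℝ))]
  exact h2.union h1

theorem integrable_exp_neg_mul_abs {a : ℝ} (ha : 0 < a) :
    Integrable fun x : ℝ => Real.exp (-(a * |x|)) :=
  integrable_comp_abs (f := fun x => Real.exp (-(a * x)))
    (by simpa using exp_neg_integrableOn_Ioi 0 ha)

theorem integral_exp_neg_mul_abs {a : ℝ} (ha : 0 < a) :
    ∫ x : ℝ, Real.exp (-(a * |x|)) = 2 / a := by
  rw [integral_comp_abs (f := fun x => Real.exp (-(a * x)))]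
  have := integral_exp_mul_Ioi (a := -a) (by linarith) 0
  simp only [neg_mul] at this
  rw [this]
  simp
  ring

theorem integrable_abs_rpow_mul_exp {a : ℝ} (ha : 0 < a) {p : ℝ} (hp : -1 < p) :
    Integrable fun x : ℝ => |x| ^ p * Real.exp (-(a * |x|)) := by
  refine integrable_comp_abs (f := fun x => x ^ p * Real.exp (-(a * x))) ?_
  have := integrableOn_rpow_mul_exp_neg_mul_rpow (s := p) (p := 1) hp one_pos ha
  simpa using this

/-- The function `exp (-a |x|)`. -/
def expAbs (a : ℂ) (x : ℝ) : ℂ := Complex.exp (-(a * (|x| : ℝ)))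

theorem norm_expAbs (a : ℂ) (x : ℝ) : ‖expAbs a x‖ = Real.exp (-(a.re * |x|)) :=
  norm_cexp_neg_mul_ofReal a |x|

theorem expAbs_neg (a : ℂ) (x : ℝ) : expAbs a (-x) = expAbs a x := by simp [expAbs]

@[fun_prop]
theorem continuous_expAbs (a : ℂ) : Continuous (expAbs a) := by
  unfold expAbs
  fun_prop

theorem integrable_expAbs {a : ℂ} (ha : 0 < a.re) : Integrable (expAbs a) := by
  refine (integrable_exp_neg_mul_abs ha).mono' (continuous_expAbs a).aestronglyMeasurable
    (ae_of_all _ fun x => ?_)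
  rw [norm_expAbs]

theorem integral_exp_mul_I_mul_expAbs {a : ℂ} (ha : 0 < a.re) (η : ℝ) :
    ∫ x : ℝ, Complex.exp (η * x * Complex.I) * expAbs a x = 2 * a / (a ^ 2 + η ^ 2) := by
  have hint : Integrable fun x : ℝ => Complex.exp (η * x * Complex.I) * expAbs a x := by
    refine (integrable_expAbs ha).bdd_mul (c := 1) (by fun_prop) (ae_of_all _ fun x => ?_)
    rw [← Complex.ofReal_mul, Complex.norm_exp_ofReal_mul_I]
  have h1 : ∫ x in Iic (0 : ℝ), Complex.exp (η * x * Complex.I) * expAbs a x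
      = 1 / (a + η * Complex.I) := by
    have h := integral_exp_mul_complex_Iic (a := a + η * Complex.I) (by simpa using ha) 0
    rw [Complex.ofReal_zero, mul_zero, Complex.exp_zero] at h
    rw [← h]
    refine setIntegral_congr_fun measurableSet_Iic fun x hx => ?_
    simp only [expAbs, ← Complex.exp_add, abs_of_nonpos (mem_Iic.1 hx), Complex.ofReal_neg]
    congr 1
    ring
  have h2 : ∫ x in Ioi (0 : ℝ), Complex.exp (η * x * Complex.I) * expAbs a x
      = 1 / (a - η * Complex.I) := by
    have h := integral_exp_mul_complex_Ioi (a := -(a - η * Complex.I)) (by simpa using ha) 0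
    rw [Complex.ofReal_zero, mul_zero, Complex.exp_zero, neg_div_neg_eq] at h
    rw [← h]
    refine setIntegral_congr_fun measurableSet_Ioi fun x hx => ?_
    simp only [expAbs, ← Complex.exp_add, abs_of_pos (mem_Ioi.1 hx)]
    congr 1
    ring
  rw [← intervalIntegral.integral_Iic_add_Ioi hint.integrableOn hint.integrableOn, h1, h2]
  have n1 : a + η * Complex.I ≠ 0 := fun h => by
    have := congrArg Complex.re h
    simp at this
    linarith
  have n2 : a - η * Complex.I ≠ 0 := fun h => by
    have := congrArg Complex.re h
    simp at this
    linarith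
  have e : a ^ 2 + (η : ℂ) ^ 2 = (a + η * Complex.I) * (a - η * Complex.I) := by
    ring_nf
    rw [Complex.I_sq]
    ring
  rw [e]
  field_simp
  ring

/-- Only the sum of the two rates must be positive, so a decaying exponential may be convolved with
the wave `e^{iE|·|}`, whose rate is zero. -/
theorem integrable_expAbs_mul_expAbs {a b : ℂ} (hab : 0 < a.re + b.re) (x : ℝ) :
    Integrable fun y => expAbs a (x - y) * expAbs b y := by
  refine ((integrable_exp_neg_mul_abs hab).const_mul (Real.exp (|a.re| * |x|))).mono'
    (by fun_prop) (ae_of_all _ fun y => ?_)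
  rw [norm_mul, norm_expAbs, norm_expAbs, ← Real.exp_add, ← Real.exp_add, Real.exp_le_exp]
  have h1 : |a.re * (|x - y| - |y|)| ≤ |a.re| * |x| := by
    rw [abs_mul]
    refine mul_le_mul_of_nonneg_left ?_ (abs_nonneg _)
    have := abs_abs_sub_abs_le (x - y) (-y)
    rwa [abs_neg, sub_neg_eq_add, sub_add_cancel] at this
  have h2 := neg_abs_le (a.re * (|x - y| - |y|))
  nlinarith

/-- The resolvent identity for even exponentials. -/
theorem expAbs_convolution {a b : ℂ} (hab : 0 < a.re + b.re) (hne : a ^ 2 ≠ b ^ 2) (x : ℝ) :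
    ∫ y, expAbs a (x - y) * expAbs b y
      = (2 * a * expAbs b x - 2 * b * expAbs a x) / (a ^ 2 - b ^ 2) := by
  have key : ∀ x : ℝ, 0 ≤ x → ∫ y, expAbs a (x - y) * expAbs b y
      = (2 * a * expAbs b x - 2 * b * expAbs a x) / (a ^ 2 - b ^ 2) := by
    intro x hx
    have hint := integrable_expAbs_mul_expAbs hab x
    have hs : a + b ≠ 0 := fun h => by
      have := congrArg Complex.re h
      simp at this
      linarith
    have hd : a - b ≠ 0 := fun h => hne (by
      have : a ^ 2 - b ^ 2 = (a - b) * (a + b) := by ring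
      rw [← sub_eq_zero, this, h, zero_mul])
    have h1 : ∫ y in Iic (0 : ℝ), expAbs a (x - y) * expAbs b y
        = Complex.exp (-(a * x)) / (a + b) := by
      have h := integral_exp_mul_complex_Iic (a := a + b) (by simpa using hab) 0
      rw [Complex.ofReal_zero, mul_zero, Complex.exp_zero] at h
      rw [div_eq_mul_one_div, ← h, ← integral_const_mul]
      refine setIntegral_congr_fun measurableSet_Iic fun y hy => ?_
      have hy' : y ≤ 0 := hy
      simp only [expAbs, ← Complex.exp_add, abs_of_nonpos hy',
        abs_of_nonneg (by linarith : 0 ≤ x - y), Complex.ofReal_neg, Complex.ofReal_sub]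
      congr 1
      ring
    have h2 : ∫ y in (0 : ℝ)..x, expAbs a (x - y) * expAbs b y
        = (Complex.exp (-(b * x)) - Complex.exp (-(a * x))) / (a - b) := by
      have h := integral_exp_mul_complex (a := 0) (b := x) hd
      rw [Complex.ofReal_zero, mul_zero, Complex.exp_zero] at h
      have e : (Complex.exp (-(b * x)) - Complex.exp (-(a * x))) / (a - b)
          = Complex.exp (-(a * x)) * ((Complex.exp ((a - b) * x) - 1) / (a - b)) := by
        rw [← mul_div_assoc, mul_sub, ← Complex.exp_add]
        congr 2
        · congr 1
          ring
        · ring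
      rw [e, ← h, ← intervalIntegral.integral_const_mul]
      refine intervalIntegral.integral_congr fun y hy => ?_
      rw [uIcc_of_le hx] at hy
      simp only [expAbs, ← Complex.exp_add, abs_of_nonneg hy.1,
        abs_of_nonneg (sub_nonneg.2 hy.2), Complex.ofReal_sub]
      congr 1
      ring
    have h3 : ∫ y in Ioi x, expAbs a (x - y) * expAbs b y
        = Complex.exp (-(b * x)) / (a + b) := by
      have h := integral_exp_mul_complex_Ioi (a := -(a + b)) (by simp; linarith) x
      rw [neg_div_neg_eq] at h
      have e : Complex.exp (-(b * x)) / (a + b)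
          = Complex.exp (a * x) * (Complex.exp (-(a + b) * x) / (a + b)) := by
        rw [← mul_div_assoc, ← Complex.exp_add]
        congr 2
        ring
      rw [e, ← h, ← integral_const_mul]
      refine setIntegral_congr_fun measurableSet_Ioi fun y hy => ?_
      have hy' : x < y := hy
      simp only [expAbs, ← Complex.exp_add, abs_of_nonpos (by linarith : x - y ≤ 0),
        abs_of_pos (hx.trans_lt hy'), Complex.ofReal_neg, Complex.ofReal_sub]
      congr 1
      ring
    rw [← intervalIntegral.integral_Iic_add_Ioi hint.integrableOn hint.integrableOn,
      ← intervalIntegral.integral_interval_add_Ioi hint.integrableOn hint.integrableOn, h1, h2, h3]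
    have e : a ^ 2 - b ^ 2 = (a - b) * (a + b) := by ring
    simp only [expAbs, abs_of_nonneg hx]
    rw [e]
    field_simp
    ring
  rcases le_total 0 x with hx | hx
  · exact key x hx
  · have h := key (-x) (by linarith)
    rw [expAbs_neg, expAbs_neg] at h
    rw [← h, ← integral_neg_eq_self]
    refine integral_congr_ae (ae_of_all _ fun y => ?_)
    simp only
    rw [expAbs_neg, ← expAbs_neg a (x - -y)]
    congr 2
    ring

/-! #### The Fourier transform of `K₀` -/

/-- Substituting `sinh u` gives the primitive `(2/S) arctan(ω sinh u / S)`, with `S = √(ω² + η²)`.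
-/
theorem integral_cosh_div {ω : ℝ} (hω : 0 < ω) (η : ℝ) :
    ∫ u in Ioi (0 : ℝ), 2 * (ω * Real.cosh u) / ((ω * Real.cosh u) ^ 2 + η ^ 2)
      = Real.pi / √(ω ^ 2 + η ^ 2) := by
  set S := √(ω ^ 2 + η ^ 2) with hS
  have hS2 : S ^ 2 = ω ^ 2 + η ^ 2 := Real.sq_sqrt (by positivity)
  have hS0 : 0 < S := Real.sqrt_pos.2 (by positivity)
  have hd : ∀ u : ℝ, HasDerivAt (fun u => 2 / S * Real.arctan (ω / S * Real.sinh u))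
      (2 * (ω * Real.cosh u) / ((ω * Real.cosh u) ^ 2 + η ^ 2)) u := fun u => by
    have h := (((Real.hasDerivAt_sinh u).const_mul (ω / S)).arctan).const_mul (2 / S)
    refine h.congr_deriv ?_
    have hc : (ω * Real.cosh u) ^ 2 + η ^ 2 = S ^ 2 * (1 + (ω / S * Real.sinh u) ^ 2) := by
      have := Real.cosh_sq u
      field_simp
      rw [hS2, this]
      ring
    rw [hc]
    field_simp
  have hlim : Tendsto (fun u => 2 / S * Real.arctan (ω / S * Real.sinh u)) atTop
      (𝓝 (2 / S * (Real.pi / 2))) := by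
    refine Tendsto.const_mul _ ?_
    have h1 : Tendsto (fun u => ω / S * Real.sinh u) atTop atTop :=
      Tendsto.const_mul_atTop (by positivity) (tendsto_atTop_mono' _
        ((eventually_ge_atTop 0).mono fun u hu => Real.self_le_sinh_iff.2 hu) tendsto_id)
    exact (Real.tendsto_arctan_atTop.mono_right nhdsWithin_le_nhds).comp h1
  rw [integral_Ioi_of_hasDerivAt_of_nonneg (hd 0).continuousAt.continuousWithinAt
    (fun u _ => hd u) (fun u _ => by have := Real.cosh_pos u; positivity) hlim]
  simp only [Real.sinh_zero, mul_zero, Real.arctan_zero, sub_zero]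
  field_simp

/-- The convolution kernel `K₀(ω |x|) / π`. -/
def besselAbs (ω : ℂ) (x : ℝ) : ℂ := besselKc (ω * (|x| : ℝ)) / Real.pi

theorem measurable_besselAbs (ω : ℂ) : Measurable (besselAbs ω) :=
  (measurable_besselKc.comp (by fun_prop)).div_const _

theorem norm_besselAbs_le {κ : ℝ} (hκ : 0 ≤ κ) (hκ' : κ < 1) {ω : ℂ} (hω : 0 ≤ ω.re) (x : ℝ) :
    ‖besselAbs ω x‖ ≤ 4 * ((1 - κ) / 2) ^ (-(1 / 4) : ℝ) *
      ((ω.re * |x|) ^ (-(1 / 4) : ℝ) * Real.exp (-(κ * (ω.re * |x|)))) := by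
  rw [besselAbs, norm_div, Complex.norm_real, Real.norm_of_nonneg Real.pi_pos.le]
  refine (div_le_self (norm_nonneg _) (by linarith [Real.pi_gt_three])).trans ?_
  refine (norm_besselKc_le _).trans ?_
  have : (ω * (|x| : ℝ)).re = ω.re * |x| := by simp
  rw [this]
  exact besselK_zero_le hκ hκ' (by positivity)

theorem integrable_besselAbs {ω : ℂ} (hω : 0 < ω.re) : Integrable (besselAbs ω) := by
  have h := (integrable_abs_rpow_mul_exp (a := 1 / 2 * ω.re) (by positivity)
    (p := -(1 / 4)) (by norm_num)).const_mul
      (4 * ((1 - (1 / 2 : ℝ)) / 2) ^ (-(1 / 4) : ℝ) * ω.re ^ (-(1 / 4) : ℝ))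
  refine h.mono' (measurable_besselAbs ω).aestronglyMeasurable (ae_of_all _ fun x => ?_)
  refine (norm_besselAbs_le (κ := 1 / 2) (by norm_num) (by norm_num) hω.le x).trans (le_of_eq ?_)
  rw [Real.mul_rpow hω.le (abs_nonneg x)]
  ring_nf

/-- `K₀(ω|x|)` is a superposition of the exponentials `e^{-ω cosh u |x|}`. Fubini transforms each of
them into a Lorentzian, and the integral over `u` is the preceding one. -/
theorem integral_exp_mul_I_mul_besselAbs {ω : ℝ} (hω : 0 < ω) (η : ℝ) :
    ∫ x : ℝ, Complex.exp (η * x * Complex.I) * besselAbs ω x = 1 / √(ω ^ 2 + η ^ 2) := by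
  have hc : ∀ u, 0 < ω * Real.cosh u := fun u => mul_pos hω (Real.cosh_pos u)
  have hb : ∀ x : ℝ, Complex.exp (η * x * Complex.I) * besselAbs ω x
      = (∫ u in Ioi (0 : ℝ), Complex.exp (η * x * Complex.I) *
          expAbs ((ω * Real.cosh u : ℝ) : ℂ) x) * (Real.pi : ℂ)⁻¹ := fun x => by
    have e : ∀ u : ℝ, expAbs ((ω * Real.cosh u : ℝ) : ℂ) x
        = Complex.exp (-((ω : ℂ) * (|x| : ℝ) * Real.cosh u)) := fun u => by
      rw [expAbs]
      congr 1
      push_cast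
      ring
    simp only [e]
    rw [integral_const_mul, besselAbs, besselKc, div_eq_mul_inv]
    ring
  have hint : Integrable (Function.uncurry fun (x u : ℝ) => Complex.exp (η * x * Complex.I) *
      expAbs ((ω * Real.cosh u : ℝ) : ℂ) x)
      ((volume : Measure ℝ).prod (volume.restrict (Ioi 0))) := by
    have hm : Continuous (Function.uncurry fun (x u : ℝ) => Complex.exp (η * x * Complex.I) *
        expAbs ((ω * Real.cosh u : ℝ) : ℂ) x) := by
      unfold expAbs Function.uncurry
      fun_prop
    have hn : ∀ x u : ℝ, ‖Complex.exp (η * x * Complex.I) * expAbs ((ω * Real.cosh u : ℝ) : ℂ) x‖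
        = Real.exp (-(ω * Real.cosh u * |x|)) := fun x u => by
      rw [norm_mul, ← Complex.ofReal_mul, Complex.norm_exp_ofReal_mul_I, norm_expAbs, one_mul,
        Complex.ofReal_re]
    rw [integrable_prod_iff' hm.aestronglyMeasurable]
    simp only [Function.uncurry_apply_pair, hn, integral_exp_neg_mul_abs (hc _)]
    constructor
    · refine ae_of_all _ fun u => ?_
      refine (integrable_exp_neg_mul_abs (hc u)).mono' (by fun_prop) (ae_of_all _ fun x => ?_)
      rw [hn]
    · refine (integrableOn_exp_neg.const_mul (4 / ω)).mono' ?_ (ae_of_all _ fun u => ?_)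
      · exact (by
          refine Continuous.div continuous_const (by fun_prop) fun u => (hc u).ne' :
            Continuous fun u : ℝ => 2 / (ω * Real.cosh u)).aestronglyMeasurable
      · rw [Real.norm_of_nonneg (div_nonneg zero_le_two (hc u).le), div_mul_eq_div_div,
          div_eq_mul_inv]
        calc 2 / ω * (Real.cosh u)⁻¹ ≤ 2 / ω * (2 * Real.exp (-u)) := by
              gcongr
              exact inv_cosh_le u
          _ = _ := by ring
  simp only [hb]
  rw [integral_mul_const, integral_integral_swap hint]
  have e : ∀ u : ℝ, ∫ x : ℝ, Complex.exp (η * x * Complex.I) * expAbs ((ω * Real.cosh u : ℝ) : ℂ) x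
      = ((2 * (ω * Real.cosh u) / ((ω * Real.cosh u) ^ 2 + η ^ 2) : ℝ) : ℂ) := fun u => by
    rw [integral_exp_mul_I_mul_expAbs (by rw [Complex.ofReal_re]; exact hc u)]
    push_cast
    ring
  simp only [e]
  rw [integral_complex_ofReal, integral_cosh_div hω]
  have hpi : (Real.pi : ℂ) ≠ 0 := Complex.ofReal_ne_zero.2 Real.pi_ne_zero
  push_cast
  field_simp

open FourierTransform SchwartzMap in
/-- The Fourier transform is injective on integrable functions. -/
theorem ae_eq_zero_of_fourier_eq_zero {f : ℝ → ℂ} (hf : Integrable f) (h : ∀ ξ, 𝓕 f ξ = 0) :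
    f =ᵐ[volume] 0 := by
  refine ae_eq_zero_of_integral_contDiff_smul_eq_zero hf.locallyIntegrable fun g hg hgc => ?_
  have hg1 : ContDiff ℝ (⊤ : ℕ∞) fun x => (g x : ℂ) := Complex.ofRealCLM.contDiff.comp hg
  have hg2 : HasCompactSupport fun x => (g x : ℂ) := hgc.comp_left (g := fun y : ℝ => (y : ℂ)) (by simp)
  set G : 𝓢(ℝ, ℂ) := hg2.toSchwartzMap hg1 with hG
  have hGψ : 𝓕 (𝓕⁻ G) = G := by simp
  -- Multiplication formula: the test function is the Fourier transform of a Schwartz function, so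
  -- its pairing with `f` equals a pairing with the transform of `f`, which vanishes.
  have hflip := VectorFourier.integral_bilin_fourierIntegral_eq_flip (ContinuousLinearMap.mul ℂ ℂ)
    (L := innerₗ ℝ) (μ := volume) (ν := volume)
    Real.continuous_fourierChar continuous_inner hf (𝓕⁻ G : 𝓢(ℝ, ℂ)).integrable
  have e1 : ∀ ξ, VectorFourier.fourierIntegral Real.fourierChar volume (innerₗ ℝ) f ξ = 0 := h
  have e2 : ∀ x, VectorFourier.fourierIntegral Real.fourierChar volume (innerₗ ℝ).flip
      (⇑(𝓕⁻ G : 𝓢(ℝ, ℂ))) x = (g x : ℂ) := fun x => by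
    have h3 : (𝓕 (𝓕⁻ G)) x = G x := by rw [hGψ]
    rw [SchwartzMap.fourier_coe] at h3
    rw [flip_innerₗ]
    exact h3
  simp only [e1, e2, ContinuousLinearMap.mul_apply', zero_mul, integral_zero] at hflip
  rw [hflip]
  refine integral_congr_ae (ae_of_all _ fun x => ?_)
  simp [mul_comm]

open FourierTransform in
theorem fourier_eq_integral (f : ℝ → ℂ) (ξ : ℝ) :
    𝓕 f ξ = ∫ x : ℝ, Complex.exp ((-2 * Real.pi * ξ : ℝ) * x * Complex.I) * f x := by
  rw [Real.fourier_real_eq_integral_exp_smul]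
  refine integral_congr_ae (ae_of_all _ fun x => ?_)
  simp only [smul_eq_mul]
  congr 2
  push_cast
  ring

/-- `K₀(ω|·|)/π` is a convolution square root of the Green's function of `-d²/dx² + ω²`. -/
theorem besselAbs_convolution {ω : ℝ} (hω : 0 < ω) :
    ∀ᵐ x, ∫ y, besselAbs ω (x - y) * besselAbs ω y = expAbs ω x / (2 * ω) := by
  have hk : Integrable (besselAbs ω) := integrable_besselAbs (by simpa using hω)
  have he : Integrable fun x => expAbs ω x / (2 * ω) :=
    (integrable_expAbs (by simpa using hω)).div_const _
  have hkk := hk.integrable_convolution (ContinuousLinearMap.mul ℂ ℂ) hk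
  have hS : ∀ η : ℝ, (1 / (√(ω ^ 2 + η ^ 2) : ℂ)) * (1 / (√(ω ^ 2 + η ^ 2) : ℂ))
      = 2 * ω / ((ω : ℂ) ^ 2 + η ^ 2) * (1 / (2 * ω)) := fun η => by
    have h1 : (√(ω ^ 2 + η ^ 2) : ℂ) * (√(ω ^ 2 + η ^ 2) : ℂ) = (ω : ℂ) ^ 2 + η ^ 2 := by
      rw [← Complex.ofReal_mul, Real.mul_self_sqrt (by positivity)]
      push_cast
      rfl
    have hω' : (ω : ℂ) ≠ 0 := Complex.ofReal_ne_zero.2 hω.ne'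
    rw [div_mul_div_comm, h1]
    field_simp
  -- The squared symbol `1/(ω² + η²)` is also the transform of the claimed exponential. Injectivity
  -- of the transform identifies the two integrable functions almost everywhere.
  have h0 := ae_eq_zero_of_fourier_eq_zero (hkk.sub he) fun ξ => by
    have h1 := Real.fourier_mul_convolution_eq hk hk ξ
    rw [fourier_eq_integral, fourier_eq_integral, integral_exp_mul_I_mul_besselAbs hω, hS] at h1
    have h2 := integral_exp_mul_I_mul_expAbs (a := ω) (by simpa using hω) (-2 * Real.pi * ξ)
    have hb : ∀ f : ℝ → ℂ, Integrable f → Integrable fun x : ℝ =>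
        Complex.exp ((-2 * Real.pi * ξ : ℝ) * x * Complex.I) * f x := fun f hf => by
      refine hf.bdd_mul (c := 1) (by fun_prop) (ae_of_all _ fun x => ?_)
      rw [← Complex.ofReal_mul, Complex.norm_exp_ofReal_mul_I]
    rw [fourier_eq_integral]
    simp only [Pi.sub_apply, mul_sub]
    rw [integral_sub (hb _ hkk) (hb _ he), h1, ← h2, ← integral_mul_const, sub_eq_zero]
    refine integral_congr_ae (ae_of_all _ fun x => ?_)
    simp only
    ring
  filter_upwards [h0] with x hx
  rw [Pi.sub_apply, Pi.zero_apply, sub_eq_zero, convolution_def] at hx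
  rw [← hx]
  refine integral_congr_ae (ae_of_all _ fun y => ?_)
  simp only [ContinuousLinearMap.mul_apply']
  ring

/-! ### Composition of kernels -/

/-- The kernel of a composition of integral operators. -/
def kerComp (k l : ℝ → ℝ → ℂ) (t s : ℝ) : ℂ := ∫ r, k t r * l r s

theorem IsSchur.comp {k l : ℝ → ℝ → ℂ} {A B : ℝ} (hk : IsSchur k A) (hl : IsSchur l B) :
    IsSchur (kerComp k l) (A * B) := by
  have hm3 : Measurable fun q : (ℝ × ℝ) × ℝ => k q.1.1 q.2 * l q.2 q.1.2 :=
    (hk.measurable.comp (by fun_prop : Measurable fun q : (ℝ × ℝ) × ℝ => (q.1.1, q.2))).mul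
      (hl.measurable.comp (by fun_prop : Measurable fun q : (ℝ × ℝ) × ℝ => (q.2, q.1.2)))
  have hle : ∀ t s, ‖kerComp k l t s‖ₑ ≤ ∫⁻ r, ‖k t r‖ₑ * ‖l r s‖ₑ := fun t s => by
    refine (enorm_integral_le_lintegral_enorm _).trans ?_
    simp only [enorm_mul, le_refl]
  refine ⟨?_, mul_nonneg hk.nonneg hl.nonneg, fun t => ?_, fun s => ?_⟩
  · exact (StronglyMeasurable.integral_prod_right
      (f := fun (p : ℝ × ℝ) (r : ℝ) => k p.1 r * l r p.2) hm3.stronglyMeasurable).measurable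
  · refine (lintegral_mono (hle t)).trans ?_
    rw [lintegral_lintegral_swap]
    · calc ∫⁻ r, ∫⁻ s, ‖k t r‖ₑ * ‖l r s‖ₑ ≤ ∫⁻ r, ‖k t r‖ₑ * ENNReal.ofReal B := by
            gcongr with r
            rw [lintegral_const_mul _ (hl.measurable_row r).enorm]
            gcongr
            exact hl.row r
        _ ≤ ENNReal.ofReal A * ENNReal.ofReal B := by
            rw [lintegral_mul_const _ (hk.measurable_row t).enorm]
            gcongr
            exact hk.row t
        _ = _ := (ENNReal.ofReal_mul hk.nonneg).symm
    · exact (((hk.measurable_row t).enorm.comp measurable_snd).mul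
        (hl.measurable.enorm.comp measurable_swap)).aemeasurable
  · refine (lintegral_mono fun t => hle t s).trans ?_
    rw [lintegral_lintegral_swap]
    · calc ∫⁻ r, ∫⁻ t, ‖k t r‖ₑ * ‖l r s‖ₑ ≤ ∫⁻ r, ENNReal.ofReal A * ‖l r s‖ₑ := by
            gcongr with r
            rw [lintegral_mul_const _ (hk.measurable_col r).enorm]
            gcongr
            exact hk.col r
        _ ≤ ENNReal.ofReal A * ENNReal.ofReal B := by
            rw [lintegral_const_mul _ (hl.measurable_col s).enorm]
            gcongr
            exact hl.col s
        _ = _ := (ENNReal.ofReal_mul hk.nonneg).symm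
    · exact (hk.measurable.enorm.mul
        ((hl.measurable_col s).enorm.comp measurable_snd)).aemeasurable

theorem kerOp_mul_kerOp {k l : ℝ → ℝ → ℂ} {A B : ℝ} (hk : IsSchur k A) (hl : IsSchur l B) :
    kerOp k * kerOp l = kerOp (kerComp k l) :=
  kerOp_comp hk hl (hk.comp hl) fun _ => ae_of_all _ fun _ => rfl

/-! ### Weighted convolution kernels -/

theorem weight_pos (α t : ℝ) : 0 < weight α t := Real.exp_pos _

@[fun_prop]
theorem continuous_weight (α : ℝ) : Continuous (weight α) := by
  unfold weight
  fun_prop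

theorem weight_mul (α β t : ℝ) : weight α t * weight β t = weight (α + β) t := by
  rw [weight, weight, weight, ← Real.exp_add]
  ring_nf

theorem weight_neg_mul (α t : ℝ) : (weight (-α) t : ℂ) * weight α t = 1 := by
  rw [← Complex.ofReal_mul, weight_mul]
  simp [weight]

theorem weight_mul_neg (α t : ℝ) : (weight α t : ℂ) * weight (-α) t = 1 := by
  rw [mul_comm, weight_neg_mul]

theorem norm_weight (α t : ℝ) : ‖(weight α t : ℂ)‖ = weight α t := by
  rw [Complex.norm_real, Real.norm_of_nonneg (weight_pos α t).le]

/-- The kernel `exp (α₁ |t|) φ(t - s) exp (α₂ |s|)`. -/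
def wker (α₁ α₂ : ℝ) (φ : ℝ → ℂ) (t s : ℝ) : ℂ := weight α₁ t * φ (t - s) * weight α₂ s

theorem measurable_wker {φ : ℝ → ℂ} (hφ : Measurable φ) (α₁ α₂ : ℝ) :
    Measurable (Function.uncurry (wker α₁ α₂ φ)) := by
  unfold Function.uncurry wker
  refine Measurable.mul (Measurable.mul ?_ ?_) ?_
  · exact (by fun_prop : Continuous fun a : ℝ × ℝ => (weight α₁ a.1 : ℂ)).measurable
  · exact hφ.comp (by fun_prop)
  · exact (by fun_prop : Continuous fun a : ℝ × ℝ => (weight α₂ a.2 : ℂ)).measurable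

/-- Since `||t| - |s|| ≤ |t - s|`, opposite weights cost at most `e^{α|t-s|}`, which a convolution
kernel decaying faster than rate `α` absorbs. -/
theorem norm_wker_neg_le {α α₁ : ℝ} (h : |α₁| ≤ α) (φ : ℝ → ℂ) (t s : ℝ) :
    ‖wker α₁ (-α₁) φ t s‖ ≤ Real.exp (α * |t - s|) * ‖φ (t - s)‖ := by
  rw [wker, norm_mul, norm_mul, norm_weight, norm_weight, mul_right_comm]
  gcongr
  rw [weight, weight, ← Real.exp_add, Real.exp_le_exp]
  calc α₁ * |t| + -α₁ * |s| = α₁ * (|t| - |s|) := by ring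
    _ ≤ |α₁| * |(|t| - |s|)| := by rw [← abs_mul]; exact le_abs_self _
    _ ≤ α * |t - s| := mul_le_mul h (abs_abs_sub_abs_le t s) (abs_nonneg _)
        ((abs_nonneg _).trans h)

/-- Since `|t - s| ≤ |t| + |s|`, decaying weights on both sides yield `e^{-α|t-s|}`. This is what
makes the wave kernel bounded on `L²`. -/
theorem norm_wker_neg_neg_le {α : ℝ} (h : 0 ≤ α) (φ : ℝ → ℂ) (t s : ℝ) :
    ‖wker (-α) (-α) φ t s‖ ≤ Real.exp (-(α * |t - s|)) * ‖φ (t - s)‖ := by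
  rw [wker, norm_mul, norm_mul, norm_weight, norm_weight, mul_right_comm]
  gcongr
  rw [weight, weight, ← Real.exp_add, Real.exp_le_exp]
  nlinarith [abs_sub t s]

theorem isSchur_wker_neg {α α₁ : ℝ} (h : |α₁| ≤ α) {φ : ℝ → ℂ} (hφ : Measurable φ)
    (hi : Integrable fun x => Real.exp (α * |x|) * ‖φ x‖) :
    IsSchur (wker α₁ (-α₁) φ) (∫ x, Real.exp (α * |x|) * ‖φ x‖) :=
  IsSchur.of_le_sub (measurable_wker hφ _ _) hi (norm_wker_neg_le h φ)

theorem isSchur_wker_neg_neg {α : ℝ} (h : 0 ≤ α) {φ : ℝ → ℂ} (hφ : Measurable φ)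
    (hi : Integrable fun x => Real.exp (-(α * |x|)) * ‖φ x‖) :
    IsSchur (wker (-α) (-α) φ) (∫ x, Real.exp (-(α * |x|)) * ‖φ x‖) :=
  IsSchur.of_le_sub (measurable_wker hφ _ _) hi (norm_wker_neg_neg_le h φ)

/-- The inner weights cancel, so only the outer weights and the convolution of the two profiles
remain. -/
theorem kerComp_wker (α₁ β β' α₂ : ℝ) (hβ : β + β' = 0) (φ ψ : ℝ → ℂ) (t s : ℝ) :
    kerComp (wker α₁ β φ) (wker β' α₂ ψ) t s
      = weight α₁ t * (∫ y, φ (t - s - y) * ψ y) * weight α₂ s := by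
  obtain rfl : β' = -β := by linarith
  have e : ∀ r, wker α₁ β φ t r * wker (-β) α₂ ψ r s
      = weight α₁ t * (φ (t - s - (r - s)) * ψ (r - s)) * weight α₂ s := fun r => by
    rw [wker, wker, sub_sub_sub_cancel_right]
    linear_combination (weight α₁ t * φ (t - r) * ψ (r - s) * weight α₂ s : ℂ) * weight_mul_neg β r
  simp only [kerComp, e]
  rw [integral_mul_const, integral_const_mul,
    integral_sub_right_eq_self (fun y => φ (t - s - y) * ψ y) s]

/-- Convolutions commute whatever the cancelling inner weights are. This moves `K` past `Q`, turning
`K₋` on the left into `K₊` on the right. -/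
theorem kerComp_wker_comm (α₁ β β' γ γ' α₂ : ℝ) (hβ : β + β' = 0) (hγ : γ + γ' = 0)
    (φ ψ : ℝ → ℂ) :
    kerComp (wker α₁ β φ) (wker β' α₂ ψ) = kerComp (wker α₁ γ ψ) (wker γ' α₂ φ) := by
  ext t s
  rw [kerComp_wker _ _ _ _ hβ, kerComp_wker _ _ _ _ hγ]
  congr 2
  rw [← integral_sub_left_eq_self _ _ (t - s)]
  refine integral_congr_ae (ae_of_all _ fun y => ?_)
  simp only [sub_sub_cancel]
  ring

/-- Composition of weighted convolution operators. -/
theorem kerOp_wker_mul {α₁ β β' α₂ A B C : ℝ} (hβ : β + β' = 0) {φ ψ χ : ℝ → ℂ}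
    (hφ : IsSchur (wker α₁ β φ) A) (hψ : IsSchur (wker β' α₂ ψ) B) (hχ : IsSchur (wker α₁ α₂ χ) C)
    (h : ∀ᵐ x, ∫ y, φ (x - y) * ψ y = χ x) :
    kerOp (wker α₁ β φ) * kerOp (wker β' α₂ ψ) = kerOp (wker α₁ α₂ χ) := by
  refine kerOp_comp hφ hψ hχ fun t => ?_
  have h' : ∀ᵐ s : ℝ, ∫ y, φ (t - s - y) * ψ y = χ (t - s) :=
    (Measure.measurePreserving_sub_left volume t).quasiMeasurePreserving.ae h
  filter_upwards [h'] with s hs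
  have := kerComp_wker α₁ β β' α₂ hβ φ ψ t s
  rw [kerComp] at this
  rw [this, hs, wker]

/-! ### Inversion of the flat operator -/

theorem integrable_exp_mul_norm_besselAbs {α : ℝ} {ω : ℂ} (hα : 0 < α) (hω : α < ω.re) :
    Integrable fun x => Real.exp (α * |x|) * ‖besselAbs ω x‖ := by
  obtain ⟨κ, hκ1, hκ2⟩ := exists_between ((div_lt_one (hα.trans hω)).2 hω)
  have hω0 : 0 < ω.re := hα.trans hω
  have hκ0 : 0 < κ := (div_pos hα hω0).trans hκ1
  rw [div_lt_iff₀ hω0] at hκ1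
  have h := (integrable_abs_rpow_mul_exp (a := κ * ω.re - α) (by linarith)
    (p := -(1 / 4)) (by norm_num)).const_mul
      (4 * ((1 - κ) / 2) ^ (-(1 / 4) : ℝ) * ω.re ^ (-(1 / 4) : ℝ))
  refine h.mono' ?_ (ae_of_all _ fun x => ?_)
  · exact ((by fun_prop : Continuous fun x : ℝ => Real.exp (α * |x|)).measurable.mul
      (measurable_besselAbs ω).norm).aestronglyMeasurable
  · rw [Real.norm_of_nonneg (by positivity)]
    have e : Real.exp (-((κ * ω.re - α) * |x|))
        = Real.exp (α * |x|) * Real.exp (-(κ * (ω.re * |x|))) := by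
      rw [← Real.exp_add]
      ring_nf
    calc _ ≤ Real.exp (α * |x|) * (4 * ((1 - κ) / 2) ^ (-(1 / 4) : ℝ) *
          ((ω.re * |x|) ^ (-(1 / 4) : ℝ) * Real.exp (-(κ * (ω.re * |x|))))) := by
          gcongr
          exact norm_besselAbs_le hκ0.le hκ2 hω0.le x
      _ = _ := by
          rw [Real.mul_rpow hω0.le (abs_nonneg x), e]
          ring

theorem integrable_exp_mul_norm_expAbs {α : ℝ} {b : ℂ} (h : α < b.re) :
    Integrable fun x => Real.exp (α * |x|) * ‖expAbs b x‖ := by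
  refine (integrable_exp_neg_mul_abs (sub_pos.2 h)).congr (ae_of_all _ fun x => ?_)
  simp only [norm_expAbs, ← Real.exp_add]
  ring_nf

theorem integrable_exp_mul_norm_const_mul {α : ℝ} {φ : ℝ → ℂ} (z : ℂ)
    (h : Integrable fun x => Real.exp (α * |x|) * ‖φ x‖) :
    Integrable fun x => Real.exp (α * |x|) * ‖z * φ x‖ := by
  refine (h.const_mul ‖z‖).congr (ae_of_all _ fun x => ?_)
  simp only [norm_mul]
  ring

theorem isSchur_wker_besselAbs {α α₁ : ℝ} (hα : 0 < α) (h : |α₁| ≤ α) {ω : ℂ} (hω : α < ω.re)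
    (z : ℂ) : ∃ A, IsSchur (wker α₁ (-α₁) fun x => z * besselAbs ω x) A :=
  ⟨_, isSchur_wker_neg h ((measurable_besselAbs ω).const_mul z)
    (integrable_exp_mul_norm_const_mul z (integrable_exp_mul_norm_besselAbs hα hω))⟩

theorem isSchur_wker_expAbs {α α₁ : ℝ} (h : |α₁| ≤ α) {b : ℂ} (hb : α < b.re)
    (z : ℂ) : ∃ A, IsSchur (wker α₁ (-α₁) fun x => z * expAbs b x) A :=
  ⟨_, isSchur_wker_neg h ((continuous_expAbs b).measurable.const_mul z)
    (integrable_exp_mul_norm_const_mul z (integrable_exp_mul_norm_expAbs hb))⟩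

theorem isSchur_wker_neg_neg_expAbs {α : ℝ} (hα : 0 < α) {b : ℂ} (hb : -α < b.re)
    (z : ℂ) : ∃ A, IsSchur (wker (-α) (-α) fun x => z * expAbs b x) A := by
  refine ⟨_, isSchur_wker_neg_neg hα.le ((continuous_expAbs b).measurable.const_mul z) ?_⟩
  have := integrable_exp_mul_norm_const_mul z (integrable_exp_mul_norm_expAbs hb)
  simpa only [neg_mul] using this

/-- The operator of multiplication by `w_α⁻²`. -/
def weightOp (α : ℝ) : L2 →L[ℂ] L2 := mulOp fun t => (weight (-(2 * α)) t : ℂ)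

theorem measurable_ofReal_weight (α : ℝ) : Measurable fun t => (weight α t : ℂ) :=
  (by fun_prop : Continuous fun t => (weight α t : ℂ)).measurable

theorem norm_weight_le_one {α : ℝ} (hα : 0 ≤ α) (t : ℝ) : ‖(weight (-α) t : ℂ)‖ ≤ 1 := by
  rw [norm_weight, weight, Real.exp_le_one_iff]
  nlinarith [abs_nonneg t]

theorem weightOp_mul_wker {α A C : ℝ} (hα : 0 ≤ α) {φ : ℝ → ℂ} (h : IsSchur (wker α (-α) φ) A)
    (h' : IsSchur (wker (-α) (-α) φ) C) :
    weightOp α * kerOp (wker α (-α) φ) = kerOp (wker (-α) (-α) φ) :=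
  mulOp_mul_kerOp (measurable_ofReal_weight _) (norm_weight_le_one (by linarith)) h h' fun t s => by
    have e : (weight (-(2 * α)) t : ℂ) * weight α t = weight (-α) t := by
      rw [← Complex.ofReal_mul, weight_mul]
      ring_nf
    rw [wker, wker, ← e]
    ring

theorem wker_mul_weightOp {α A C : ℝ} (hα : 0 ≤ α) {φ : ℝ → ℂ} (h : IsSchur (wker (-α) α φ) A)
    (h' : IsSchur (wker (-α) (-α) φ) C) :
    kerOp (wker (-α) α φ) * weightOp α = kerOp (wker (-α) (-α) φ) :=
  kerOp_mul_mulOp (measurable_ofReal_weight _) (norm_weight_le_one (by linarith)) h h' fun t s => by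
    have e : (weight α s : ℂ) * weight (-(2 * α)) s = weight (-α) s := by
      rw [← Complex.ofReal_mul, weight_mul]
      ring_nf
    rw [wker, wker, ← e]
    ring

theorem exists_isSchur_wker_neg_neg {α : ℝ} (hα : 0 ≤ α) {φ : ℝ → ℂ} (hφ : Measurable φ)
    (h : Integrable fun x => Real.exp (α * |x|) * ‖φ x‖) :
    ∃ C, IsSchur (wker (-α) (-α) φ) C := by
  refine ⟨_, isSchur_wker_neg_neg hα hφ (h.mono' ?_ (ae_of_all _ fun x => ?_))⟩
  · exact ((by fun_prop : Continuous fun x : ℝ => Real.exp (-(α * |x|))).measurable.mul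
      hφ.norm).aestronglyMeasurable
  · rw [Real.norm_of_nonneg (by positivity)]
    gcongr
    nlinarith [mul_nonneg hα (abs_nonneg x)]

/-- The weighted convolution operator with the kernel `m K₀(ω|·|)/π`. -/
def besselOp (α₁ : ℝ) (m ω : ℂ) : L2 →L[ℂ] L2 :=
  kerOp (wker α₁ (-α₁) fun x => m * besselAbs ω x)

/-- The weighted convolution operator with kernel `z exp (-b |·|)`. -/
def expOp (α₁ : ℝ) (z b : ℂ) : L2 →L[ℂ] L2 :=
  kerOp (wker α₁ (-α₁) fun x => z * expAbs b x)

/-- The weighted version of the operator `Q`. -/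
def waveOp (α : ℝ) (m E : ℂ) : L2 →L[ℂ] L2 :=
  kerOp (wker (-α) (-α) fun x => m ^ 2 / E * expAbs (-(Complex.I * E)) x)

/-- For the flat interface `γ(t) = (t, 0)`, the operator `ℒ 𝒫` is inverted by the product of
the two convolution operators below. -/
theorem flat_equation_iff {α m E ω : ℝ} {b : ℂ} (hα : 0 < α) (hm : 0 < m) (hE : E ≠ 0)
    (hωE : ω ^ 2 + E ^ 2 = m ^ 2) (hω : α < ω) (hb : b ^ 2 = -(E ^ 2 + 2 * Complex.I * m ^ 2))
    (hbα : α < b.re) (σ τ : L2) :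
    ((1 - besselOp (-α) m ω) * (weightOp α + waveOp α m E)) σ = weightOp α τ ↔
      σ = ((1 + expOp α (m ^ 2 * (1 + 2 * Complex.I) / (2 * b)) b) * (1 + besselOp α m ω)) τ := by
  have hω0 : 0 < ω := hα.trans hω
  have hωc : (ω : ℂ) ≠ 0 := Complex.ofReal_ne_zero.2 hω0.ne'
  have hEc : (E : ℂ) ≠ 0 := Complex.ofReal_ne_zero.2 hE
  have hmc : (m : ℂ) ≠ 0 := Complex.ofReal_ne_zero.2 hm.ne'
  have hωEc : (ω : ℂ) ^ 2 + E ^ 2 = m ^ 2 := by exact_mod_cast hωE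
  have hbc : b ≠ 0 := fun h => by rw [h, Complex.zero_re] at hbα; linarith
  have hI : (1 + 2 * Complex.I : ℂ) ≠ 0 := fun h => by
    have := congrArg Complex.re h
    simp at this
  have hωb : (ω : ℂ) ^ 2 - b ^ 2 = m ^ 2 * (1 + 2 * Complex.I) := by
    rw [hb]; linear_combination hωEc
  have habs : |α| ≤ α := (abs_of_pos hα).le
  have habs' : |-α| ≤ α := by rw [abs_neg]; exact habs
  have hω' : α < (ω : ℂ).re := hω
  have hnn : - -α = α := neg_neg α
  obtain ⟨A1, hKp⟩ := isSchur_wker_besselAbs hα habs hω' m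
  obtain ⟨A2, hKm⟩ := isSchur_wker_besselAbs hα habs' hω' m
  obtain ⟨A4, hG⟩ := isSchur_wker_expAbs habs hbα (m ^ 2 * (1 + 2 * Complex.I) / (2 * b))
  have hH := fun z : ℂ => isSchur_wker_expAbs (α := α) habs hω' z
  have hH' := fun z : ℂ => isSchur_wker_expAbs (α := α) habs' hω' z
  have hH0 := fun z : ℂ => isSchur_wker_neg_neg_expAbs (b := ω) hα (by rw [Complex.ofReal_re]; linarith) z
  obtain ⟨A5, hQ⟩ := isSchur_wker_neg_neg_expAbs (b := -(Complex.I * E)) hα (by simpa using hα)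
    ((m : ℂ) ^ 2 / E)
  obtain ⟨A6, hK0⟩ := exists_isSchur_wker_neg_neg hα.le
    ((measurable_besselAbs ω).const_mul (m : ℂ))
    (integrable_exp_mul_norm_const_mul m (integrable_exp_mul_norm_besselAbs hα hω'))
  set W := weightOp α
  set Q := waveOp α m E with hQd
  set Kp := besselOp α m ω with hKpd
  set Km := besselOp (-α) m ω with hKmd
  set a : ℂ := m ^ 2 * (1 + 2 * Complex.I) with ha
  set G := expOp α (a / (2 * b)) b with hGd
  set Hp := expOp α (1 / (2 * ω)) ω with hHpd
  set Hm := expOp (-α) (1 / (2 * ω)) ω with hHmd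
  have hHsmul : ∀ (α₁ : ℝ) (z : ℂ), |α₁| ≤ α →
      expOp α₁ z ω = (2 * ω * z) • expOp α₁ (1 / (2 * ω)) ω := fun α₁ z hα₁ => by
    obtain ⟨A, hA⟩ := isSchur_wker_expAbs hα₁ hω' (1 / (2 * ω))
    rw [expOp, expOp, ← kerOp_const_mul hA]
    congr 1
    ext t s
    rw [wker, wker]
    field_simp
  -- squares of the Bessel operator
  have i1 : Km * Km = (m : ℂ) ^ 2 • Hm := by
    obtain ⟨A, hA⟩ := hH' (m ^ 2 / (2 * ω))
    have e := hHsmul (-α) (m ^ 2 / (2 * ω)) habs'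
    rw [show 2 * ω * ((m : ℂ) ^ 2 / (2 * ω)) = m ^ 2 by field_simp] at e
    rw [hHmd, ← e, expOp]
    refine kerOp_wker_mul (by ring) hKm hKm hA ?_
    filter_upwards [besselAbs_convolution hω0] with x hx
    have e2 : ∀ y, (m : ℂ) * besselAbs ω (x - y) * (m * besselAbs ω y)
        = m ^ 2 * (besselAbs ω (x - y) * besselAbs ω y) := fun y => by ring
    simp only [e2]
    rw [integral_const_mul, hx]
    ring
  have i2 : Km * W = W * Kp := by
    have h1 := wker_mul_weightOp hα.le (φ := fun x => m * besselAbs ω x)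
      (by simpa only [hnn] using hKm) hK0
    have h2 := weightOp_mul_wker hα.le hKp hK0
    rw [hKmd, hKpd, besselOp, besselOp, hnn, h1, h2]
  have i2' : Hm * W = W * Hp := by
    obtain ⟨B1, hB1⟩ := hH (1 / (2 * ω))
    obtain ⟨B2, hB2⟩ := hH' (1 / (2 * ω))
    obtain ⟨B3, hB3⟩ := hH0 (1 / (2 * ω))
    have h1 := wker_mul_weightOp hα.le (φ := fun x => 1 / (2 * ω) * expAbs ω x)
      (by simpa only [hnn] using hB2) hB3
    have h2 := weightOp_mul_wker hα.le hB1 hB3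
    rw [hHmd, hHpd, expOp, expOp, hnn, h1, h2]
  have i3 : Km * Q = Q * Kp := by
    rw [hKmd, hQd, hKpd, besselOp, besselOp, waveOp, kerOp_mul_kerOp hKm hQ,
      kerOp_mul_kerOp hQ hKp, kerComp_wker_comm _ _ _ (-α) α _ (by ring) (by ring)]
  have i3' : G * Kp = Kp * G := by
    rw [hGd, hKpd, besselOp, expOp, kerOp_mul_kerOp hG hKp,
      kerOp_mul_kerOp hKp hG, kerComp_wker_comm _ _ _ (-α) α _ (by ring) (by ring)]
  -- The resolvent identity for rates `ω` and `-iE`. Its denominator is `ω² + E² = m²`, so the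
  -- prefactor `m²` reproduces `Q` exactly and leaves a multiple of `H`.
  have i4 : (m : ℂ) ^ 2 • (Hm * Q) = Q + (2 * Complex.I * m ^ 2) • (W * Hp) := by
    obtain ⟨B1, hB1⟩ := hH (1 / (2 * ω))
    obtain ⟨B2, hB2⟩ := hH' (1 / (2 * ω))
    obtain ⟨B3, hB3⟩ := hH0 (1 / (2 * ω))
    rw [hHpd, expOp, weightOp_mul_wker hα.le hB1 hB3, hHmd, hQd, expOp, waveOp,
      kerOp_mul_kerOp hB2 hQ, ← kerOp_const_mul (hB2.comp hQ), ← kerOp_const_mul hB3,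
      ← kerOp_add hQ (hB3.const_mul _)]
    congr 1
    ext t s
    rw [kerComp_wker _ _ _ _ (by ring), wker, wker]
    have e2 : ∀ y, 1 / (2 * (ω : ℂ)) * expAbs ω (t - s - y) *
        (m ^ 2 / E * expAbs (-(Complex.I * E)) y)
        = 1 / (2 * (ω : ℂ)) * (m ^ 2 / E) *
          (expAbs ω (t - s - y) * expAbs (-(Complex.I * E)) y) := fun y => by ring
    have hsq : (-(Complex.I * (E : ℂ))) ^ 2 = -E ^ 2 := by
      rw [neg_sq, mul_pow, Complex.I_sq]; ring
    simp only [e2]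
    rw [integral_const_mul, expAbs_convolution (by simpa using hω0), hsq, sub_neg_eq_add, hωEc]
    · field_simp
      ring
    · rw [hsq]
      intro h
      exact hmc (pow_eq_zero_iff two_ne_zero |>.1 (by rw [← hωEc, h]; ring))
  have i5 : Hp * G = (1 / a) • G - Hp ∧ G * Hp = (1 / a) • G - Hp := by
    obtain ⟨B1, hB1⟩ := hH (1 / (2 * ω))
    have hne : (ω : ℂ) ^ 2 ≠ b ^ 2 := by
      rw [ne_eq, ← sub_eq_zero, hωb]
      exact mul_ne_zero (pow_ne_zero 2 hmc) hI
    have ha0 : a ≠ 0 := mul_ne_zero (pow_ne_zero 2 hmc) hI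
    have e1 : kerOp (kerComp (wker α (-α) fun x => 1 / (2 * (ω : ℂ)) * expAbs ω x)
        (wker α (-α) fun x => a / (2 * b) * expAbs b x)) = (1 / a) • G - Hp := by
      rw [hGd, hHpd, expOp, expOp, ← kerOp_const_mul hG, ← kerOp_sub (hG.const_mul _) hB1]
      congr 1
      ext t s
      rw [kerComp_wker _ _ _ _ (by ring), wker, wker]
      have e2 : ∀ y, 1 / (2 * (ω : ℂ)) * expAbs ω (t - s - y) * (a / (2 * b) * expAbs b y)
          = 1 / (2 * (ω : ℂ)) * (a / (2 * b)) * (expAbs ω (t - s - y) * expAbs b y) :=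
        fun y => by ring
      simp only [e2]
      rw [integral_const_mul, expAbs_convolution (by rw [Complex.ofReal_re]; linarith) hne, hωb]
      field_simp
    refine ⟨?_, ?_⟩
    · rw [← e1, hHpd, hGd, expOp, expOp, kerOp_mul_kerOp hB1 hG]
    · rw [← e1, hHpd, hGd, expOp, expOp, kerOp_mul_kerOp hG hB1,
        kerComp_wker_comm _ _ _ (-α) α _ (by ring) (by ring)]
  have ha0 : a ≠ 0 := mul_ne_zero (pow_ne_zero 2 hmc) hI
  have j1 : (1 + G) * (1 - a • Hp) = 1 := by
    rw [add_mul, one_mul, mul_sub, mul_one, mul_smul_comm, i5.2, smul_sub, smul_smul,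
      mul_one_div_cancel ha0, one_smul]
    abel
  have j2 : (1 - a • Hp) * (1 + G) = 1 := by
    rw [sub_mul, one_mul, mul_add, mul_one, smul_mul_assoc, i5.1, smul_sub,
      smul_smul, mul_one_div_cancel ha0, one_smul]
    abel
  -- The wave terms cancel here: this is the zero of `1 - m²/(η² + ω²)` at `η = ±E` removing the
  -- pole of `𝒫`.
  have k1 : (1 - (m : ℂ) ^ 2 • Hm) * (W + Q) = W * (1 - a • Hp) := by
    rw [sub_mul, one_mul, mul_add, smul_mul_assoc, smul_mul_assoc, i2', i4, mul_sub, mul_one,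
      mul_smul_comm, ha, mul_add, mul_one, add_smul,
      show (m : ℂ) ^ 2 * (2 * Complex.I) = 2 * Complex.I * m ^ 2 by ring]
    abel
  have k2 : (1 + Km) * (1 - Km) = 1 - (m : ℂ) ^ 2 • Hm := by
    rw [← i1]
    noncomm_ring
  have k2' : (1 - Km) * (1 + Km) = 1 - (m : ℂ) ^ 2 • Hm := by
    rw [← i1]
    noncomm_ring
  have k3 : (1 + Km) * W = W * (1 + Kp) := by
    rw [add_mul, mul_add, i2, one_mul, mul_one]
  have hWinj : Function.Injective W := by
    refine mulOp_injective (measurable_ofReal_weight _) (norm_weight_le_one (by linarith)) fun t => ?_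
    exact Complex.ofReal_ne_zero.2 (weight_pos _ t).ne'
  -- Forward, multiplication by `1 + K₋` completes the square, and `W` is then cancelled by
  -- injectivity. Backward, the candidate is inserted and the factors commuted, so injectivity of `1
  -- + K₋` is never needed.
  constructor
  · intro h
    have h1 : ((1 + Km) * ((1 - Km) * (W + Q))) σ = ((1 + Km) * W) τ := by
      rw [mul_apply_eq_comp, h, mul_apply_eq_comp]
    rw [← mul_assoc, k2, k1, k3, mul_apply_eq_comp, mul_apply_eq_comp] at h1
    have h2 := congrArg (⇑(1 + G)) (hWinj h1)
    rwa [← mul_apply_eq_comp, j1, ← mul_apply_eq_comp, one_apply_eq_self] at h2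
  · intro h
    rw [h, ← mul_apply_eq_comp]
    congr 1
    have h1 : (1 + G) * (1 + Kp) = (1 + Kp) * (1 + G) := by
      rw [add_mul, mul_add, mul_add, mul_add, i3']
      noncomm_ring
    have h2 : (W + Q) * (1 + Kp) = (1 + Km) * (W + Q) := by
      rw [mul_add, mul_one, mul_add (1 + Km), add_mul 1 Km W, one_mul, add_mul 1 Km Q, one_mul,
        add_mul W Q Kp, i2, i3]
      abel
    rw [h1, mul_assoc, ← mul_assoc (W + Q), h2, mul_assoc (1 + Km), ← mul_assoc, k2',
      ← mul_assoc, k1, mul_assoc, j2, mul_one]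

section

/-! ### Geometry of the interface -/

theorem chi_comm (s t : ℝ) : chi s t = chi t s := by
  rw [chi, chi, mul_comm, min_comm]

theorem chi_nonneg (s t : ℝ) : 0 ≤ chi s t := by
  unfold chi
  split_ifs <;> positivity

/-- `χ` is the distance from 0 to the parameter segment, so it bounds the curvature decay along the
whole arc. -/
theorem chi_le_abs_of_mem_Icc {s t u : ℝ} (hu : u ∈ Icc s t) : chi s t ≤ |u| := by
  unfold chi
  split_ifs with h
  · rcases lt_or_ge 0 s with hs | hs
    · exact (min_le_left _ _).trans (abs_le_abs_of_nonneg hs.le hu.1)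
    · have ht : t < 0 := by
        by_contra! ht
        nlinarith
      refine (min_le_right _ _).trans ?_
      rw [abs_of_neg ht, abs_of_neg (hu.2.trans_lt ht)]
      linarith [hu.2]
  · exact abs_nonneg u

theorem abs_sub_abs_sub_le_chi (s t : ℝ) : |t| - |t - s| ≤ chi s t := by
  unfold chi
  split_ifs with h
  · refine le_min ?_ (by linarith [abs_nonneg (t - s)])
    linarith [abs_sub_abs_le_abs_sub t s]
  · have : |t| ≤ |t - s| := by
      rw [← sq_le_sq]
      nlinarith [sq_nonneg s]
    linarith

/-- In fact an equality: for equal signs twice the minimum is lost in `|t - s|`, for opposite signs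
nothing is. -/
theorem abs_add_abs_le_chi (s t : ℝ) : |t| + |s| ≤ |t - s| + 2 * chi s t := by
  unfold chi
  split_ifs with h
  · have h1 := abs_sub_abs_le_abs_sub t s
    have h2 := abs_sub_abs_le_abs_sub s t
    rw [abs_sub_comm s t] at h2
    rcases min_cases |s| |t| with h3 | h3 <;> linarith [h3.1]
  · have : (|t| + |s|) ^ 2 ≤ |t - s| ^ 2 := by
      have h4 : |t| * |s| = -(t * s) := by
        rw [← abs_mul, abs_of_nonpos (by linarith)]
      rw [sq_abs]
      nlinarith [sq_abs t, sq_abs s]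
    linarith [abs_le_of_sq_le_sq' this (abs_nonneg _) |>.2]

variable {γ : ℝ → Plane} {C₀ β c : ℝ}

theorem IsInterface.differentiable (hγ : IsInterface γ C₀ β) : Differentiable ℝ γ :=
  hγ.smooth.differentiable (by simp)

theorem IsInterface.norm_sub_le (hγ : IsInterface γ C₀ β) (t s : ℝ) : ‖γ t - γ s‖ ≤ |t - s| := by
  have := convex_univ.norm_image_sub_le_of_norm_deriv_le (f := γ) (C := 1)
    (fun x _ => hγ.differentiable x) (fun x _ => (hγ.norm_deriv x).le) (mem_univ s) (mem_univ t)
  simpa using this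

theorem IsInterface.chordArc_le_one (hγ : IsInterface γ C₀ β) (hc : IsChordArcConst γ c) :
    c ≤ 1 := by
  have h1 := hc.2 0 1
  have h2 := hγ.norm_sub_le 1 0
  simp only [sub_zero, abs_one, mul_one] at h1 h2
  exact h1.trans h2

theorem IsInterface.differentiable_deriv (hγ : IsInterface γ C₀ β) :
    Differentiable ℝ (deriv γ) := by
  have h : ContDiff ℝ 2 γ := by exact_mod_cast contDiff_infty.1 hγ.smooth 2
  exact h.differentiable_deriv_two

theorem IsInterface.norm_deriv_deriv_sq_le (hγ : IsInterface γ C₀ β) (t : ℝ) :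
    ‖deriv (deriv γ) t‖ ^ 2 ≤ C₀ * Real.exp (-(β * |t|)) := by
  have h := hγ.decay t
  rw [iteratedDeriv_succ, iteratedDeriv_one] at h
  linarith [norm_nonneg (iteratedDeriv 3 γ t)]

/-- The defect between arclength and chord is cubic, with exponentially decaying constant. -/
theorem IsInterface.abs_sub_sub_norm_le (hγ : IsInterface γ C₀ β) (t s : ℝ) :
    |t - s| - ‖γ t - γ s‖ ≤ C₀ * Real.exp (-(β * chi s t)) * |t - s| ^ 3 / 6 := by
  wlog hst : s ≤ t generalizing s t
  · have := this s t (by linarith)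
    rwa [abs_sub_comm, norm_sub_rev, chi_comm] at this
  set D := C₀ * Real.exp (-(β * chi s t)) with hD
  have hD0 : 0 ≤ D := mul_nonneg hγ.C₀_pos.le (Real.exp_pos _).le
  have h2 : ∀ u ∈ Icc s t, ‖deriv (deriv γ) u‖ ≤ √D := fun u hu => by
    refine Real.le_sqrt_of_sq_le ((hγ.norm_deriv_deriv_sq_le u).trans ?_)
    have := chi_le_abs_of_mem_Icc hu
    have hβ := hγ.β_pos
    have hC := hγ.C₀_pos
    rw [hD]
    gcongr
  have h1 : ∀ u ∈ Icc s t, ‖deriv γ u - deriv γ s‖ ≤ √D * (u - s) := fun u hu => by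
    have := (convex_Icc s t).norm_image_sub_le_of_norm_deriv_le (f := deriv γ) (C := √D)
      (fun x _ => hγ.differentiable_deriv x) h2 (left_mem_Icc.2 hst) hu
    rwa [Real.norm_of_nonneg (sub_nonneg.2 hu.1)] at this
  -- For unit vectors the inner product is `1 - |difference|²/2`. Integrating this projection onto
  -- the initial tangent bounds the chord from below with a cubic error.
  have h0 : ∀ u ∈ Icc s t, 1 - D * (u - s) ^ 2 / 2 ≤ inner ℝ (deriv γ s) (deriv γ u) := fun u hu => by
    have e := norm_sub_sq_real (deriv γ u) (deriv γ s)
    rw [hγ.norm_deriv, hγ.norm_deriv, real_inner_comm] at e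
    have h3 : ‖deriv γ u - deriv γ s‖ ^ 2 ≤ D * (u - s) ^ 2 := by
      calc _ ≤ (√D * (u - s)) ^ 2 := by gcongr; exact h1 u hu
        _ = _ := by rw [mul_pow, Real.sq_sqrt hD0]
    linarith
  have hd : ∀ u, HasDerivAt (fun u => inner ℝ (deriv γ s) (γ u) - (u - D * (u - s) ^ 3 / 6))
      (inner ℝ (deriv γ s) (deriv γ u) - (1 - D * (u - s) ^ 2 / 2)) u := fun u => by
    have hi : HasDerivAt (fun u => inner ℝ (deriv γ s) (γ u)) (inner ℝ (deriv γ s) (deriv γ u)) u :=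
      (innerSL ℝ (deriv γ s)).hasFDerivAt.comp_hasDerivAt u (hγ.differentiable u).hasDerivAt
    have hp := ((((hasDerivAt_id u).sub_const s).pow 3).const_mul D).div_const 6
    refine (hi.sub ((hasDerivAt_id u).sub hp)).congr_deriv ?_
    simp
    ring
  have hmono := monotoneOn_of_deriv_nonneg (convex_Icc s t)
    (f := fun u => inner ℝ (deriv γ s) (γ u) - (u - D * (u - s) ^ 3 / 6))
    (fun u _ => (hd u).continuousAt.continuousWithinAt)
    (fun u _ => (hd u).differentiableAt.differentiableWithinAt)
    (fun u hu => by
      rw [(hd u).deriv]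
      linarith [h0 u (interior_subset hu)])
  have h4 := hmono (left_mem_Icc.2 hst) (right_mem_Icc.2 hst) hst
  simp only [sub_self] at h4
  have h5 : inner ℝ (deriv γ s) (γ t - γ s) ≤ ‖γ t - γ s‖ := by
    refine (real_inner_le_norm _ _).trans ?_
    rw [hγ.norm_deriv, one_mul]
  rw [inner_sub_right] at h5
  rw [abs_of_nonneg (sub_nonneg.2 hst)]
  nlinarith

/-! ### Consequences of the conditions on the weight -/

variable {m₀ E₀ a : ℝ}

theorem freq_pos (hE₀ : E₀ ∈ Ioo (-m₀) m₀) : 0 < freq m₀ E₀ :=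
  Real.sqrt_pos.2 (by nlinarith [hE₀.1, hE₀.2])

/-- If `2a ≥ β`, the square integrable function stays bounded below on the strip `s > 0`, `1 < t - s
< 2`, which has infinite measure. -/
theorem IsMaxWeight.two_mul_lt (h : IsMaxWeight m₀ E₀ β c a) (hc : 0 < c)
    (hω : 0 < freq m₀ E₀) : 2 * a < β := by
  by_contra! hβ
  -- `Y` dominates the argument of `K₁` on the strip, and `Y ≥ 1` permits the lower bound for `K₁`.
  set Y := max 1 (c * freq m₀ E₀ * 2) with hY
  set k := besselK 1 Y with hk
  have hk0 : 0 < k := lt_of_lt_of_le (by positivity)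
    (exp_neg_div_le_besselK_one (le_max_left _ _))
  have hfin := h.integrable_K1.measure_norm_ge_lt_top (ε := k ^ 2) (by positivity)
  have hsub : {p : ℝ × ℝ | 0 < p.2 ∧ 1 < p.1 - p.2 ∧ p.1 - p.2 < 2} ⊆ {p : ℝ × ℝ | k ^ 2 ≤
      ‖(Real.exp (a * p.1) * Real.exp (a * p.2) * |p.1 - p.2| ^ 3 *
      Real.exp (-(β * chi p.2 p.1)) * besselK 1 (c * freq m₀ E₀ * |p.1 - p.2|)) ^ 2‖} := by
    rintro ⟨t, s⟩ ⟨hs, h1, h2⟩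
    simp only at hs h1 h2
    simp only [mem_ofPred_eq]
    have hr : |t - s| = t - s := abs_of_pos (by linarith)
    have hchi : chi s t = s := by
      rw [chi, if_pos (by nlinarith), abs_of_pos hs, abs_of_pos (by linarith),
        min_eq_left (by linarith)]
    have hK : k ≤ besselK 1 (c * freq m₀ E₀ * (t - s)) := by
      refine besselK_one_anti (by positivity [sub_pos.2 (by linarith : s < t)]) ?_
      refine le_trans ?_ (le_max_right _ _)
      gcongr
    have he : 1 ≤ Real.exp (a * t) * Real.exp (a * s) * Real.exp (-(β * s)) := by
      rw [← Real.exp_add, ← Real.exp_add, Real.one_le_exp_iff]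
      nlinarith [mul_pos h.pos (by linarith : 0 < t - s), mul_nonneg (sub_nonneg.2 hβ) hs.le]
    have hp : 1 ≤ (t - s) ^ 3 := one_le_pow₀ h1.le
    rw [hr, hchi, Real.norm_of_nonneg (sq_nonneg _)]
    refine pow_le_pow_left₀ hk0.le ?_ 2
    calc k = 1 * 1 * k := by ring
      _ ≤ (Real.exp (a * t) * Real.exp (a * s) * Real.exp (-(β * s))) * (t - s) ^ 3 *
          besselK 1 (c * freq m₀ E₀ * (t - s)) := by gcongr
      _ = _ := by ring
  have hlt := (measure_mono hsub).trans_lt hfin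
  have hms : MeasurableSet {p : ℝ × ℝ | 0 < p.2 ∧ 1 < p.1 - p.2 ∧ p.1 - p.2 < 2} := by
    have e : {p : ℝ × ℝ | 0 < p.2 ∧ 1 < p.1 - p.2 ∧ p.1 - p.2 < 2} =
      {p : ℝ × ℝ | 0 < p.2} ∩ ({p | 1 < p.1 - p.2} ∩ {p | p.1 - p.2 < 2}) := rfl
    rw [e]
    exact (measurableSet_lt measurable_const measurable_snd).inter
      ((measurableSet_lt measurable_const (by fun_prop)).inter
        (measurableSet_lt (by fun_prop) measurable_const))
  rw [Measure.volume_eq_prod, Measure.prod_apply_symm hms] at hlt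
  have hge : ∫⁻ s : ℝ, (Ioi (0 : ℝ)).indicator 1 s ≤
      ∫⁻ s : ℝ, volume ((fun t : ℝ => (t, s)) ⁻¹'
        {p : ℝ × ℝ | 0 < p.2 ∧ 1 < p.1 - p.2 ∧ p.1 - p.2 < 2}) := by
    refine lintegral_mono fun s => ?_
    by_cases hs : s ∈ Ioi (0 : ℝ)
    · have e : (fun t : ℝ => (t, s)) ⁻¹'
          {p : ℝ × ℝ | 0 < p.2 ∧ 1 < p.1 - p.2 ∧ p.1 - p.2 < 2} = Ioo (1 + s) (2 + s) := by
        ext t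
        simp only [mem_preimage, mem_ofPred_eq, mem_Ioo, mem_Ioi.1 hs, true_and]
        constructor <;> rintro ⟨h1, h2⟩ <;> constructor <;> linarith
      rw [indicator_of_mem hs, e, Real.volume_Ioo]
      norm_num
    · simp [indicator_of_notMem hs]
  rw [lintegral_indicator_one measurableSet_Ioi, Real.volume_Ioi] at hge
  exact absurd hlt (not_lt.2 hge)

/-- If `a ≥ cω`, the growth `e^{at}` beats the decay of `K₁`, so the integrand is bounded below for
`s ∈ (0,1)` and all large `t`. -/
theorem IsMaxWeight.lt_mul_freq (h : IsMaxWeight m₀ E₀ β c a) (hβ : 0 < β) (hc : 0 < c)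
    (hω : 0 < freq m₀ E₀) : a < c * freq m₀ E₀ := by
  by_contra! ha
  set q := c * freq m₀ E₀ with hq
  have hq0 : 0 < q := mul_pos hc hω
  set k := Real.exp (-1) * Real.exp (-β) / q with hk
  have hk0 : 0 < k := by positivity
  have hfin := h.integrable_K1.measure_norm_ge_lt_top (ε := k ^ 2) (by positivity)
  -- The threshold gives both `t - s ≥ 1` and `q(t - s) ≥ 1`.
  have hsub : Ioi (2 + 1 / q) ×ˢ Ioo (0 : ℝ) 1 ⊆ {p : ℝ × ℝ | k ^ 2 ≤
      ‖(Real.exp (a * p.1) * Real.exp (a * p.2) * |p.1 - p.2| ^ 3 *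
      Real.exp (-(β * chi p.2 p.1)) * besselK 1 (q * |p.1 - p.2|)) ^ 2‖} := by
    rintro ⟨t, s⟩ ⟨ht, hs0, hs1⟩
    simp only [mem_Ioi] at ht hs0 hs1
    have hq1 : 0 < 1 / q := by positivity
    simp only [mem_ofPred_eq]
    have hr : |t - s| = t - s := abs_of_pos (by linarith)
    have hr1 : 1 ≤ t - s := by linarith
    have hx : 1 ≤ q * (t - s) := by
      rw [← div_le_iff₀' hq0]
      linarith
    have hchi : chi s t ≤ 1 := by
      rw [chi, if_pos (by nlinarith)]
      exact (min_le_left _ _).trans (by rw [abs_of_pos hs0]; exact hs1.le)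
    have hK := exp_neg_div_le_besselK_one hx
    have he : Real.exp (-1) * Real.exp (-β) ≤ Real.exp (a * t) * Real.exp (a * s) *
        Real.exp (-(β * chi s t)) * Real.exp (-(q * (t - s) + 1)) := by
      simp only [← Real.exp_add, Real.exp_le_exp]
      nlinarith [mul_nonneg (sub_nonneg.2 ha) (by linarith : 0 ≤ t - s),
        mul_nonneg h.pos.le hs0.le, mul_nonneg hβ.le (sub_nonneg.2 hchi)]
    have hp : 1 ≤ (t - s) ^ 2 := one_le_pow₀ hr1
    have hr0 : 0 < t - s := by linarith
    rw [hr, Real.norm_of_nonneg (sq_nonneg _)]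
    refine pow_le_pow_left₀ hk0.le ?_ 2
    calc k = (Real.exp (-1) * Real.exp (-β)) * 1 / q := by rw [hk, mul_one]
      _ ≤ (Real.exp (a * t) * Real.exp (a * s) *
        Real.exp (-(β * chi s t)) * Real.exp (-(q * (t - s) + 1))) * (t - s) ^ 2 / q := by gcongr
      _ = Real.exp (a * t) * Real.exp (a * s) * (t - s) ^ 3 *
        Real.exp (-(β * chi s t)) * (Real.exp (-(q * (t - s) + 1)) / (q * (t - s))) := by
          field_simp
      _ ≤ _ := by gcongr
  have hlt := (measure_mono hsub).trans_lt hfin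
  rw [Measure.volume_eq_prod, Measure.prod_prod, Real.volume_Ioi, Real.volume_Ioo] at hlt
  simp at hlt

end

section

/-! ### The perturbation caused by the curvature of the interface -/

/-- The weighted difference of the kernels of the single-layer operators of the interface and of
the flat interface. -/
def pertKer (γ : ℝ → Plane) (α : ℝ) (m ω : ℂ) (t s : ℝ) : ℂ :=
  weight α t * (m / Real.pi * (besselKc (ω * ‖γ t - γ s‖) - besselKc (ω * (|t - s| : ℝ))))
    * weight α s

variable {γ : ℝ → Plane} {C₀ β c : ℝ}

theorem IsInterface.measurable_pertKer (hγ : IsInterface γ C₀ β) (α : ℝ) (m ω : ℂ) :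
    Measurable (Function.uncurry (pertKer γ α m ω)) := by
  have hc := hγ.differentiable.continuous
  unfold Function.uncurry pertKer
  refine Measurable.mul (Measurable.mul ?_ (Measurable.const_mul (Measurable.sub ?_ ?_) _)) ?_
  · exact (by fun_prop : Continuous fun a : ℝ × ℝ => (weight α a.1 : ℂ)).measurable
  · exact measurable_besselKc.comp (by fun_prop : Continuous fun a : ℝ × ℝ =>
      ω * (‖γ a.1 - γ a.2‖ : ℂ)).measurable
  · exact measurable_besselKc.comp (by fun_prop : Continuous fun a : ℝ × ℝ =>
      ω * ((|a.1 - a.2| : ℝ) : ℂ)).measurable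
  · exact (by fun_prop : Continuous fun a : ℝ × ℝ => (weight α a.2 : ℂ)).measurable

/-- Growing weights cost `α(|t - s| + 2χ)`. The `2αχ` and a spare `εχ` are paid by `βχ`, and since
`|t| - |t - s| ≤ χ` the spare becomes decay in `t` itself. -/
theorem exp_weight_mul_le {α ε q : ℝ} (hα : 0 ≤ α) (hε : 0 ≤ ε) (hεβ : ε ≤ β - 2 * α) (t s : ℝ) :
    weight α t * weight α s * Real.exp (-(β * chi s t)) * Real.exp (-(q * |t - s|)) ≤
      Real.exp (-(ε * |t|)) * Real.exp (-((q - α - ε) * |t - s|)) := by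
  simp only [weight, ← Real.exp_add, Real.exp_le_exp]
  nlinarith [mul_nonneg hα (sub_nonneg.2 (abs_add_abs_le_chi s t)),
    mul_nonneg hε (sub_nonneg.2 (abs_sub_abs_sub_le_chi s t)),
    mul_nonneg (sub_nonneg.2 hεβ) (chi_nonneg s t)]

/-- The cubic chord defect compensates the singularity of `K₁`: `r³K₁` is bounded with exponential
decay, and the chord-arc constant allows arclength in its argument. -/
theorem IsInterface.norm_pertKer_le (hγ : IsInterface γ C₀ β) (hc : IsChordArcConst γ c)
    {α ε κ : ℝ} (hα : 0 ≤ α) (hε : 0 ≤ ε) (hεβ : ε ≤ β - 2 * α) (hκ : 0 ≤ κ) (hκ' : κ < 1)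
    (m : ℂ) {ω : ℂ} (hω : 0 < ω.re) (t s : ℝ) :
    ‖pertKer γ α m ω t s‖ ≤ 2 * C₀ / (c ^ 3 * (1 - κ) ^ 3) * (‖m‖ * ‖ω‖ / ω.re ^ 3) *
      (Real.exp (-(ε * |t|)) * Real.exp (-((κ * c * ω.re - α - ε) * |t - s|))) := by
  have hc0 := hc.1
  have h1κ : 0 < 1 - κ := by linarith
  have hC := hγ.C₀_pos
  rcases eq_or_ne t s with rfl | hts
  · have : pertKer γ α m ω t t = 0 := by simp [pertKer]
    rw [this, norm_zero]
    positivity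
  set r := |t - s| with hr
  set d := ‖γ t - γ s‖ with hd
  have hr0 : 0 < r := abs_pos.2 (sub_ne_zero.2 hts)
  have hdr : d ≤ r := hγ.norm_sub_le t s
  have hcd : c * r ≤ d := hc.2 s t
  have hd0 : 0 < d := (mul_pos hc0 hr0).trans_le hcd
  have h1 := norm_besselKc_sub_le hω hd0 hdr
  have h2 : besselK 1 (ω.re * d) ≤ besselK 1 (ω.re * (c * r)) :=
    besselK_one_anti (by positivity) (by gcongr)
  have h3 := hγ.abs_sub_sub_norm_le t s
  rw [← hr, ← hd] at h3
  have h4 := pow_three_mul_besselK_one_le (x := ω.re * (c * r)) (by positivity) hκ hκ'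
  have hK0 := besselK_nonneg 1 (ω.re * (c * r))
  have h5 : r ^ 3 * besselK 1 (ω.re * (c * r)) ≤
      12 / (1 - κ) ^ 3 * Real.exp (-(κ * c * ω.re * r)) / (c ^ 3 * ω.re ^ 3) := by
    rw [le_div_iff₀ (by positivity)]
    refine le_trans (le_of_eq ?_) (h4.trans (le_of_eq ?_))
    · ring
    · ring_nf
  have h6 : ‖besselKc (ω * d) - besselKc (ω * r)‖ ≤ ‖ω‖ * (C₀ * Real.exp (-(β * chi s t)) / 6 *
      (12 / (1 - κ) ^ 3 * Real.exp (-(κ * c * ω.re * r)) / (c ^ 3 * ω.re ^ 3))) := by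
    calc _ ≤ ‖ω‖ * (r - d) * besselK 1 (ω.re * d) := h1
      _ ≤ ‖ω‖ * (C₀ * Real.exp (-(β * chi s t)) * r ^ 3 / 6) * besselK 1 (ω.re * (c * r)) := by
          have := besselK_nonneg 1 (ω.re * d)
          gcongr
      _ = ‖ω‖ * (C₀ * Real.exp (-(β * chi s t)) / 6 * (r ^ 3 * besselK 1 (ω.re * (c * r)))) := by
          ring
      _ ≤ _ := by gcongr
  have h7 := exp_weight_mul_le (q := κ * c * ω.re) hα hε hεβ t s
  rw [← hr] at h7
  rw [pertKer, norm_mul, norm_mul, norm_weight, norm_weight, norm_mul, norm_div, Complex.norm_real,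
    Real.norm_of_nonneg Real.pi_pos.le]
  have h8 : ‖m‖ / Real.pi ≤ ‖m‖ := div_le_self (norm_nonneg _) (by linarith [Real.pi_gt_three])
  have hw1 := weight_pos α t
  have hw2 := weight_pos α s
  calc _ ≤ weight α t * (‖m‖ * (‖ω‖ * (C₀ * Real.exp (-(β * chi s t)) / 6 *
      (12 / (1 - κ) ^ 3 * Real.exp (-(κ * c * ω.re * r)) / (c ^ 3 * ω.re ^ 3))))) * weight α s := by
        gcongr
    _ = 2 * C₀ / (c ^ 3 * (1 - κ) ^ 3) * (‖m‖ * ‖ω‖ / ω.re ^ 3) * (weight α t * weight α s *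
        Real.exp (-(β * chi s t)) * Real.exp (-(κ * c * ω.re * r))) := by
        field_simp
        ring
    _ ≤ _ := by gcongr

theorem lintegral_lintegral_enorm_sq_lt_top {k : ℝ → ℝ → ℂ} {D ε : ℝ} (hε : 0 < ε)
    (h : ∀ t s, ‖k t s‖ ≤ D * (Real.exp (-(ε * |t|)) * Real.exp (-(ε * |t - s|)))) :
    ∫⁻ t, ∫⁻ s, ‖k t s‖ₑ ^ 2 ≠ ∞ := by
  have hi : ∫⁻ x : ℝ, ENNReal.ofReal (Real.exp (-(2 * ε * |x|))) ≠ ∞ :=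
    (integrable_exp_neg_mul_abs (by positivity : 0 < 2 * ε)).lintegral_lt_top.ne
  have hle : ∀ t s, ‖k t s‖ₑ ^ 2 ≤ ENNReal.ofReal (D ^ 2) *
      (ENNReal.ofReal (Real.exp (-(2 * ε * |t|))) *
        ENNReal.ofReal (Real.exp (-(2 * ε * |t - s|)))) := fun t s => by
    rw [← ENNReal.ofReal_mul (by positivity), ← ENNReal.ofReal_mul (by positivity), ← ofReal_norm,
      ← ENNReal.ofReal_pow (norm_nonneg _)]
    refine ENNReal.ofReal_le_ofReal ((pow_le_pow_left₀ (norm_nonneg _) (h t s) 2).trans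
      (le_of_eq ?_))
    rw [mul_pow, mul_pow, ← Real.exp_nat_mul, ← Real.exp_nat_mul]
    push_cast
    ring_nf
  refine ((lintegral_mono fun t => lintegral_mono (hle t)).trans_lt ?_).ne
  have e : ∀ t : ℝ, ∫⁻ s, ENNReal.ofReal (D ^ 2) * (ENNReal.ofReal (Real.exp (-(2 * ε * |t|))) *
        ENNReal.ofReal (Real.exp (-(2 * ε * |t - s|)))) =
      ENNReal.ofReal (D ^ 2) * (ENNReal.ofReal (Real.exp (-(2 * ε * |t|))) *
        ∫⁻ x : ℝ, ENNReal.ofReal (Real.exp (-(2 * ε * |x|)))) := fun t => by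
    rw [lintegral_const_mul' _ _ ENNReal.ofReal_ne_top,
      lintegral_const_mul' _ _ ENNReal.ofReal_ne_top,
      lintegral_sub_left_eq_self (fun x => ENNReal.ofReal (Real.exp (-(2 * ε * |x|)))) t]
  simp only [e]
  rw [lintegral_const_mul' _ _ ENNReal.ofReal_ne_top, lintegral_mul_const' _ _ hi]
  exact ENNReal.mul_lt_top ENNReal.ofReal_lt_top (ENNReal.mul_lt_top hi.lt_top hi.lt_top)

/-! ### Holomorphic dependence on the spectral parameter -/

theorem differentiableAt_besselKc_mul {ω d : ℝ} (hω : 0 < ω) (hd : 0 ≤ d) {z : ℂ}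
    (hz : 0 < z.re) : DifferentiableAt ℂ (fun z : ℂ => besselKc (z * ω * d)) z := by
  -- At distance zero the argument is 0 for every `z`, so the function is constant.
  rcases hd.eq_or_lt with rfl | hd
  · simp
  · have h1 : DifferentiableAt ℂ (fun z : ℂ => z * ω * d) z := by fun_prop
    have h2 : 0 < (z * ω * d).re := by
      have : (z * ω * d).re = z.re * ω * d := by simp
      rw [this]
      positivity
    exact DifferentiableAt.comp (g := besselKc) z (differentiableAt_besselKc h2) h1

theorem norm_besselAbs_le_of_le {ω' : ℝ} (hω' : 0 < ω') {ω : ℂ} (h : ω' ≤ ω.re) (x : ℝ) :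
    ‖besselAbs ω x‖ ≤ ‖besselAbs ω' x‖ := by
  rcases eq_or_ne x 0 with rfl | hx
  · simp [besselAbs]
  · have hx' : 0 < |x| := abs_pos.2 hx
    rw [besselAbs, besselAbs, norm_div, norm_div]
    gcongr
    refine (norm_besselKc_le _).trans ?_
    have e1 : (ω * (|x| : ℝ)).re = ω.re * |x| := by simp
    rw [e1, ← Complex.ofReal_mul, besselKc_ofReal, Complex.norm_real,
      Real.norm_of_nonneg (besselK_nonneg _ _)]
    exact besselK_zero_anti (by positivity) (by gcongr)

/-- The domain of holomorphy in the spectral parameter. -/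
def specStrip (κ η : ℝ) : Set ℂ := {z | κ < z.re} ∩ ({z | -η < z.im} ∩ {z | z.im < η})

theorem isOpen_specStrip (κ η : ℝ) : IsOpen (specStrip κ η) :=
  (isOpen_lt continuous_const Complex.continuous_re).inter
    ((isOpen_lt continuous_const Complex.continuous_im).inter
      (isOpen_lt Complex.continuous_im continuous_const))

theorem isPreconnected_specStrip (κ η : ℝ) : IsPreconnected (specStrip κ η) :=
  ((convex_halfSpace_re_gt κ).inter
    ((convex_halfSpace_im_gt (-η)).inter (convex_halfSpace_im_lt η))).isPreconnected

theorem ofReal_mem_specStrip {κ η x : ℝ} (hx : κ < x) (hη : 0 < η) : (x : ℂ) ∈ specStrip κ η :=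
  ⟨by simpa using hx, by simpa using hη, by simpa using hη⟩

theorem exists_ball_subset_specStrip {κ η : ℝ} {z₀ : ℂ} (h : z₀ ∈ specStrip κ η) :
    ∃ R > 0, Metric.ball z₀ R ⊆ specStrip κ η ∧ ∀ z ∈ Metric.ball z₀ R, ‖z‖ ≤ ‖z₀‖ + R := by
  obtain ⟨R, hR, hsub⟩ := Metric.isOpen_iff.1 (isOpen_specStrip κ η) z₀ h
  refine ⟨R, hR, hsub, fun z hz => ?_⟩
  have h1 := (mem_ball_iff_norm.1 hz).le
  linarith [norm_le_norm_add_norm_sub' z z₀]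

theorem differentiableOn_besselOp {α κ η ω m : ℝ} (hα : 0 < α) (hκ : 0 < κ) (hω : 0 < ω)
    (hακ : α < κ * ω) :
    DifferentiableOn ℂ (fun z : ℂ => besselOp α (z * m) (z * ω)) (specStrip κ η) := by
  intro z₀ hz₀
  obtain ⟨R, hR, hsub, hn⟩ := exists_ball_subset_specStrip hz₀
  refine (differentiableAt_kerOp hR (Φ := fun x => (‖z₀‖ + R) * ‖(m : ℂ)‖ *
    (Real.exp (α * |x|) * ‖besselAbs ((κ * ω : ℝ) : ℂ) x‖)) ?_ (fun z _ => ?_) (fun z hz t s => ?_)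
    fun t s z hz => ?_).differentiableWithinAt
  · exact (integrable_exp_mul_norm_besselAbs hα (by rw [Complex.ofReal_re]; exact hακ)).const_mul _
  · exact measurable_wker ((measurable_besselAbs _).const_mul _) _ _
  · have hre : κ < z.re := (hsub hz).1
    refine (norm_wker_neg_le (abs_of_pos hα).le _ t s).trans ?_
    rw [norm_mul, norm_mul]
    have h1 : ‖besselAbs (z * ω) (t - s)‖ ≤ ‖besselAbs ((κ * ω : ℝ) : ℂ) (t - s)‖ :=
      norm_besselAbs_le_of_le (by positivity) (by simp; gcongr) _
    calc _ ≤ Real.exp (α * |t - s|) * ((‖z₀‖ + R) * ‖(m : ℂ)‖ *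
          ‖besselAbs ((κ * ω : ℝ) : ℂ) (t - s)‖) := by
          gcongr
          exact hn z hz
      _ = _ := by ring
  · have hre : κ < z.re := (hsub hz).1
    have h1 := differentiableAt_besselKc_mul hω (abs_nonneg (t - s)) (hκ.trans hre)
    have h2 : DifferentiableAt ℂ (fun z : ℂ => (weight α t : ℂ) *
        (z * m * (besselKc (z * ω * (|t - s| : ℝ)) / Real.pi)) * weight (-α) s) z := by fun_prop
    exact h2.differentiableWithinAt

/-- On the strip `Re(zb) ≥ κ Re b - η|Im b|`, and the hypothesis keeps this rate above the weight.
-/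
theorem differentiableOn_expOp {α κ η : ℝ} {b g : ℂ} (hα : 0 < α) (hb : 0 < b.re)
    (h : α < κ * b.re - η * |b.im|) :
    DifferentiableOn ℂ (fun z : ℂ => expOp α (z * g) (z * b)) (specStrip κ η) := by
  intro z₀ hz₀
  obtain ⟨R, hR, hsub, hn⟩ := exists_ball_subset_specStrip hz₀
  refine (differentiableAt_kerOp hR (Φ := fun x => (‖z₀‖ + R) * ‖g‖ *
    (Real.exp (-((κ * b.re - η * |b.im| - α) * |x|)))) ?_ (fun z _ => ?_) (fun z hz t s => ?_)
    fun t s z hz => ?_).differentiableWithinAt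
  · exact (integrable_exp_neg_mul_abs (by linarith)).const_mul _
  · exact measurable_wker ((continuous_expAbs _).measurable.const_mul _) _ _
  · obtain ⟨hre, him1, him2⟩ := hsub hz
    refine (norm_wker_neg_le (abs_of_pos hα).le _ t s).trans ?_
    rw [norm_mul, norm_mul, norm_expAbs]
    have h2 : κ * b.re - η * |b.im| ≤ (z * b).re := by
      rw [Complex.mul_re]
      have h3 : z.im * b.im ≤ η * |b.im| := by
        refine (le_abs_self _).trans ?_
        rw [abs_mul]
        gcongr
        exact abs_le.2 ⟨le_of_lt him1, le_of_lt him2⟩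
      have h4 : κ * b.re ≤ z.re * b.re := by
        gcongr
        exact hre.le
      linarith
    calc _ ≤ Real.exp (α * |t - s|) * ((‖z₀‖ + R) * ‖g‖ *
          Real.exp (-((κ * b.re - η * |b.im|) * |t - s|))) := by
          gcongr
          exact hn z hz
      _ = (‖z₀‖ + R) * ‖g‖ * (Real.exp (α * |t - s|) *
          Real.exp (-((κ * b.re - η * |b.im|) * |t - s|))) := by ring
      _ = _ := by
          rw [← Real.exp_add]
          ring_nf
  · have h2 : DifferentiableAt ℂ (fun z : ℂ => (weight α t : ℂ) *
        (z * g * Complex.exp (-(z * b * (|t - s| : ℝ)))) * weight (-α) s) z := by fun_prop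
    exact h2.differentiableWithinAt

theorem norm_sq_div_mul (z : ℂ) (hz : z ≠ 0) (m E : ℝ) :
    ‖(z * m) ^ 2 / (z * E)‖ = ‖z‖ * (m ^ 2 / |E|) := by
  have : (z * m) ^ 2 / (z * E) = z * ((m : ℂ) ^ 2 / E) := by field_simp
  rw [this, norm_mul, norm_div, norm_pow, Complex.norm_real, Complex.norm_real, Real.norm_eq_abs,
    Real.norm_eq_abs, sq_abs]

/-- For complex `z` the wave may grow at rate up to `η|E|`, which the two decaying weights absorb.
-/
theorem differentiableOn_waveOp {α κ η m E : ℝ} (hα : 0 < α) (hκ : 0 < κ) (hE : E ≠ 0)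
    (h : η * |E| < α) :
    DifferentiableOn ℂ (fun z : ℂ => waveOp α (z * m) (z * E)) (specStrip κ η) := by
  intro z₀ hz₀
  obtain ⟨R, hR, hsub, hn⟩ := exists_ball_subset_specStrip hz₀
  have hne : ∀ z ∈ Metric.ball z₀ R, z ≠ 0 := fun z hz h0 => by
    have : κ < z.re := (hsub hz).1
    rw [h0, Complex.zero_re] at this
    linarith
  refine (differentiableAt_kerOp hR (Φ := fun x => (‖z₀‖ + R) * (m ^ 2 / |E|) *
    (Real.exp (-((α - η * |E|) * |x|)))) ?_ (fun z _ => ?_) (fun z hz t s => ?_)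
    fun t s z hz => ?_).differentiableWithinAt
  · exact (integrable_exp_neg_mul_abs (by linarith)).const_mul _
  · exact measurable_wker ((continuous_expAbs _).measurable.const_mul _) _ _
  · obtain ⟨hre, him1, him2⟩ := hsub hz
    refine (norm_wker_neg_neg_le hα.le _ t s).trans ?_
    rw [norm_mul, norm_sq_div_mul z (hne z hz), norm_expAbs]
    have h2 : -(η * |E|) ≤ (-(Complex.I * (z * E))).re := by
      have e : (-(Complex.I * (z * E))).re = z.im * E := by simp
      rw [e]
      refine le_trans ?_ (neg_abs_le _)
      rw [abs_mul, neg_le_neg_iff]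
      gcongr
      exact abs_le.2 ⟨le_of_lt him1, le_of_lt him2⟩
    calc _ ≤ Real.exp (-(α * |t - s|)) * ((‖z₀‖ + R) * (m ^ 2 / |E|) *
          Real.exp (-(-(η * |E|) * |t - s|))) := by
          gcongr
          exact hn z hz
      _ = (‖z₀‖ + R) * (m ^ 2 / |E|) * (Real.exp (-(α * |t - s|)) *
          Real.exp (-(-(η * |E|) * |t - s|))) := by ring
      _ = _ := by
          rw [← Real.exp_add]
          ring_nf
  · have hz0 : z * E ≠ 0 := mul_ne_zero (hne z hz) (Complex.ofReal_ne_zero.2 hE)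
    have h2 : DifferentiableAt ℂ (fun z : ℂ => (weight (-α) t : ℂ) *
        ((z * m) ^ 2 / (z * E) * Complex.exp (-(-(Complex.I * (z * E)) * (|t - s| : ℝ))))
          * weight (-α) s) z := by fun_prop (disch := exact hz0)
    exact h2.differentiableWithinAt

/-- One factor `κ` is lost in the decay of `K₁` and one in `Re z > κ`, whence the `κ²`. -/
theorem IsInterface.norm_pertKer_mul_le (hγ : IsInterface γ C₀ β) (hc : IsChordArcConst γ c)
    {α ε κ ω m : ℝ} (hα : 0 ≤ α) (hε : 0 ≤ ε) (hεβ : ε ≤ β - 2 * α) (hκ : 0 < κ) (hκ' : κ < 1)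
    (hm : 0 < m) (hω : 0 < ω) (hκε : α + 2 * ε ≤ κ ^ 2 * c * ω) {z : ℂ} (hz : κ < z.re) (t s : ℝ) :
    ‖pertKer γ α (z * m) (z * ω) t s‖ ≤ 2 * C₀ / (c ^ 3 * (1 - κ) ^ 3) *
      (‖z‖ ^ 2 * m * ω / (κ * ω) ^ 3) * (Real.exp (-(ε * |t|)) * Real.exp (-(ε * |t - s|))) := by
  have hre : (z * ω).re = z.re * ω := by simp
  have hz0 : 0 < z.re := hκ.trans hz
  have hc0 := hc.1
  have hC := hγ.C₀_pos
  have h1κ : 0 < 1 - κ := by linarith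
  refine (hγ.norm_pertKer_le hc hα hε hεβ hκ.le hκ' (z * m) (by rw [hre]; positivity) t s).trans ?_
  rw [hre, norm_mul, norm_mul, Complex.norm_real, Complex.norm_real, Real.norm_of_nonneg hm.le,
    Real.norm_of_nonneg hω.le]
  have e : ‖z‖ * m * (‖z‖ * ω) = ‖z‖ ^ 2 * m * ω := by ring
  rw [e]
  have h1 : ε ≤ κ * c * (z.re * ω) - α - ε := by
    have : κ ^ 2 * c * ω ≤ κ * c * (z.re * ω) := by
      calc κ ^ 2 * c * ω = κ * c * (κ * ω) := by ring
        _ ≤ _ := by gcongr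
    linarith
  gcongr

theorem IsInterface.differentiableOn_pertKer (hγ : IsInterface γ C₀ β) (hc : IsChordArcConst γ c)
    {α ε κ η ω m : ℝ} (hα : 0 ≤ α) (hε : 0 < ε) (hεβ : ε ≤ β - 2 * α) (hκ : 0 < κ) (hκ' : κ < 1)
    (hm : 0 < m) (hω : 0 < ω) (hκε : α + 2 * ε ≤ κ ^ 2 * c * ω) :
    DifferentiableOn ℂ (fun z : ℂ => kerOp (pertKer γ α (z * m) (z * ω))) (specStrip κ η) := by
  intro z₀ hz₀
  obtain ⟨R, hR, hsub, hn⟩ := exists_ball_subset_specStrip hz₀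
  have hc0 := hc.1
  have hC := hγ.C₀_pos
  have h1κ : 0 < 1 - κ := by linarith
  refine (differentiableAt_kerOp hR (Φ := fun x => 2 * C₀ / (c ^ 3 * (1 - κ) ^ 3) *
      ((‖z₀‖ + R) ^ 2 * m * ω / (κ * ω) ^ 3) * Real.exp (-(ε * |x|)))
      ?_ (fun z _ => ?_) (fun z hz t s => ?_) fun t s z hz => ?_).differentiableWithinAt
  · exact (integrable_exp_neg_mul_abs hε).const_mul _
  · exact hγ.measurable_pertKer _ _ _
  · refine (hγ.norm_pertKer_mul_le hc hα hε.le hεβ hκ hκ' hm hω hκε (hsub hz).1 t s).trans ?_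
    have h1 : Real.exp (-(ε * |t|)) ≤ 1 := by
      rw [Real.exp_le_one_iff]
      nlinarith [abs_nonneg t]
    calc _ ≤ 2 * C₀ / (c ^ 3 * (1 - κ) ^ 3) *
      ((‖z₀‖ + R) ^ 2 * m * ω / (κ * ω) ^ 3) * (1 * Real.exp (-(ε * |t - s|))) := by
          gcongr
          exact hn z hz
      _ = _ := by rw [one_mul]
  · have hre : κ < z.re := (hsub hz).1
    have h1 := differentiableAt_besselKc_mul hω (abs_nonneg (t - s)) (hκ.trans hre)
    have h1' := differentiableAt_besselKc_mul hω (norm_nonneg (γ t - γ s)) (hκ.trans hre)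
    have h2 : DifferentiableAt ℂ (fun z : ℂ => (weight α t : ℂ) *
        (z * m / Real.pi * (besselKc (z * ω * ‖γ t - γ s‖) - besselKc (z * ω * (|t - s| : ℝ))))
          * weight α s) z := by fun_prop
    exact h2.differentiableWithinAt

theorem IsInterface.isSchur_pertKer (hγ : IsInterface γ C₀ β) (hc : IsChordArcConst γ c)
    {α ε κ ω m : ℝ} (hα : 0 ≤ α) (hε : 0 < ε) (hεβ : ε ≤ β - 2 * α) (hκ : 0 < κ) (hκ' : κ < 1)
    (hm : 0 < m) (hω : 0 < ω) (hκε : α + 2 * ε ≤ κ ^ 2 * c * ω) {z : ℂ} (hz : κ < z.re) :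
    (∃ A, IsSchur (pertKer γ α (z * m) (z * ω)) A) ∧
      IsFiniteRankLimit (kerOp (pertKer γ α (z * m) (z * ω))) := by
  have hc0 := hc.1
  have hC := hγ.C₀_pos
  have h1κ : 0 < 1 - κ := by linarith
  have hb := hγ.norm_pertKer_mul_le hc hα hε.le hεβ hκ hκ' hm hω hκε hz
  have hS := IsSchur.of_le_sub (hγ.measurable_pertKer α (z * m) (z * ω))
    ((integrable_exp_neg_mul_abs hε).const_mul
      (2 * C₀ / (c ^ 3 * (1 - κ) ^ 3) * (‖z‖ ^ 2 * m * ω / (κ * ω) ^ 3))) fun t s => by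
        refine (hb t s).trans ?_
        gcongr
        refine mul_le_of_le_one_left (Real.exp_pos _).le ?_
        rw [Real.exp_le_one_iff]
        nlinarith [abs_nonneg t]
  exact ⟨⟨_, hS⟩, hS.isFiniteRankLimit
    (lintegral_lintegral_enorm_sq_lt_top hε hb)⟩

/-! ### Bounds for large spectral parameters -/

/-- Rescaling preserves the `L¹` norm, and for `L ≥ 1` the weight is dominated by its rescaled
version. The bound is therefore uniform in `L`. -/
theorem norm_kerOp_wker_scaled_le {α L : ℝ} (hα : 0 < α) (hL : 1 ≤ L) {φ : ℝ → ℂ}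
    (hφ : Measurable φ) (hi : Integrable fun x => Real.exp (α * |x|) * ‖φ x‖) :
    ‖kerOp (wker α (-α) fun x => L * φ (L * x))‖ ≤ ∫ x, Real.exp (α * |x|) * ‖φ x‖ := by
  have hL0 : 0 < L := by linarith
  have hS := IsSchur.of_le_sub
    (measurable_wker (φ := fun x => L * φ (L * x))
      ((hφ.comp (measurable_const_mul L)).const_mul (L : ℂ)) α (-α))
    ((hi.comp_mul_left' hL0.ne').const_mul L) fun t s => by
      refine (norm_wker_neg_le (abs_of_pos hα).le _ t s).trans ?_
      rw [norm_mul, Complex.norm_real, Real.norm_of_nonneg hL0.le, abs_mul, abs_of_pos hL0]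
      have : |t - s| ≤ L * |t - s| := le_mul_of_one_le_left (abs_nonneg _) hL
      calc _ ≤ Real.exp (α * (L * |t - s|)) * (L * ‖φ (L * (t - s))‖) := by gcongr
        _ = _ := by ring
  refine hS.norm_kerOp_le.trans (le_of_eq ?_)
  rw [integral_const_mul, Measure.integral_comp_mul_left (fun x => Real.exp (α * |x|) * ‖φ x‖) L,
    abs_of_pos (inv_pos.2 hL0), smul_eq_mul, mul_inv_cancel_left₀ hL0.ne']

theorem norm_besselOp_le {α ω L m : ℝ} (hα : 0 < α) (hω : α < ω) (hL : 1 ≤ L) :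
    ‖besselOp α ((L : ℂ) * m) ((L : ℂ) * ω)‖ ≤
      ∫ x, Real.exp (α * |x|) * ‖(m : ℂ) * besselAbs ω x‖ := by
  have h := norm_kerOp_wker_scaled_le hα hL ((measurable_besselAbs ω).const_mul (m : ℂ))
    (integrable_exp_mul_norm_const_mul m
      (integrable_exp_mul_norm_besselAbs hα (by rw [Complex.ofReal_re]; exact hω)))
  have e : besselOp α ((L : ℂ) * m) ((L : ℂ) * ω)
      = kerOp (wker α (-α) fun x => L * ((m : ℂ) * besselAbs ω (L * x))) := by
    rw [besselOp]
    congr 2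
    ext x
    rw [besselAbs, besselAbs, abs_mul, abs_of_pos (by linarith : 0 < L)]
    push_cast
    ring_nf
  rwa [e]

theorem norm_expOp_le {α L : ℝ} {b g : ℂ} (hα : 0 < α) (hb : α < b.re) (hL : 1 ≤ L) :
    ‖expOp α ((L : ℂ) * g) ((L : ℂ) * b)‖ ≤
      ∫ x, Real.exp (α * |x|) * ‖g * expAbs b x‖ := by
  have h := norm_kerOp_wker_scaled_le hα hL ((continuous_expAbs b).measurable.const_mul g)
    (integrable_exp_mul_norm_const_mul g (integrable_exp_mul_norm_expAbs hb))
  have e : expOp α ((L : ℂ) * g) ((L : ℂ) * b)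
      = kerOp (wker α (-α) fun x => L * (g * expAbs b (L * x))) := by
    rw [expOp]
    congr 2
    ext x
    rw [expAbs, expAbs, abs_mul, abs_of_pos (by linarith : 0 < L)]
    push_cast
    ring_nf
  rwa [e]

theorem norm_waveOp_le {α L m E : ℝ} (hα : 0 < α) (hL : 1 ≤ L) :
    ‖waveOp α ((L : ℂ) * m) ((L : ℂ) * E)‖ ≤ L * (m ^ 2 / |E| * (2 / α)) := by
  have hL0 : 0 < L := by linarith
  have hS := IsSchur.of_le_sub
    (measurable_wker (φ := fun x => ((L : ℂ) * m) ^ 2 / (L * E) * expAbs (-(Complex.I * (L * E))) x)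
      ((continuous_expAbs _).measurable.const_mul _) (-α) (-α))
    ((integrable_exp_neg_mul_abs hα).const_mul (L * (m ^ 2 / |E|))) fun t s => by
      refine (norm_wker_neg_neg_le hα.le _ t s).trans (le_of_eq ?_)
      have e : (-(Complex.I * ((L : ℂ) * E))).re = 0 := by simp
      rw [norm_mul, norm_sq_div_mul _ (Complex.ofReal_ne_zero.2 hL0.ne'), norm_expAbs, e,
        Complex.norm_real, Real.norm_of_nonneg hL0.le]
      simp
      ring
  refine hS.norm_kerOp_le.trans (le_of_eq ?_)
  rw [integral_const_mul, integral_exp_neg_mul_abs hα]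
  ring

/-- One power of `1/L` comes from the prefactor `|m||ω|/(Re ω)³`, the other from integrating
`e^{-Lε|x|}`. -/
theorem IsInterface.norm_kerOp_pertKer_le (hγ : IsInterface γ C₀ β) (hc : IsChordArcConst γ c)
    {α ε κ ω m L : ℝ} (hα : 0 ≤ α) (hε : 0 < ε) (hεβ : ε ≤ β - 2 * α) (hκ : 0 < κ) (hκ' : κ < 1)
    (hm : 0 < m) (hω : 0 < ω) (hκε : α + 2 * ε ≤ κ ^ 2 * c * ω) (hL : 1 ≤ L) :
    ‖kerOp (pertKer γ α ((L : ℂ) * m) ((L : ℂ) * ω))‖ ≤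
      2 * C₀ / (c ^ 3 * (1 - κ) ^ 3) * (m / ω ^ 2) * (2 / ε) / L ^ 2 := by
  have hL0 : 0 < L := by linarith
  have hc0 := hc.1
  have hC := hγ.C₀_pos
  have h1κ : 0 < 1 - κ := by linarith
  have hre : ((L : ℂ) * ω).re = L * ω := by simp
  have hS := IsSchur.of_le_sub (hγ.measurable_pertKer α ((L : ℂ) * m) ((L : ℂ) * ω))
    ((integrable_exp_neg_mul_abs (mul_pos hL0 hε)).const_mul
      (2 * C₀ / (c ^ 3 * (1 - κ) ^ 3) * (m / ω ^ 2 / L))) fun t s => by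
        refine (hγ.norm_pertKer_le hc hα hε.le hεβ hκ.le hκ' _ (by rw [hre]; positivity) t s).trans ?_
        rw [hre, norm_mul, norm_mul, Complex.norm_real, Complex.norm_real, Complex.norm_real,
          Real.norm_of_nonneg hm.le, Real.norm_of_nonneg hω.le, Real.norm_of_nonneg hL0.le]
        have e : L * m * (L * ω) / (L * ω) ^ 3 = m / ω ^ 2 / L := by field_simp
        have h1 : Real.exp (-(ε * |t|)) ≤ 1 := by
          rw [Real.exp_le_one_iff]
          nlinarith [abs_nonneg t]
        have h2 : L * ε ≤ κ * c * (L * ω) - α - ε := by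
          have h3 : κ ^ 2 * c * ω ≤ κ * c * ω := by
            have : κ ^ 2 ≤ κ := by nlinarith
            gcongr
          nlinarith
        rw [e]
        calc _ ≤ 2 * C₀ / (c ^ 3 * (1 - κ) ^ 3) * (m / ω ^ 2 / L) *
            (1 * Real.exp (-(L * ε * |t - s|))) := by gcongr
          _ = _ := by rw [one_mul]
  refine hS.norm_kerOp_le.trans (le_of_eq ?_)
  rw [integral_const_mul, integral_exp_neg_mul_abs (mul_pos hL0 hε)]
  field_simp

end

section

/-! ### The incident field on the interface -/

theorem green_eq_besselKc (ω : ℝ) (x y : Plane) :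
    (green ω x y : ℂ) = (2 * Real.pi : ℂ)⁻¹ * besselKc (ω * ‖x - y‖) := by
  rw [green, ← Complex.ofReal_mul ω, besselKc_ofReal]
  push_cast
  rfl

theorem green_nonneg (ω : ℝ) (x y : Plane) : 0 ≤ green ω x y :=
  mul_nonneg (by positivity) (besselK_nonneg _ _)

variable {γ : ℝ → Plane} {C₀ β c : ℝ}

theorem IsInterface.measurable_green (hγ : IsInterface γ C₀ β) (ω : ℝ) :
    Measurable fun p : ℝ × Plane => (green ω (γ p.1) p.2 : ℂ) := by
  have hc := hγ.differentiable.continuous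
  simp only [green_eq_besselKc]
  refine Measurable.const_mul ?_ _
  exact measurable_besselKc.comp (by fun_prop : Continuous fun p : ℝ × Plane =>
    (ω : ℂ) * (‖γ p.1 - p.2‖ : ℂ)).measurable

theorem IsChordArcConst.le_norm_sub (hc : IsChordArcConst γ c) (y : Plane) (t : ℝ) :
    c * |t| - (‖γ 0‖ + ‖y‖) ≤ ‖γ t - y‖ := by
  have h1 := hc.2 0 t
  rw [sub_zero] at h1
  have h2 : ‖γ t - γ 0‖ ≤ ‖γ t - y‖ + (‖y‖ + ‖γ 0‖) := by
    calc ‖γ t - γ 0‖ = ‖(γ t - y) + (y - γ 0)‖ := by congr 1; abel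
      _ ≤ _ := (norm_add_le _ _).trans (by gcongr; exact _root_.norm_sub_le _ _)
  linarith

/-- Every point of the plane has a nearest point on the interface, so that its distance to `γ t`
is comparable to a distance of parameters. -/
theorem IsInterface.exists_le_norm_sub (hγ : IsInterface γ C₀ β) (hc : IsChordArcConst γ c)
    (y : Plane) : ∃ t₀, ∀ t, c / 2 * |t - t₀| ≤ ‖γ t - y‖ := by
  have hlim : Tendsto (fun t => ‖γ t - y‖) (cocompact ℝ) atTop := by
    refine tendsto_atTop_mono (hc.le_norm_sub y) ?_
    exact tendsto_atTop_add_const_right _ _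
      ((tendsto_norm_cocompact_atTop (E := ℝ)).const_mul_atTop hc.1)
  have hcont := hγ.differentiable.continuous
  obtain ⟨t₀, ht₀⟩ := (by fun_prop : Continuous fun t => ‖γ t - y‖).exists_forall_le hlim
  refine ⟨t₀, fun t => ?_⟩
  have h1 := hc.2 t₀ t
  have h2 : ‖γ t - γ t₀‖ ≤ ‖γ t - y‖ + ‖γ t₀ - y‖ := by
    calc ‖γ t - γ t₀‖ = ‖(γ t - y) - (γ t₀ - y)‖ := by congr 1; abel
      _ ≤ _ := _root_.norm_sub_le _ _
  linarith [ht₀ t]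

/-- Splits the squared singularity into a bounded and an integrable part. -/
theorem abs_rpow_neg_half_le (x : ℝ) :
    |x| ^ (-(1 / 2) : ℝ) ≤ 1 + Real.exp 1 * (|x| ^ (-(1 / 2) : ℝ) * Real.exp (-(1 * |x|))) := by
  have h0 : 0 ≤ |x| ^ (-(1 / 2) : ℝ) := Real.rpow_nonneg (abs_nonneg x) _
  rcases le_total 1 |x| with h | h
  · have h1 := Real.rpow_le_one_of_one_le_of_nonpos h (by norm_num : (-(1 / 2) : ℝ) ≤ 0)
    have : 0 ≤ Real.exp 1 * (|x| ^ (-(1 / 2) : ℝ) * Real.exp (-(1 * |x|))) := by positivity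
    linarith
  · have h1 : 1 ≤ Real.exp 1 * Real.exp (-(1 * |x|)) := by
      rw [← Real.exp_add, Real.one_le_exp_iff]
      linarith
    nlinarith

/-- Uniform weighted square integrability of the Green's function along the interface. -/
theorem IsInterface.exists_lintegral_green_sq_le (hγ : IsInterface γ C₀ β)
    (hc : IsChordArcConst γ c) {ω α : ℝ} (hω : 0 < ω) (hα : 0 ≤ α) (hαω : α < c * ω) (R : ℝ) :
    ∃ M : ℝ≥0∞, M ≠ ∞ ∧ ∀ y : Plane, ‖y‖ ≤ R →
      ∫⁻ t, (‖(weight α t : ℂ)‖ₑ * ‖(green ω (γ t) y : ℂ)‖ₑ) ^ 2 ≤ M := by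
  have hc0 := hc.1
  obtain ⟨κ, hκ1, hκ2⟩ := exists_between ((div_lt_one (hα.trans_lt hαω)).2 hαω)
  have hκ0 : 0 ≤ κ := (div_nonneg hα (hα.trans hαω.le)).trans hκ1.le
  rw [div_lt_iff₀ (hα.trans_lt hαω)] at hκ1
  have h1κ : 0 < 1 - κ := by linarith
  -- The decay left after the weight is paid; positive by the choice of `κ` between `α/(cω)` and 1.
  set δ := κ * (c * ω) - α with hδ
  have hδ0 : 0 < δ := by linarith
  set D := (4 * ((1 - κ) / 2) ^ (-(1 / 4) : ℝ) * (ω * (c / 2)) ^ (-(1 / 4) : ℝ) *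
    Real.exp (κ * ω * (‖γ 0‖ + R))) with hD
  have hD0 : 0 ≤ D := by positivity
  set Ψ : ℝ → ℝ := fun x => Real.exp 1 * (|x| ^ (-(1 / 2) : ℝ) * Real.exp (-(1 * |x|))) with hΨ
  have hΨi : Integrable Ψ := (integrable_abs_rpow_mul_exp one_pos (by norm_num)).const_mul _
  have hei := integrable_exp_neg_mul_abs (mul_pos two_pos hδ0)
  refine ⟨ENNReal.ofReal (D ^ 2) * ((∫⁻ t, ENNReal.ofReal (Real.exp (-(2 * δ * |t|))))
    + ∫⁻ x, ENNReal.ofReal (Ψ x)), ?_, fun y hy => ?_⟩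
  · exact (ENNReal.mul_lt_top ENNReal.ofReal_lt_top
      (ENNReal.add_lt_top.2 ⟨hei.lintegral_lt_top, hΨi.lintegral_lt_top⟩)).ne
  obtain ⟨t₀, ht₀⟩ := hγ.exists_le_norm_sub hc y
  have hpt : ∀ t, t ≠ t₀ → weight α t * green ω (γ t) y ≤
      D * (|t - t₀| ^ (-(1 / 4) : ℝ) * Real.exp (-(δ * |t|))) := fun t ht => by
    have hr : 0 < |t - t₀| := abs_pos.2 (sub_ne_zero.2 ht)
    set d := ‖γ t - y‖ with hd
    have hd0 : 0 < d := lt_of_lt_of_le (by positivity) (ht₀ t)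
    have h1 : green ω (γ t) y ≤ besselK 0 (ω * d) := by
      rw [green]
      refine mul_le_of_le_one_left (besselK_nonneg _ _) (inv_le_one_of_one_le₀ ?_)
      linarith [Real.pi_gt_three]
    have h2 := besselK_zero_le hκ0 hκ2 (x := ω * d) (by positivity)
    have h3 : (ω * d) ^ (-(1 / 4) : ℝ) ≤ (ω * (c / 2)) ^ (-(1 / 4) : ℝ) *
        |t - t₀| ^ (-(1 / 4) : ℝ) := by
      rw [← Real.mul_rpow (by positivity) hr.le]
      refine Real.rpow_le_rpow_of_nonpos (by positivity) ?_ (by norm_num)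
      rw [mul_assoc]
      gcongr
      exact ht₀ t
    have h4 : weight α t * Real.exp (-(κ * (ω * d))) ≤
        Real.exp (κ * ω * (‖γ 0‖ + R)) * Real.exp (-(δ * |t|)) := by
      rw [weight, ← Real.exp_add, ← Real.exp_add, Real.exp_le_exp]
      have h5 : c * |t| - (‖γ 0‖ + R) ≤ d := by linarith [hc.le_norm_sub y t]
      have := mul_le_mul_of_nonneg_left h5 (mul_nonneg hκ0 hω.le)
      rw [hδ]
      nlinarith
    have hw := weight_pos α t
    calc weight α t * green ω (γ t) y ≤ weight α t * (4 * ((1 - κ) / 2) ^ (-(1 / 4) : ℝ) *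
          ((ω * d) ^ (-(1 / 4) : ℝ) * Real.exp (-(κ * (ω * d))))) := by
          gcongr
          exact h1.trans h2
      _ = 4 * ((1 - κ) / 2) ^ (-(1 / 4) : ℝ) * (ω * d) ^ (-(1 / 4) : ℝ) *
          (weight α t * Real.exp (-(κ * (ω * d)))) := by ring
      _ ≤ 4 * ((1 - κ) / 2) ^ (-(1 / 4) : ℝ) * ((ω * (c / 2)) ^ (-(1 / 4) : ℝ) *
          |t - t₀| ^ (-(1 / 4) : ℝ)) *
          (Real.exp (κ * ω * (‖γ 0‖ + R)) * Real.exp (-(δ * |t|))) := by gcongr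
      _ = _ := by rw [hD]; ring
  have hsq : ∀ t, t ≠ t₀ → (‖(weight α t : ℂ)‖ₑ * ‖(green ω (γ t) y : ℂ)‖ₑ) ^ 2 ≤
      ENNReal.ofReal (D ^ 2) * (ENNReal.ofReal (Real.exp (-(2 * δ * |t|)))
        + ENNReal.ofReal (Ψ (t - t₀))) := fun t ht => by
    have hΨ0 : 0 ≤ Ψ (t - t₀) := by rw [hΨ]; positivity
    rw [← ENNReal.ofReal_add (by positivity) hΨ0, ← ENNReal.ofReal_mul (by positivity),
      ← ofReal_norm, ← ofReal_norm, norm_weight, Complex.norm_real,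
      Real.norm_of_nonneg (green_nonneg _ _ _), ← ENNReal.ofReal_mul (weight_pos α t).le,
      ← ENNReal.ofReal_pow (mul_nonneg (weight_pos α t).le (green_nonneg _ _ _))]
    refine ENNReal.ofReal_le_ofReal ?_
    have h1 := pow_le_pow_left₀ (mul_nonneg (weight_pos α t).le (green_nonneg _ _ _)) (hpt t ht) 2
    refine h1.trans ?_
    have e1 : (|t - t₀| ^ (-(1 / 4) : ℝ)) ^ 2 = |t - t₀| ^ (-(1 / 2) : ℝ) := by
      rw [← Real.rpow_natCast, ← Real.rpow_mul (abs_nonneg _)]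
      norm_num
    have e2 : Real.exp (-(δ * |t|)) ^ 2 = Real.exp (-(2 * δ * |t|)) := by
      rw [← Real.exp_nat_mul]
      push_cast
      ring_nf
    rw [mul_pow D, mul_pow (|t - t₀| ^ (-(1 / 4) : ℝ)), e1, e2]
    gcongr
    have h2 := abs_rpow_neg_half_le (t - t₀)
    have h3 : Real.exp (-(2 * δ * |t|)) ≤ 1 := by
      rw [Real.exp_le_one_iff]
      nlinarith [abs_nonneg t]
    have h4 := Real.exp_pos (-(2 * δ * |t|))
    calc |t - t₀| ^ (-(1 / 2) : ℝ) * Real.exp (-(2 * δ * |t|))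
        ≤ (1 + Ψ (t - t₀)) * Real.exp (-(2 * δ * |t|)) := by gcongr
      _ = Real.exp (-(2 * δ * |t|)) + Ψ (t - t₀) * Real.exp (-(2 * δ * |t|)) := by ring
      _ ≤ Real.exp (-(2 * δ * |t|)) + Ψ (t - t₀) * 1 := by gcongr
      _ = _ := by rw [mul_one]
  calc ∫⁻ t, (‖(weight α t : ℂ)‖ₑ * ‖(green ω (γ t) y : ℂ)‖ₑ) ^ 2
      ≤ ∫⁻ t, ENNReal.ofReal (D ^ 2) * (ENNReal.ofReal (Real.exp (-(2 * δ * |t|)))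
        + ENNReal.ofReal (Ψ (t - t₀))) := by
        refine lintegral_mono_ae ?_
        filter_upwards [compl_mem_ae_iff.2 (measure_singleton t₀)] with t ht
        exact hsq t ht
    _ = _ := by
        rw [lintegral_const_mul' _ _ ENNReal.ofReal_ne_top, lintegral_add_left (by fun_prop),
          lintegral_sub_right_eq_self (fun x => ENNReal.ofReal (Ψ x)) t₀]

/-- Cauchy-Schwarz with density `|f|`, then Tonelli: compact support reduces the claim to the
Green's function bound, uniform over sources in a ball. -/
theorem IsInterface.memLp_incident (hγ : IsInterface γ C₀ β)
    (hc : IsChordArcConst γ c) {ω α : ℝ} (hω : 0 < ω) (hα : 0 ≤ α) (hαω : α < c * ω)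
    {f : Plane → ℂ} (hf : Integrable f) (hfc : HasCompactSupport f) :
    MemLp (fun t => (weight α t : ℂ) * incident ω f (γ t)) 2 volume := by
  obtain ⟨R, hR⟩ := hfc.isCompact.isBounded.exists_norm_le
  obtain ⟨M, hM, hMy⟩ := hγ.exists_lintegral_green_sq_le hc hω hα hαω R
  have hfm : AEMeasurable (fun y => ‖f y‖ₑ) := hf.1.enorm
  have hgm := hγ.measurable_green ω
  have hwm := measurable_ofReal_weight α
  have hmeas : AEStronglyMeasurable (fun t => (weight α t : ℂ) * incident ω f (γ t)) volume :=
    hwm.aestronglyMeasurable.mul (AEStronglyMeasurable.integral_prod_right'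
      (f := fun p : ℝ × Plane => (green ω (γ p.1) p.2 : ℂ) * f p.2)
      (hgm.aestronglyMeasurable.mul hf.1.comp_snd))
  have hFm : AEMeasurable (Function.uncurry fun (t : ℝ) (y : Plane) =>
      ‖f y‖ₑ * (‖(weight α t : ℂ)‖ₑ * ‖(green ω (γ t) y : ℂ)‖ₑ) ^ 2)
      ((volume : Measure ℝ).prod volume) :=
    hfm.comp_snd.mul (((hwm.comp measurable_fst).enorm.mul hgm.enorm).pow_const 2).aemeasurable
  have hsq : ∫⁻ t, ‖(weight α t : ℂ) * incident ω f (γ t)‖ₑ ^ 2 < ∞ := by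
    calc ∫⁻ t, ‖(weight α t : ℂ) * incident ω f (γ t)‖ₑ ^ 2
        ≤ ∫⁻ t, (∫⁻ y, ‖f y‖ₑ) * ∫⁻ y, ‖f y‖ₑ *
            (‖(weight α t : ℂ)‖ₑ * ‖(green ω (γ t) y : ℂ)‖ₑ) ^ 2 := by
          refine lintegral_mono fun t => ?_
          have h1 : ‖(weight α t : ℂ) * incident ω f (γ t)‖ₑ ≤
              ∫⁻ y, ‖f y‖ₑ * (‖(weight α t : ℂ)‖ₑ * ‖(green ω (γ t) y : ℂ)‖ₑ) := by
            rw [enorm_mul]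
            calc ‖(weight α t : ℂ)‖ₑ * ‖incident ω f (γ t)‖ₑ ≤ ‖(weight α t : ℂ)‖ₑ *
                  ∫⁻ y, ‖(green ω (γ t) y : ℂ)‖ₑ * ‖f y‖ₑ := by
                  gcongr
                  refine (enorm_integral_le_lintegral_enorm _).trans ?_
                  simp only [enorm_mul, le_refl]
              _ = ∫⁻ y, ‖(weight α t : ℂ)‖ₑ * (‖(green ω (γ t) y : ℂ)‖ₑ * ‖f y‖ₑ) :=
                  (lintegral_const_mul' _ _ enorm_ne_top).symm
              _ ≤ _ := le_of_eq (lintegral_congr fun y => by ring)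
          refine (pow_le_pow_left' h1 2).trans (sq_lintegral_mul_le hfm ?_)
          exact (((hgm.comp measurable_prodMk_left).enorm).const_mul _).aemeasurable
      _ = (∫⁻ y, ‖f y‖ₑ) * ∫⁻ t, ∫⁻ y, ‖f y‖ₑ *
            (‖(weight α t : ℂ)‖ₑ * ‖(green ω (γ t) y : ℂ)‖ₑ) ^ 2 :=
          lintegral_const_mul' _ _ hf.2.ne
      _ = (∫⁻ y, ‖f y‖ₑ) * ∫⁻ y, ∫⁻ t, ‖f y‖ₑ *
            (‖(weight α t : ℂ)‖ₑ * ‖(green ω (γ t) y : ℂ)‖ₑ) ^ 2 := by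
          rw [lintegral_lintegral_swap hFm]
      _ ≤ (∫⁻ y, ‖f y‖ₑ) * ∫⁻ y, ‖f y‖ₑ * M := by
          gcongr with y
          rw [lintegral_const_mul' _ _ enorm_ne_top]
          by_cases hy : f y = 0
          · simp [hy]
          · gcongr
            exact hMy y (hR y (subset_tsupport f hy))
      _ = (∫⁻ y, ‖f y‖ₑ) * ((∫⁻ y, ‖f y‖ₑ) * M) := by
          rw [lintegral_mul_const' _ _ hM]
      _ < ∞ := ENNReal.mul_lt_top hf.2 (ENNReal.mul_lt_top hf.2 hM.lt_top)
  refine ⟨hmeas, ?_⟩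
  rw [lintegral_enorm_sq_eq] at hsq
  by_contra! h'
  rw [top_le_iff] at h'
  simp [h'] at hsq

end

section

/-! ### The weighted integral equation -/

variable {γ : ℝ → Plane}

theorem weight_neg_two_mul (α t : ℝ) :
    (weight (-(2 * α)) t : ℂ) = weight (-α) t * weight (-α) t := by
  rw [← Complex.ofReal_mul, weight_mul]
  ring_nf

theorem coeFn_weightOp {α : ℝ} (hα : 0 ≤ α) (f : L2) :
    weightOp α f =ᵐ[volume] fun t => (weight (-(2 * α)) t : ℂ) * f t :=
  coeFn_mulOp (measurable_ofReal_weight _) (norm_weight_le_one (by linarith)) f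

theorem coeFn_weightOp_add_waveOp {α m E : ℝ} (hα : 0 < α) {ρ σ : L2}
    (h : ∀ᵐ t, σ t = weight α t * ρ t) :
    ∀ᵐ t, (weightOp α + waveOp α m E) σ t = weight (-α) t * opP m E ρ t := by
  obtain ⟨A, hA⟩ := isSchur_wker_neg_neg_expAbs hα (b := -(Complex.I * E)) (by simpa using hα)
    ((m : ℂ) ^ 2 / E)
  rw [add_apply]
  filter_upwards [Lp.coeFn_add (weightOp α σ) (waveOp α m E σ), coeFn_weightOp hα.le σ,
    hA.coeFn_kerOp σ, h] with t h1 h2 h3 h4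
  rw [h1, Pi.add_apply, h2, waveOp, h3, h4, opP, opQ, kerFun, weight_neg_two_mul, mul_add]
  congr 1
  · linear_combination (weight (-α) t * ρ t : ℂ) * weight_neg_mul α t
  · rw [← integral_const_mul, ← integral_const_mul]
    refine integral_congr_ae ?_
    filter_upwards [h] with s hs
    have e : expAbs (-(Complex.I * E)) (t - s)
        = Complex.exp (Complex.I * ((E * |t - s| : ℝ) : ℂ)) := by
      rw [expAbs]
      push_cast
      ring_nf
    rw [wker, hs, e]
    push_cast
    linear_combination (weight (-α) t * ((m : ℂ) ^ 2 / E *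
      Complex.exp (Complex.I * (E * (|t - s| : ℝ)))) * ρ s : ℂ) * weight_neg_mul α s

/-- The curved kernel is the straight one plus the perturbation. Since `pertKer` carries growing
weights, `w_α⁻²` restores the outer weight. -/
theorem two_mul_green (γ : ℝ → Plane) (α m ω t s : ℝ) :
    (weight (-α) t : ℂ) * (2 * m * green ω (γ t) (γ s))
      = (wker (-α) α (fun x => m * besselAbs ω x) t s
        + weight (-(2 * α)) t * pertKer γ α m ω t s) * weight (-α) s := by
  have hπ : (Real.pi : ℂ) ≠ 0 := Complex.ofReal_ne_zero.2 Real.pi_ne_zero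
  rw [green_eq_besselKc, wker, pertKer, weight_neg_two_mul, besselAbs]
  have e : (2 * (m : ℂ) * ((2 * Real.pi : ℂ)⁻¹ * besselKc (ω * ‖γ t - γ s‖)))
      = m * (besselKc (ω * (|t - s| : ℝ)) / Real.pi) + m / Real.pi *
        (besselKc (ω * ‖γ t - γ s‖) - besselKc (ω * (|t - s| : ℝ))) := by
    field_simp
    ring
  rw [e]
  set X := besselKc (ω * (|t - s| : ℝ))
  set Y := besselKc (ω * ‖γ t - γ s‖)
  linear_combination (-(weight (-α) t * (m * (X / Real.pi)
      + m / Real.pi * (Y - X) * (weight (-α) t * weight α t)) : ℂ)) * weight_mul_neg α s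
    - (weight (-α) t * (m / Real.pi * (Y - X)) : ℂ) * weight_neg_mul α t

theorem coeFn_sub_pertKer {α m E A : ℝ} (hα : 0 < α) (hω : α < freq m E)
    (hM : IsSchur (pertKer γ α m (freq m E)) A) {ν : L2} {μ : ℝ → ℂ}
    (h : ∀ᵐ t, ν t = weight (-α) t * μ t) :
    ∀ᵐ t, ((1 - besselOp (-α) m (freq m E)) ν
      - weightOp α (kerOp (pertKer γ α m (freq m E)) ν)) t = weight (-α) t * opL γ m E μ t := by
  obtain ⟨B, hB⟩ := isSchur_wker_besselAbs hα (by rw [abs_neg, abs_of_pos hα])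
    (by rwa [Complex.ofReal_re]) (α₁ := -α) (ω := freq m E) (m : ℂ)
  rw [sub_apply, one_apply_eq_self, besselOp]
  rw [neg_neg] at *
  set k := wker (-α) α fun x => (m : ℂ) * besselAbs (freq m E) x with hk
  set p := pertKer γ α m (freq m E) with hp
  filter_upwards [Lp.coeFn_sub (ν - kerOp k ν) (weightOp α (kerOp p ν)),
    Lp.coeFn_sub ν (kerOp k ν), coeFn_weightOp hα.le (kerOp p ν), hB.coeFn_kerOp ν,
    hM.coeFn_kerOp ν, hB.ae_integrable (Lp.memLp ν), hM.ae_integrable (Lp.memLp ν), h]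
    with t h1 h2 h3 h4 h5 h6 h7 h8
  have e : (weight (-α) t : ℂ) * (2 * m * singleLayer γ (freq m E) μ t)
      = kerFun k ν t + weight (-(2 * α)) t * kerFun p ν t := by
    rw [singleLayer, kerFun, kerFun, ← integral_const_mul, ← integral_const_mul,
      ← integral_const_mul, ← integral_add h6 (h7.const_mul _)]
    refine integral_congr_ae ?_
    filter_upwards [h] with s hs
    rw [hs]
    linear_combination (μ s) * two_mul_green γ α m (freq m E) t s
  rw [h1, Pi.sub_apply, h2, Pi.sub_apply, h3, h4, h5, h8, opL]
  linear_combination e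

/-- Both sides are multiplied by the nowhere vanishing `w_{-α}`, which puts every term in `L²`, and
the curvature contribution is moved to the right as data for the straight-line problem. -/
theorem solvesBIE_iff {α m E A : ℝ} (hα : 0 < α) (hω : α < freq m E)
    (hM : IsSchur (pertKer γ α m (freq m E)) A) {f : Plane → ℂ} {ρ σ b : L2}
    (hσ : ∀ᵐ t, σ t = weight α t * ρ t)
    (hb : ∀ᵐ t, b t = weight α t * (2 * m * incident (freq m E) f (γ t))) :
    SolvesBIE γ m E f ρ ↔
      ((1 - besselOp (-α) m (freq m E)) * (weightOp α + waveOp α m E)) σ = weightOp α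
        (b + kerOp (pertKer γ α m (freq m E)) ((weightOp α + waveOp α m E) σ)) := by
  have h1 := coeFn_sub_pertKer hα hω hM (coeFn_weightOp_add_waveOp (m := m) (E := E) hα hσ)
  rw [mul_apply_eq_comp, map_add, ← sub_eq_iff_eq_add, Lp.ext_iff]
  have hw : ∀ t, (weight (-α) t : ℂ) ≠ 0 := fun t =>
    Complex.ofReal_ne_zero.2 (weight_pos _ _).ne'
  have hb' : ∀ᵐ t, weightOp α b t = weight (-α) t * (2 * m * incident (freq m E) f (γ t)) := by
    filter_upwards [coeFn_weightOp hα.le b, hb] with t h2 h3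
    rw [h2, h3, weight_neg_two_mul]
    linear_combination (weight (-α) t * (2 * m * incident (freq m E) f (γ t)) : ℂ) *
      weight_neg_mul α t
  constructor
  · intro h
    filter_upwards [h1, hb', h] with t h2 h3 h4
    rw [h2, h3, h4]
  · intro h
    filter_upwards [h1, hb', h] with t h2 h3 h4
    rw [h2, h3] at h4
    exact mul_left_cancel₀ (hw t) h4

/-- Unique solvability of the weighted equation gives unique solvability in the weighted space. -/
theorem existsUnique_weightedL2 {α : ℝ} (hα : 0 ≤ α) {P Q : L2 → Prop}
    (h : ∀ ρ σ : L2, (∀ᵐ t, σ t = weight α t * ρ t) → (P ρ ↔ Q σ)) (hQ : ∃! σ, Q σ) :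
    ∃! ρ, ρ ∈ weightedL2 α ∧ P ρ := by
  obtain ⟨σ, hσ, huniq⟩ := hQ
  have hm : MemLp (fun t => (weight (-α) t : ℂ) * σ t) 2 volume :=
    memLp_mul_of_bound (measurable_ofReal_weight _) (norm_weight_le_one hα) (Lp.memLp σ)
  have hρ : ∀ᵐ t, σ t = weight α t * hm.toLp _ t := by
    filter_upwards [hm.coeFn_toLp] with t ht
    rw [ht]
    linear_combination (-σ t) * weight_mul_neg α t
  refine ⟨hm.toLp _, ⟨(memLp_congr_ae hρ).1 (Lp.memLp σ), (h _ _ hρ).2 hσ⟩, ?_⟩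
  rintro ρ' ⟨hρ', hP⟩
  have hσ' : ∀ᵐ t, (MemLp.toLp _ hρ' : L2) t = weight α t * ρ' t := MemLp.coeFn_toLp hρ'
  have e := huniq _ ((h _ _ hσ').1 hP)
  refine Lp.ext ?_
  rw [e] at hσ'
  filter_upwards [hσ', hρ] with t h1 h2
  rw [h1] at h2
  exact mul_left_cancel₀ (Complex.ofReal_ne_zero.2 (weight_pos α t).ne') h2

theorem existsUnique_fixed {H : Type*} [NormedAddCommGroup H] [NormedSpace ℂ H]
    {T M N : H →L[ℂ] H} (hu : IsUnit (1 - T * M * N)) (b : H) :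
    ∃! σ, σ = T (b + M (N σ)) := by
  obtain ⟨u, hu⟩ := hu
  have key : ∀ σ, σ = T (b + M (N σ)) ↔ (u : H →L[ℂ] H) σ = T b := fun σ => by
    rw [hu, sub_apply, one_apply_eq_self, mul_apply_eq_comp, mul_apply_eq_comp, map_add,
      sub_eq_iff_eq_add]
  refine ⟨(↑u⁻¹ : H →L[ℂ] H) (T b), ?_, fun σ hσ => ?_⟩
  · refine (key _).2 ?_
    rw [← mul_apply_eq_comp, u.mul_inv, one_apply_eq_self]
  · rw [← (key σ).1 hσ, ← mul_apply_eq_comp, u.inv_mul, one_apply_eq_self]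

/-! ### The characteristic rate of the flat interface -/

/-- The given rate is the positive root of `x⁴ + E²x² = m⁴`, which makes the real part of the square
`-E²`; the cross term contributes `-2im²`. -/
theorem flatRate_sq {m E x : ℝ}
    (hx : x = Real.sqrt ((Real.sqrt (4 * m ^ 4 + E ^ 4) - E ^ 2) / 2)) (hx0 : 0 < x) :
    ((x : ℂ) - Complex.I * (m ^ 2 / x : ℝ)) ^ 2 = -(E ^ 2 + 2 * Complex.I * m ^ 2) := by
  have h1 : 0 ≤ (Real.sqrt (4 * m ^ 4 + E ^ 4) - E ^ 2) / 2 := by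
    by_contra! h
    rw [Real.sqrt_eq_zero_of_nonpos h.le] at hx
    exact hx0.ne' hx
  have h2 : x ^ 2 = (Real.sqrt (4 * m ^ 4 + E ^ 4) - E ^ 2) / 2 := by rw [hx, Real.sq_sqrt h1]
  have h3 : Real.sqrt (4 * m ^ 4 + E ^ 4) ^ 2 = 4 * m ^ 4 + E ^ 4 := Real.sq_sqrt (by positivity)
  have h4 : x ^ 2 - (m ^ 2 / x) ^ 2 = -E ^ 2 := by
    field_simp
    have h5 : Real.sqrt (4 * m ^ 4 + E ^ 4) = 2 * x ^ 2 + E ^ 2 := by linarith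
    rw [h5] at h3
    linear_combination h3 / 4
  have h6 : x * (m ^ 2 / x) = m ^ 2 := by field_simp
  have h4' : (x : ℂ) ^ 2 - ((m ^ 2 / x : ℝ) : ℂ) ^ 2 = -(E : ℂ) ^ 2 := by exact_mod_cast h4
  have h6' : (x : ℂ) * ((m ^ 2 / x : ℝ) : ℂ) = (m : ℂ) ^ 2 := by exact_mod_cast h6
  linear_combination h4' - 2 * Complex.I * h6' + ((m ^ 2 / x : ℝ) : ℂ) ^ 2 * Complex.I_sq

theorem freq_mul {lam : ℝ} (h : 0 ≤ lam) (m E : ℝ) :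
    freq (lam * m) (lam * E) = lam * freq m E := by
  rw [freq, freq, mul_pow, mul_pow, ← mul_sub, Real.sqrt_mul (by positivity), Real.sqrt_sq h]

/-! ### Finiteness of the exceptional set -/

/-- An infinite exceptional set in a compact interval would accumulate at a point of the interval,
where `p` holds on a punctured neighbourhood. -/
theorem finite_of_eventually_nhdsNE {p : ℂ → Prop} {a b : ℝ}
    (h : ∀ x ∈ Icc a b, ∀ᶠ w in 𝓝[≠] (x : ℂ), p w) : {x | x ∈ Icc a b ∧ ¬ p (x : ℂ)}.Finite := by
  by_contra hinf
  obtain ⟨x, hx, hacc⟩ := Set.Infinite.exists_accPt_of_subset_isCompact hinf isCompact_Icc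
    fun x hx => hx.1
  rw [accPt_iff_frequently_nhdsNE] at hacc
  have ht : Tendsto (fun y : ℝ => (y : ℂ)) (𝓝[≠] x) (𝓝[≠] (x : ℂ)) :=
    tendsto_nhdsWithin_iff.2 ⟨Complex.continuous_ofReal.continuousAt.tendsto.mono_left
      nhdsWithin_le_nhds, eventually_nhdsWithin_of_forall fun y hy => by simpa using hy⟩
  obtain ⟨y, hy1, hy2⟩ := (hacc.and_eventually (ht.eventually (h x hx))).exists
  exact hy1.2 hy2

end

section

/-! ### Invertibility and unique solvability -/

variable {γ : ℝ → Plane} {C₀ β c : ℝ}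

/-- The operator `B` for which the weighted integral equation reads `(1 - B) σ = τ`. -/
def reducedOp (γ : ℝ → Plane) (α : ℝ) (m E ω g b : ℂ) : L2 →L[ℂ] L2 :=
  (1 + expOp α g b) * (1 + besselOp α m ω) * kerOp (pertKer γ α m ω) * (weightOp α + waveOp α m E)

theorem IsInterface.finite_not_isUnit (hγ : IsInterface γ C₀ β) (hc : IsChordArcConst γ c)
    {α ε κ η m E ω : ℝ} {g b : ℂ} (hα : 0 < α) (hε : 0 < ε) (hεβ : ε ≤ β - 2 * α) (hκ : 0 < κ)
    (hκ' : κ < 1) (hη : 0 < η) (hm : 0 < m) (hE : E ≠ 0) (hω : 0 < ω)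
    (hκε : α + 2 * ε ≤ κ ^ 2 * c * ω) (hκω : α < κ * ω) (hb : 0 < b.re)
    (hκb : α < κ * b.re - η * |b.im|) (hηE : η * |E| < α) :
    {lam : ℝ | 1 ≤ lam ∧
      ¬ IsUnit (1 - reducedOp γ α (lam * m) (lam * E) (lam * ω) (lam * g) (lam * b))}.Finite := by
  set B : ℂ → L2 →L[ℂ] L2 := fun z => reducedOp γ α (z * m) (z * E) (z * ω) (z * g) (z * b) with hB
  have hαω : α < ω := hκω.trans_le (mul_le_of_le_one_left hω.le hκ'.le)
  have hαb : α < b.re := by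
    have h1 := mul_le_of_le_one_left hb.le hκ'.le
    have h2 := mul_nonneg hη.le (abs_nonneg b.im)
    linarith
  have hdiff : DifferentiableOn ℂ B (specStrip κ η) :=
    ((((differentiableOn_const _).add (differentiableOn_expOp hα hb hκb)).mul
      ((differentiableOn_const _).add (differentiableOn_besselOp hα hκ hω hκω))).mul
      (hγ.differentiableOn_pertKer hc hα.le hε hεβ hκ hκ' hm hω hκε)).mul
      ((differentiableOn_const _).add (differentiableOn_waveOp hα hκ hE hηE))
  have hfin : ∀ z ∈ specStrip κ η, IsFiniteRankLimit (B z) := fun z hz =>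
    (hγ.isSchur_pertKer hc hα.le hε hεβ hκ hκ' hm hω hκε hz.1).2.mul_mul _ _
  -- invertibility for large parameters
  obtain ⟨D, hD⟩ : ∃ D : ℝ, ∀ L : ℝ, 1 ≤ L → ‖B L‖ ≤ D / L := by
    set A₁ := ∫ x, Real.exp (α * |x|) * ‖g * expAbs b x‖
    set A₂ := ∫ x, Real.exp (α * |x|) * ‖(m : ℂ) * besselAbs ω x‖
    set A₃ := 2 * C₀ / (c ^ 3 * (1 - κ) ^ 3) * (m / ω ^ 2) * (2 / ε)
    set A₄ := m ^ 2 / |E| * (2 / α)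
    refine ⟨(1 + A₁) * (1 + A₂) * A₃ * (1 + A₄), fun L hL => ?_⟩
    have hL0 : 0 < L := by linarith
    have h1 : ‖(1 : L2 →L[ℂ] L2) + expOp α (L * g) (L * b)‖ ≤ 1 + A₁ :=
      (norm_add_le _ _).trans (add_le_add ContinuousLinearMap.norm_id_le (norm_expOp_le hα hαb hL))
    have h2 : ‖(1 : L2 →L[ℂ] L2) + besselOp α (L * m) (L * ω)‖ ≤ 1 + A₂ :=
      (norm_add_le _ _).trans
        (add_le_add ContinuousLinearMap.norm_id_le (norm_besselOp_le hα hαω hL))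
    have h3 : ‖kerOp (pertKer γ α (L * m) (L * ω))‖ ≤ A₃ / L ^ 2 :=
      hγ.norm_kerOp_pertKer_le hc hα.le hε hεβ hκ hκ' hm hω hκε hL
    have h4 : ‖weightOp α + waveOp α (L * m) (L * E)‖ ≤ L * (1 + A₄) := by
      refine (norm_add_le _ _).trans ?_
      have h5 : ‖weightOp α‖ ≤ 1 :=
        norm_mulOp_le (measurable_ofReal_weight _) (norm_weight_le_one (by linarith))
      have h6 := norm_waveOp_le (m := m) (E := E) hα hL
      linarith
    have p1 := (norm_nonneg _).trans h1
    have p2 := (norm_nonneg _).trans h2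
    have p3 := (norm_nonneg _).trans h3
    calc ‖B L‖ ≤ (1 + A₁) * (1 + A₂) * (A₃ / L ^ 2) * (L * (1 + A₄)) :=
          (norm_mul_le _ _).trans (mul_le_mul ((norm_mul_le _ _).trans (mul_le_mul
            ((norm_mul_le _ _).trans (mul_le_mul h1 h2 (norm_nonneg _) p1)) h3 (norm_nonneg _)
            (mul_nonneg p1 p2))) h4 (norm_nonneg _) (mul_nonneg (mul_nonneg p1 p2) p3))
      _ = (1 + A₁) * (1 + A₂) * A₃ * (1 + A₄) / L := by field_simp
  have hunit : ∀ L : ℝ, 1 ≤ L → D < L → IsUnit (1 - B L) := fun L hL hDL =>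
    isUnit_one_sub_of_norm_lt_one ((hD L hL).trans_lt ((div_lt_one (by linarith)).2 hDL))
  have hmem : ∀ L : ℝ, 1 ≤ L → (L : ℂ) ∈ specStrip κ η := fun L hL =>
    ofReal_mem_specStrip (hκ'.trans_le hL) hη
  -- The base point `max 1 (D + 1)` lies beyond `D`, where the Neumann series converges.
  have hev := eventually_isUnit_one_sub (isOpen_specStrip κ η) (isPreconnected_specStrip κ η) hdiff
    hfin (hmem (max 1 (D + 1)) (le_max_left _ _))
    (hunit _ (le_max_left _ _) (lt_of_lt_of_le (by linarith) (le_max_right _ _)))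
  refine (finite_of_eventually_nhdsNE (a := 1) (b := D) (p := fun z => IsUnit (1 - B z))
    fun x hx => hev _ (hmem x hx.1)).subset ?_
  rintro L ⟨hL, hLu⟩
  exact ⟨⟨hL, not_lt.1 fun h => hLu (hunit L hL h)⟩, hLu⟩

/-- Unique solvability of the integral equation from invertibility of `1 - B`. -/
theorem IsInterface.existsUnique_of_isUnit (hγ : IsInterface γ C₀ β) (hc : IsChordArcConst γ c)
    {α m E A : ℝ} {b : ℂ} (hα : 0 < α) (hm : 0 < m) (hE : E ≠ 0) (hEm : E ^ 2 < m ^ 2)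
    (hαω : α < c * freq m E) (hb : b ^ 2 = -(E ^ 2 + 2 * Complex.I * m ^ 2)) (hαb : α < b.re)
    (hM : IsSchur (pertKer γ α m (freq m E)) A)
    (hu : IsUnit (1 - reducedOp γ α m E (freq m E) (m ^ 2 * (1 + 2 * Complex.I) / (2 * b)) b))
    {f : Plane → ℂ} (hf : Integrable f) (hfc : HasCompactSupport f) :
    ∃! ρ : L2, ρ ∈ weightedL2 α ∧ SolvesBIE γ m E f ρ := by
  have hω0 : 0 < freq m E := Real.sqrt_pos.2 (sub_pos.2 hEm)
  have hω : α < freq m E :=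
    hαω.trans_le (mul_le_of_le_one_left hω0.le (hγ.chordArc_le_one hc))
  have hωE : freq m E ^ 2 + E ^ 2 = m ^ 2 := by
    rw [freq, Real.sq_sqrt (sub_nonneg.2 hEm.le), sub_add_cancel]
  have hmem : MemLp (fun t => (weight α t : ℂ) * (2 * m * incident (freq m E) f (γ t))) 2 volume :=
    (memLp_congr_ae (ae_of_all _ fun t => by ring)).1
      ((hγ.memLp_incident hc hω0 hα.le hαω hf hfc).const_mul (2 * (m : ℂ)))
  refine existsUnique_weightedL2 hα.le
    (fun ρ σ hσ => (solvesBIE_iff hα hω hM hσ hmem.coeFn_toLp).trans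
      (flat_equation_iff hα hm hE hωE hω hb hαb _ _)) (existsUnique_fixed hu _)

theorem IsInterface.exists_finite_existsUnique (hγ : IsInterface γ C₀ β)
    (hc : IsChordArcConst γ c) {m₀ E₀ : ℝ} (hm₀ : 0 < m₀) (hE₀ : E₀ ∈ Ioo (-m₀) m₀ \ {0})
    {αs : ℝ} (hαs : IsMaxWeight m₀ E₀ β c αs)
    {α : ℝ} (hα : α ∈ Ioc 0 αs) :
    ∃ S : Set ℝ, S.Finite ∧ ∀ lam ∈ Ici (1 : ℝ) \ S,
      ∀ f : Plane → ℂ, Integrable f → HasCompactSupport f →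
        ∃! ρ : L2,
          ρ ∈ weightedL2 α ∧
            SolvesBIE γ (lam * m₀) (lam * E₀) f ρ := by
  obtain ⟨hα0, hααs⟩ := hα
  have hc0 := hc.1
  have hE0 : E₀ ≠ 0 := hE₀.2
  have hω := freq_pos hE₀.1
  set ω := freq m₀ E₀ with hωdef
  have hαω : α < c * ω := hααs.trans_lt (hαs.lt_mul_freq hγ.β_pos hc0 hω)
  have hαβ : 2 * α < β := by linarith [hαs.two_mul_lt hc0 hω]
  set x := Real.sqrt ((Real.sqrt (4 * m₀ ^ 4 + E₀ ^ 4) - E₀ ^ 2) / 2) with hx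
  have hαx : α < x := hααs.trans_lt hαs.lt_rate
  have hx0 : 0 < x := hα0.trans hαx
  set b : ℂ := (x : ℂ) - Complex.I * (m₀ ^ 2 / x : ℝ) with hb
  have hb2 : b ^ 2 = -(E₀ ^ 2 + 2 * Complex.I * m₀ ^ 2) := flatRate_sq hx hx0
  have hbre : b.re = x := by
    rw [hb, Complex.sub_re, Complex.I_mul_re, Complex.ofReal_im, Complex.ofReal_re]
    ring
  -- The strict inequalities `α < cω` and `α < x` survive a factor slightly below 1. Having `κ < 1`
  -- also puts every `λ ≥ 1` inside the strip.
  obtain ⟨κ, hκ1, hκ2, hκω, hκx⟩ : ∃ κ : ℝ, 0 < κ ∧ κ < 1 ∧ α < κ ^ 2 * c * ω ∧ α < κ * x := by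
    have h1 : ∀ᶠ κ : ℝ in 𝓝[<] 1, α < κ ^ 2 * c * ω ∧ α < κ * x := nhdsWithin_le_nhds
      (((by fun_prop : Continuous fun κ : ℝ => κ ^ 2 * c * ω).continuousAt.eventually_const_lt
        (by simpa using hαω)).and
      ((by fun_prop : Continuous fun κ : ℝ => κ * x).continuousAt.eventually_const_lt
        (by simpa using hαx)))
    obtain ⟨κ, ⟨h2, h3⟩, h4, h5⟩ := (h1.and (Ioo_mem_nhdsLT zero_lt_one)).exists
    exact ⟨κ, h4, h5, h2, h3⟩
  obtain ⟨η, hη0, hηE, hηb⟩ : ∃ η : ℝ, 0 < η ∧ η * |E₀| < α ∧ α < κ * b.re - η * |b.im| := by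
    have h1 : ∀ᶠ η : ℝ in 𝓝[>] 0, η * |E₀| < α ∧ α < κ * b.re - η * |b.im| := nhdsWithin_le_nhds
      (((by fun_prop : Continuous fun η : ℝ => η * |E₀|).continuousAt.eventually_lt_const
        (by simpa using hα0)).and
      ((by fun_prop : Continuous fun η : ℝ =>
        κ * b.re - η * |b.im|).continuousAt.eventually_const_lt (by simpa [hbre] using hκx)))
    obtain ⟨η, ⟨h2, h3⟩, h4⟩ := (h1.and self_mem_nhdsWithin).exists
    exact ⟨η, h4, h2, h3⟩
  -- `ε` must fit into the gap of `2α < β`, and twice into the gap of `α < κ²cω`.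
  obtain ⟨ε, hε0, hε⟩ := exists_between
    (lt_min (sub_pos.2 hαβ) (half_pos (sub_pos.2 hκω)))
  obtain ⟨hε1, hε2⟩ := lt_min_iff.1 hε
  have hκε : α + 2 * ε ≤ κ ^ 2 * c * ω := by linarith
  have hκω' : α < κ * ω := by
    have h1 : κ * c ≤ 1 := mul_le_one₀ hκ2.le hc0.le (hγ.chordArc_le_one hc)
    calc α < κ * c * (κ * ω) := by linarith
      _ ≤ κ * ω := mul_le_of_le_one_left (by positivity) h1
  refine ⟨_, hγ.finite_not_isUnit hc (g := m₀ ^ 2 * (1 + 2 * Complex.I) / (2 * b)) hα0 hε0 hε1.le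
    hκ1 hκ2 hη0 hm₀ hE0 hω hκε hκω' (hbre ▸ hx0) hηb hηE, ?_⟩
  rintro lam ⟨hlam, hS⟩ f hf hfc
  have hlam1 : (1 : ℝ) ≤ lam := hlam
  have hlam0 : 0 < lam := by linarith
  have hu := not_not.1 fun h => hS ⟨hlam, h⟩
  have hfreq : freq (lam * m₀) (lam * E₀) = lam * ω := freq_mul hlam0.le _ _
  have hbne : b ≠ 0 := fun h => by
    rw [h, Complex.zero_re] at hbre
    exact hx0.ne hbre
  have hlamc : (lam : ℂ) ≠ 0 := Complex.ofReal_ne_zero.2 hlam0.ne'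
  obtain ⟨A, hM⟩ := (hγ.isSchur_pertKer hc hα0.le hε0 hε1.le hκ1 hκ2 hm₀ hω hκε
    (z := lam) (by simpa using hκ2.trans_le hlam1)).1
  have hre : ((lam : ℂ) * b).re = lam * x := by rw [Complex.re_ofReal_mul, hbre]
  have hcω : 0 < c * ω := by positivity
  refine hγ.existsUnique_of_isUnit hc (b := lam * b) (A := A) hα0 (by positivity)
    (mul_ne_zero hlam0.ne' hE0) ?_ ?_ ?_ ?_ ?_ ?_ hf hfc
  · rw [mul_pow, mul_pow]
    have := sq_lt_sq' hE₀.1.1 hE₀.1.2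
    gcongr
  · rw [hfreq]
    nlinarith
  · rw [mul_pow, hb2]
    push_cast
    ring
  · rw [hre]
    nlinarith
  · rw [hfreq]
    push_cast
    exact hM
  -- The coefficient `m²(1 + 2i)/(2b)` is homogeneous of degree one in `λ`, like `m`, `E`, `ω` and
  -- `b`, so the physical operator is the holomorphic family evaluated at `z = λ`.
  · have e : ((lam * m₀ : ℝ) : ℂ) ^ 2 * (1 + 2 * Complex.I) / (2 * (lam * b))
        = lam * (m₀ ^ 2 * (1 + 2 * Complex.I) / (2 * b)) := by
      push_cast
      field_simp
    rw [hfreq, e]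
    push_cast
    exact hu

end

end KleinGordonInterface

end

theorem mainTheorem1
    (γ : ℝ → KleinGordonInterface.Plane) (C₀ β c : ℝ)
    (hγ : KleinGordonInterface.IsInterface γ C₀ β)
    (hc : KleinGordonInterface.IsChordArcConst γ c)
    (m₀ E₀ : ℝ) (hm₀ : 0 < m₀) (hE₀ : E₀ ∈ Ioo (-m₀) m₀ \ {0})
    (αs : ℝ) (hαs : KleinGordonInterface.IsMaxWeight m₀ E₀ β c αs)
    (α : ℝ) (hα : α ∈ Ioc 0 αs) :
    ∃ S : Set ℝ, S.Finite ∧ ∀ lam ∈ Ici (1 : ℝ) \ S,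
      ∀ f : KleinGordonInterface.Plane → ℂ, Integrable f → HasCompactSupport f →
        ∃! ρ : Lp ℂ 2 (volume : Measure ℝ),
          ρ ∈ KleinGordonInterface.weightedL2 α ∧
            KleinGordonInterface.SolvesBIE γ (lam * m₀) (lam * E₀) f ρ :=
  KleinGordonInterface.IsInterface.exists_finite_existsUnique hγ hc hm₀ hE₀ hαs hα
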